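/- **Setting.** Let $G=(V,E)$ be a finite multigraph (loops and multiple edges allowed) without isolated vertices, given by the two endpoints of each edge, with $n=|E|\ge 1$. Its edges carry the qubits of a surface code. (The $m\times l$ square lattice of the torus, with $n=2ml$, is an example.) The syndrome $\partial A\subseteq V$ of a set $A\subseteq E$ is the set of vertices at which $A$ has an odd number of edge ends. The decoder receives $G$, an erasure $\varepsilon\subseteq E$ and the syndrome $\sigma=\partial E_Z$ of a $Z$-error $E_Z\subseteq E$; both $\varepsilon$ and $E_Z$ are arbitrary. **The Union-Find decoder.** Each edge is unoccupied, half-grown or grown; initially the edges of $\varepsilon$ are grown and the others are unoccupied. The clusters are the connected components of the graph of grown edges on $V$; a cluster is odd if it contains an odd number of vertices of $\sigma$. A boundary vertex is a vertex with an incident edge that is not grown. The decoder is the following program. 1. Explore the components of $\varepsilon$. Store each cluster as a tree of depth at most one, with its size and parity at the root and with a linked list of its boundary vertices. Initialize the table Support of edge states and the list $\mathcal L$ of roots of odd clusters. 2. While $\mathcal L\neq\emptyset$: (i) for each $u\in\mathcal L$, run over the boundary list of $u$ and grow all incident half-edges in Support; collect the newly grown edges in a list $\mathcal F$; (ii) for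 each $\{u,v\}\in\mathcal F$, if $\mathrm{Find}(u)\ne\mathrm{Find}(v)$ then apply Union, otherwise remove the edge from $\mathcal F$. Find uses path compression, and Union hangs the root of the smaller tree below the root of the larger one and updates size and parity; (iii) for each edge left in $\mathcal F$, append the boundary list of the smaller of the two clusters (before their fusion) to that of the larger one; (iv) replace each $u\in\mathcal L$ by $\mathrm{Find}(u)$, without duplicates; (v) for each $u\in\mathcal L$ whose cluster is odd, remove from its boundary list the vertices that are no longer boundary vertices (the list of an even cluster is cleaned up only once the cluster has become odd again); (vi) remove the roots of even clusters from $\mathcal L$. 3. Let $\varepsilon'$ be the set of grown edges, and apply the peeling decoder to $\varepsilon'$ and $\sigma$: build a spanning forest of $(V,\varepsilon')$ and peel it from the leaves. Whenever the peeled leaf carries a syndrome bit, put its edge into the correction $C$ and flip the bit at the other endpoint. **Cost model.** The program is written out for a deterministic random access machine with registers and arrays of natural numbers, in which each read, write, constant, addition, (truncated) subtraction and comparison costs one step. **Inverse Ackermann function.** $A(0,j)=2j$; for $i\ge1$, $A(i,0)=0$, $A(i,1)=2$ and $A(i,j)=A(i-1,A(i,j-1))$ for $j\ge2$; $\alpha(n)=\min\{i\ge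 0 : A(i,4)\ge\log_2 n\}$. **Theorem.** There are absolute constants $K,n_0$ such that for all $G,\varepsilon,E_Z$ as above the program terminates, writes only numbers that are at most $Kn$, and the following holds. * *Output.* $\varepsilon'$ is the set of grown edges that results from $\varepsilon$ when, in each round, all odd clusters grow simultaneously by one half-edge (each end of a not yet grown edge that lies in an odd cluster adds a half-edge, and two half-edges make the edge grown), until there is no odd cluster. The correction $C$ is contained in a spanning forest of $(V,\varepsilon')$ and satisfies $\partial C=\sigma$. * *Linear parts.* The initialization (1) takes at most $Kn$ steps, and so does the peeling block (3). In block (2), over the whole run, the fusion of boundary lists (iii) and their update (v) take at most $Kn$ steps, and so does everything else in block (2) (including the growth of Support) except for the calls of Find and Union. * *Total time.* If $n\ge n_0$, the total number of steps is at most $K\,n\,\alpha(n)$. Thus the decoder runs in worst-case time $O(n\,\alpha(n))$. -/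

import Mathlib

/-! ### The inverse Ackermann function -/

/-- Tarjan's version of Ackermann's function:
`A(0,j) = 2j`, `A(i,0) = 0`, `A(i,1) = 2`, `A(i,j) = A(i-1, A(i,j-1))`. -/
def ackermannA : ℕ → ℕ → ℕ
  | 0, j => 2 * j
  | _ + 1, 0 => 0
  | _ + 1, 1 => 2
  | i + 1, j + 2 => ackermannA i (ackermannA (i + 1) (j + 1))

/-- `α(n) = min { i | A(i,4) ≥ log₂ n }`. -/
noncomputable def inverseAckermann (n : ℕ) : ℕ :=
  sInf {i : ℕ | Real.logb 2 (n : ℝ) ≤ (ackermannA i 4 : ℝ)}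

set_option linter.constructorNameAsVariable false

namespace UFDecoder

/-! ### Lattices, errors and syndromes -/

/-- The vertices and edges of a lattice on a closed surface. The qubits are the edges. Loops and
multiple edges are allowed, as they occur on small tori. The `Z`-part of the code and its decoder
only depend on these data. -/
structure Lattice where
  numV : ℕ
  numE : ℕ
  src : Fin numE → Fin numV
  dst : Fin numE → Fin numV

namespace Lattice

variable (G : Lattice)

/-- Every vertex is an endpoint of some edge. -/
def NoIsolatedVertex : Prop :=
  ∀ v : Fin G.numV, ∃ e : Fin G.numE, G.src e = v ∨ G.dst e = v

/-- The syndrome of the `Z`-error supported on `A`: the vertices `v` at which the operator `X_v`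
anticommutes with the error, i.e. those at which `A` has an odd number of edge ends. -/
def syndrome (A : Finset (Fin G.numE)) : Finset (Fin G.numV) :=
  Finset.univ.filter fun v =>
    Odd ((A.filter fun e => G.src e = v).card + (A.filter fun e => G.dst e = v).card)

/-- `u` and `v` lie in the same connected component of the graph `(V, A)`. -/
def Connected (A : Finset (Fin G.numE)) (u v : Fin G.numV) : Prop :=
  Relation.EqvGen (fun x y => ∃ e ∈ A, G.src e = x ∧ G.dst e = y) u v

/-! ### Syndrome validation

A growth state assigns to each edge `0` (unoccupied), `1` (half-grown) or `2` (grown). -/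

/-- The fully grown edges of a growth state. -/
def grown (S : Fin G.numE → ℕ) : Finset (Fin G.numE) :=
  Finset.univ.filter fun e => S e = 2

open Classical in
/-- The cluster of `v` (its component in the graph of grown edges) contains an odd number of
syndrome vertices. -/
def InOddCluster (σ : Finset (Fin G.numV)) (S : Fin G.numE → ℕ) (v : Fin G.numV) : Prop :=
  Odd (σ.filter fun w => G.Connected (G.grown S) v w).card

/-- The initial state: erased edges are grown, all others are unoccupied. -/
def initialGrowth (ε : Finset (Fin G.numE)) : Fin G.numE → ℕ :=
  fun e => if e ∈ ε then 2 else 0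

open Classical in
/-- One round: every odd cluster grows by one half-edge. Each end of an edge that lies in an odd
cluster adds a half-edge, until the edge is grown. -/
noncomputable def growRound (σ : Finset (Fin G.numV)) (S : Fin G.numE → ℕ) : Fin G.numE → ℕ :=
  fun e => min 2 (S e + (if G.InOddCluster σ S (G.src e) then 1 else 0)
                      + (if G.InOddCluster σ S (G.dst e) then 1 else 0))

/-- `ε'` is the modified erasure obtained from `ε`: rounds of growth are performed until there is
no odd cluster, and the grown edges are then erased. (A round without odd cluster changes nothing,
so `ε'` is unique.) -/
def IsValidatedErasure (ε : Finset (Fin G.numE)) (σ : Finset (Fin G.numV))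
    (ε' : Finset (Fin G.numE)) : Prop :=
  ∃ k : ℕ, (∀ v, ¬ G.InOddCluster σ ((G.growRound σ)^[k] (G.initialGrowth ε)) v) ∧
    ε' = G.grown ((G.growRound σ)^[k] (G.initialGrowth ε))

/-- `F` is a spanning forest of `(V, A)`: each edge of `F` is a bridge of `F`, and the endpoints
of each edge of `A` are connected by `F`. -/
def IsSpanningForest (A F : Finset (Fin G.numE)) : Prop :=
  F ⊆ A ∧ (∀ e ∈ F, ¬ G.Connected (F.erase e) (G.src e) (G.dst e)) ∧
    ∀ e ∈ A, G.Connected F (G.src e) (G.dst e)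

/-- `C` is a correction returned by the peeling decoder on the erasure `ε'` and the syndrome `σ`:
it is supported on a spanning forest of the erasure and its syndrome is `σ`. (For a given forest
there is at most one such `C`.) -/
def IsPeelingCorrection (ε' : Finset (Fin G.numE)) (σ : Finset (Fin G.numV))
    (C : Finset (Fin G.numE)) : Prop :=
  ∃ F, G.IsSpanningForest ε' F ∧ C ⊆ F ∧ G.syndrome C = σ

end Lattice

/-- The square lattice of the `m × l` torus, with `2ml` edges. The edge `2q` goes from the vertex
`q = a + m b` to `(a+1, b)` and the edge `2q+1` goes from `q` to `(a, b+1)`. -/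
def toricLattice (m l : ℕ) : Lattice where
  numV := m * l
  numE := m * l * 2
  src e := e.divNat
  dst e :=
    have hq : e.val / 2 < m * l := by have := e.isLt; omega
    have hm : 0 < m := Nat.pos_of_ne_zero fun h => by simp [h] at hq
    have hl : 0 < l := Nat.pos_of_ne_zero fun h => by simp [h] at hq
    let a := e.val / 2 % m
    let b := e.val / 2 / m
    if e.val % 2 = 0 then
      ⟨(a + 1) % m + m * b, by
        have h1 : (a + 1) % m < m := Nat.mod_lt _ hm
        have h2 : b < l := Nat.div_lt_of_lt_mul hq
        nlinarith⟩
    else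
      ⟨a + m * ((b + 1) % l), by
        have h1 : a < m := Nat.mod_lt _ hm
        have h2 : (b + 1) % l < l := Nat.mod_lt _ hl
        nlinarith⟩

theorem toricLattice_noIsolatedVertex (m l : ℕ) : (toricLattice m l).NoIsolatedVertex := by
  intro v
  have hv : v.val < m * l := v.isLt
  refine ⟨⟨v.val * 2, show v.val * 2 < m * l * 2 by omega⟩, Or.inl (Fin.ext ?_)⟩
  show v.val * 2 / 2 = v.val
  omega

/-! ### A random access machine with a step count -/

/-- The registers. -/
inductive Var
  | numV | numE | i | j | k | d | e | u | v | w | x | y | z | r | a | b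
  | front | back | lenL | lenF | flag
  deriving DecidableEq

/-- The tables (arrays) in memory. -/
inductive Tab
  -- input: endpoints of edges, erasure, syndrome
  | src | dst | erased | syn
  -- incidence lists: first edge end at a vertex, next edge end, its edge, its far vertex
  | first | next | edge | target
  -- cluster-trees; size and parity are stored at the roots
  | parent | size | parity
  -- state of an edge (0 unoccupied, 1 half-grown, 2 grown) and where it was half-grown from
  | support | origin
  -- boundary lists: first and last vertex at the roots, next vertex of a list
  | bFirst | bLast | bNext
  -- the list of odd roots and the indicator of its members
  | roots | mark
  -- the list of fusion edges, with the roots of the larger and of the smaller cluster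
  | fusion | fLarge | fSmall
  -- graph exploration
  | seen | queue
  -- peeling: spanning forest and remaining syndrome
  | treeEdge | treeParent | rest
  -- output
  | modErased | correction
  deriving DecidableEq

/-- The headings under which the steps are counted. -/
inductive Phase
  | initialization | growth | unionFind | boundaryLists | peeling
  deriving DecidableEq

instance : Fintype Phase where
  elems := {.initialization, .growth, .unionFind, .boundaryLists, .peeling}
  complete p := by cases p <;> decide

structure Store where
  var : Var → ℕ
  tab : Tab → ℕ → ℕ

def Store.setVar (s : Store) (x : Var) (k : ℕ) : Store :=
  { s with var := Function.update s.var x k }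

def Store.setTab (s : Store) (a : Tab) (i k : ℕ) : Store :=
  { s with tab := Function.update s.tab a (Function.update (s.tab a) i k) }

inductive Expr
  | lit (k : ℕ)
  | var (x : Var)
  | get (a : Tab) (i : Expr)
  | add (e f : Expr)
  | sub (e f : Expr)

namespace Expr

def eval (s : Store) : Expr → ℕ
  | lit k => k
  | var x => s.var x
  | get a i => s.tab a (i.eval s)
  | add e f => e.eval s + f.eval s
  | sub e f => e.eval s - f.eval s

/-- The number of operations in an expression. -/
def cost : Expr → ℕ
  | lit _ => 1
  | var _ => 1
  | get _ i => i.cost + 1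
  | add e f => e.cost + f.cost + 1
  | sub e f => e.cost + f.cost + 1

end Expr

inductive Test
  | eq (e f : Expr)
  | ne (e f : Expr)
  | lt (e f : Expr)

namespace Test

def Holds (s : Store) : Test → Prop
  | eq e f => e.eval s = f.eval s
  | ne e f => e.eval s ≠ f.eval s
  | lt e f => e.eval s < f.eval s

def cost : Test → ℕ
  | eq e f => e.cost + f.cost + 1
  | ne e f => e.cost + f.cost + 1
  | lt e f => e.cost + f.cost + 1

end Test

inductive Cmd
  | skip
  | set (x : Var) (e : Expr)
  | put (a : Tab) (i e : Expr)
  | seq (c c' : Cmd)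
  | ite (b : Test) (c c' : Cmd)
  | loop (b : Test) (c : Cmd)
  /-- run `c`, counting its steps under the heading `p` -/
  | charge (p : Phase) (c : Cmd)

infixr:60 " ;; " => Cmd.seq

/-- `Exec W p c s t s'`: the command `c`, started in the store `s`, terminates in the store `s'`;
`t q` is the number of steps counted under the heading `q`, where `p` is the heading in force at
the start. All operations have unit cost, and every number written to memory is at most `W`. -/
inductive Exec (W : ℕ) : Phase → Cmd → Store → (Phase → ℕ) → Store → Prop
  | skip (p : Phase) (s : Store) : Exec W p .skip s (Pi.single p 1) s
  | set (p : Phase) (x : Var) (e : Expr) (s : Store) (h : e.eval s ≤ W) :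
      Exec W p (.set x e) s (Pi.single p (e.cost + 1)) (s.setVar x (e.eval s))
  | put (p : Phase) (a : Tab) (i e : Expr) (s : Store) (h : e.eval s ≤ W) :
      Exec W p (.put a i e) s (Pi.single p (i.cost + e.cost + 1))
        (s.setTab a (i.eval s) (e.eval s))
  | seq (p : Phase) (c c' : Cmd) (s s₁ s₂ : Store) (t₁ t₂ : Phase → ℕ)
      (h₁ : Exec W p c s t₁ s₁) (h₂ : Exec W p c' s₁ t₂ s₂) :
      Exec W p (.seq c c') s (t₁ + t₂) s₂
  | ite_true (p : Phase) (b : Test) (c c' : Cmd) (s s₁ : Store) (t : Phase → ℕ)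
      (hb : b.Holds s) (h : Exec W p c s t s₁) :
      Exec W p (.ite b c c') s (Pi.single p b.cost + t) s₁
  | ite_false (p : Phase) (b : Test) (c c' : Cmd) (s s₁ : Store) (t : Phase → ℕ)
      (hb : ¬ b.Holds s) (h : Exec W p c' s t s₁) :
      Exec W p (.ite b c c') s (Pi.single p b.cost + t) s₁
  | loop_true (p : Phase) (b : Test) (c : Cmd) (s s₁ s₂ : Store) (t₁ t₂ : Phase → ℕ)
      (hb : b.Holds s) (h₁ : Exec W p c s t₁ s₁) (h₂ : Exec W p (.loop b c) s₁ t₂ s₂) :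
      Exec W p (.loop b c) s (Pi.single p b.cost + t₁ + t₂) s₂
  | loop_false (p : Phase) (b : Test) (c : Cmd) (s : Store) (hb : ¬ b.Holds s) :
      Exec W p (.loop b c) s (Pi.single p b.cost) s
  | charge (p q : Phase) (c : Cmd) (s s₁ : Store) (t : Phase → ℕ) (h : Exec W q c s t s₁) :
      Exec W p (.charge q c) s t s₁

/-- The machine is deterministic: its final store and its running time are functions of the
initial store. -/
theorem Exec.deterministic {W W' : ℕ} {p : Phase} {c : Cmd} {s s₁ s₂ : Store} {t₁ t₂ : Phase → ℕ}
    (h₁ : Exec W p c s t₁ s₁) (h₂ : Exec W' p c s t₂ s₂) : t₁ = t₂ ∧ s₁ = s₂ := by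
  induction h₁ generalizing t₂ s₂ with
  | skip | set | put => cases h₂; exact ⟨rfl, rfl⟩
  | seq p c c' s s₁ s₂ t₁ t₂ _ _ ih₁ ih₂ =>
    cases h₂ with
    | seq _ _ _ _ _ _ _ _ g₁ g₂ =>
      obtain ⟨rfl, rfl⟩ := ih₁ g₁
      obtain ⟨rfl, rfl⟩ := ih₂ g₂
      exact ⟨rfl, rfl⟩
  | ite_true p b c c' s s₁ t hb _ ih =>
    cases h₂ with
    | ite_true _ _ _ _ _ _ _ _ g => obtain ⟨rfl, rfl⟩ := ih g; exact ⟨rfl, rfl⟩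
    | ite_false _ _ _ _ _ _ _ hb' g => exact absurd hb hb'
  | ite_false p b c c' s s₁ t hb _ ih =>
    cases h₂ with
    | ite_true _ _ _ _ _ _ _ hb' g => exact absurd hb' hb
    | ite_false _ _ _ _ _ _ _ _ g => obtain ⟨rfl, rfl⟩ := ih g; exact ⟨rfl, rfl⟩
  | loop_true p b c s s₁ s₂ t₁ t₂ hb _ _ ih₁ ih₂ =>
    cases h₂ with
    | loop_true _ _ _ _ _ _ _ _ _ g₁ g₂ =>
      obtain ⟨rfl, rfl⟩ := ih₁ g₁
      obtain ⟨rfl, rfl⟩ := ih₂ g₂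
      exact ⟨rfl, rfl⟩
    | loop_false _ _ _ _ hb' => exact absurd hb hb'
  | loop_false p b c s hb =>
    cases h₂ with
    | loop_true _ _ _ _ _ _ _ _ hb' _ _ => exact absurd hb' hb
    | loop_false _ _ _ _ _ => exact ⟨rfl, rfl⟩
  | charge p q c s s₁ t _ ih =>
    cases h₂ with
    | charge _ _ _ _ _ _ g => exact ih g

/-! ### The decoder

In memory the vertices are numbered from `1`, the edges from `0`. Each edge `e` has the two edge
ends `2e+1` (at its source) and `2e+2` (at its other endpoint). The number `0` ends every list. -/

namespace Cmd

open UFDecoder.Expr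

def incr (x : Var) : Cmd := set x (add (var x) (lit 1))

/-- Body of a loop over the edge ends `d` at the vertex in `x`. -/
def forEnds (x : Var) (c : Cmd) : Cmd :=
  set .d (get .first (var x)) ;;
  loop (.ne (var .d) (lit 0)) (c ;; set .d (get .next (var .d)))

/-- Replaces the bit `a[i]` by `1 - a[i]`. -/
def flip (a : Tab) (i : Expr) : Cmd := put a i (sub (lit 1) (get a i))

/-- `y := Find(x)` with path compression: walk up to the root `y`, then let all vertices
encountered on the path point to `y`. -/
def find (x y : Var) : Cmd :=
  charge .unionFind (
    set y (var x) ;;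
    loop (.ne (get .parent (var y)) (var y)) (set y (get .parent (var y))) ;;
    set .z (var x) ;;
    loop (.ne (var .z) (var y))
      (set .w (get .parent (var .z)) ;;
       put .parent (var .z) (var y) ;;
       set .z (var .w)))

/-- Weighted union of the clusters with the distinct roots `a` and `b`: the tree of the smaller one
becomes a subtree of the root of the larger one, whose size and parity are updated. Afterwards `a`
is the root of the larger one and `b` the root of the smaller one. -/
def union : Cmd :=
  charge .unionFind (
    ite (.lt (get .size (var .a)) (get .size (var .b)))
      (set .z (var .a) ;; set .a (var .b) ;; set .b (var .z)) skip ;;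
    put .parent (var .b) (var .a) ;;
    put .size (var .a) (add (get .size (var .a)) (get .size (var .b))) ;;
    ite (.eq (get .parity (var .b)) (lit 1)) (flip .parity (var .a)) skip)

/-- `flag := 1` if the vertex `v` is a boundary vertex, i.e. if some edge at `v` is not grown,
and `flag := 0` otherwise. -/
def testBoundary : Cmd :=
  set .flag (lit 0) ;;
  forEnds .v (ite (.ne (get .support (get .edge (var .d))) (lit 2)) (set .flag (lit 1)) skip)

/-- Appends the vertex `v` to the boundary list of the root `r`. -/
def appendVertex : Cmd :=
  put .bNext (var .v) (lit 0) ;;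
  ite (.eq (get .bFirst (var .r)) (lit 0))
    (put .bFirst (var .r) (var .v))
    (put .bNext (get .bLast (var .r)) (var .v)) ;;
  put .bLast (var .r) (var .v)

/-- Appends the boundary list of the root `b` at the end of the boundary list of the root `a`. -/
def appendList : Cmd :=
  ite (.eq (get .bFirst (var .b)) (lit 0)) skip (
    ite (.eq (get .bFirst (var .a)) (lit 0))
      (put .bFirst (var .a) (get .bFirst (var .b)))
      (put .bNext (get .bLast (var .a)) (get .bFirst (var .b))) ;;
    put .bLast (var .a) (get .bLast (var .b)))

/-- Incidence lists and the table `support`: erased edges are grown, the others unoccupied. -/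
def initTables : Cmd :=
  set .v (lit 1) ;;
  loop (.lt (var .v) (add (var .numV) (lit 1)))
    (put .first (var .v) (lit 0) ;;
     put .seen (var .v) (lit 0) ;;
     put .mark (var .v) (lit 0) ;;
     incr .v) ;;
  set .e (lit 0) ;;
  set .d (lit 1) ;;
  loop (.lt (var .e) (var .numE))
    (put .edge (var .d) (var .e) ;;
     put .target (var .d) (get .dst (var .e)) ;;
     put .next (var .d) (get .first (get .src (var .e))) ;;
     put .first (get .src (var .e)) (var .d) ;;
     incr .d ;;
     put .edge (var .d) (var .e) ;;
     put .target (var .d) (get .src (var .e)) ;;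
     put .next (var .d) (get .first (get .dst (var .e))) ;;
     put .first (get .dst (var .e)) (var .d) ;;
     incr .d ;;
     ite (.eq (get .erased (var .e)) (lit 1))
       (put .support (var .e) (lit 2)) (put .support (var .e) (lit 0)) ;;
     incr .e)

/-- Explores the components of the erased edges. Each component becomes a cluster-tree of depth at
most one with a boundary list; the roots of the odd clusters are listed in `roots` and marked. -/
def initClusters : Cmd :=
  set .lenL (lit 0) ;;
  set .r (lit 1) ;;
  loop (.lt (var .r) (add (var .numV) (lit 1)))
    (ite (.eq (get .seen (var .r)) (lit 0))
      (put .seen (var .r) (lit 1) ;;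
       put .size (var .r) (lit 0) ;;
       put .parity (var .r) (lit 0) ;;
       put .bFirst (var .r) (lit 0) ;;
       put .queue (lit 0) (var .r) ;;
       set .front (lit 0) ;;
       set .back (lit 1) ;;
       loop (.lt (var .front) (var .back))
         (set .v (get .queue (var .front)) ;;
          incr .front ;;
          put .parent (var .v) (var .r) ;;
          put .size (var .r) (add (get .size (var .r)) (lit 1)) ;;
          ite (.eq (get .syn (var .v)) (lit 1)) (flip .parity (var .r)) skip ;;
          forEnds .v
            (ite (.eq (get .support (get .edge (var .d))) (lit 2))
              (set .w (get .target (var .d)) ;;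
               ite (.eq (get .seen (var .w)) (lit 0))
                 (put .seen (var .w) (lit 1) ;;
                  put .queue (var .back) (var .w) ;;
                  incr .back) skip) skip) ;;
          testBoundary ;;
          ite (.eq (var .flag) (lit 1)) appendVertex skip) ;;
       ite (.eq (get .parity (var .r)) (lit 1))
         (put .roots (var .lenL) (var .r) ;;
          put .mark (var .r) (lit 1) ;;
          incr .lenL) skip) skip ;;
     incr .r)

/-- Grows the clusters of the roots in `roots` by a half-edge; the newly grown edges form the
list `fusion`. -/
def growClusters : Cmd :=
  charge .growth (
    set .lenF (lit 0) ;;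
    set .j (lit 0) ;;
    loop (.lt (var .j) (var .lenL))
      (set .v (get .bFirst (get .roots (var .j))) ;;
       loop (.ne (var .v) (lit 0))
         (forEnds .v
           (set .e (get .edge (var .d)) ;;
            ite (.eq (get .support (var .e)) (lit 0))
              (put .support (var .e) (lit 1) ;;
               put .origin (var .e) (var .v))
              (ite (.eq (get .support (var .e)) (lit 1))
                (put .support (var .e) (lit 2) ;;
                 put .fusion (var .lenF) (var .e) ;;
                 incr .lenF) skip)) ;;
          set .v (get .bNext (var .v))) ;;
       incr .j))

/-- For each edge `{u,v}` of `fusion`: if `Find(u) ≠ Find(v)`, merge the clusters and keep the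
edge, together with the roots of both clusters before the fusion; otherwise remove the edge. -/
def fuseClusters : Cmd :=
  charge .growth (
    set .k (lit 0) ;;
    set .j (lit 0) ;;
    loop (.lt (var .j) (var .lenF))
      (set .e (get .fusion (var .j)) ;;
       set .u (get .src (var .e)) ;;
       find .u .a ;;
       set .v (get .dst (var .e)) ;;
       find .v .b ;;
       ite (.ne (var .a) (var .b))
         (union ;;
          put .fusion (var .k) (var .e) ;;
          put .fLarge (var .k) (var .a) ;;
          put .fSmall (var .k) (var .b) ;;
          incr .k) skip ;;
       incr .j) ;;
    set .lenF (var .k))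

/-- For each remaining fusion edge, append the boundary list of the smaller cluster (before fusion)
at the end of that of the larger one. -/
def fuseBoundaryLists : Cmd :=
  charge .boundaryLists (
    set .j (lit 0) ;;
    loop (.lt (var .j) (var .lenF))
      (set .a (get .fLarge (var .j)) ;;
       set .b (get .fSmall (var .j)) ;;
       appendList ;;
       incr .j))

/-- Replaces each `u` in `roots` by `Find(u)`, without creating duplicates. -/
def updateRoots : Cmd :=
  charge .growth (
    set .k (lit 0) ;;
    set .j (lit 0) ;;
    loop (.lt (var .j) (var .lenL))
      (set .u (get .roots (var .j)) ;;
       find .u .y ;;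
       ite (.eq (var .y) (var .u))
         (put .roots (var .k) (var .u) ;;
          incr .k)
         (put .mark (var .u) (lit 0) ;;
          ite (.eq (get .mark (var .y)) (lit 0))
            (put .mark (var .y) (lit 1) ;;
             put .roots (var .k) (var .y) ;;
             incr .k) skip) ;;
       incr .j) ;;
    set .lenL (var .k))

/-- For each root in `roots` whose cluster is odd, run over its boundary list and remove the
vertices that are not boundary vertices. (The list of an even cluster, which is about to leave
`roots`, is only cleaned up once the cluster has become odd again, before it is next used.) -/
def updateBoundaryLists : Cmd :=
  charge .boundaryLists (
    set .j (lit 0) ;;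
    loop (.lt (var .j) (var .lenL))
      (set .r (get .roots (var .j)) ;;
       ite (.eq (get .parity (var .r)) (lit 1))
         (set .v (get .bFirst (var .r)) ;;
          put .bFirst (var .r) (lit 0) ;;
          loop (.ne (var .v) (lit 0))
            (set .x (get .bNext (var .v)) ;;
             testBoundary ;;
             ite (.eq (var .flag) (lit 1)) appendVertex skip ;;
             set .v (var .x))) skip ;;
       incr .j))

/-- Removes the roots of even clusters from `roots`. -/
def removeEvenRoots : Cmd :=
  charge .growth (
    set .k (lit 0) ;;
    set .j (lit 0) ;;
    loop (.lt (var .j) (var .lenL))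
      (set .u (get .roots (var .j)) ;;
       ite (.eq (get .parity (var .u)) (lit 1))
         (put .roots (var .k) (var .u) ;;
          incr .k)
         (put .mark (var .u) (lit 0)) ;;
       incr .j) ;;
    set .lenL (var .k))

/-- Erases the grown edges. -/
def eraseGrown : Cmd :=
  set .e (lit 0) ;;
  loop (.lt (var .e) (var .numE))
    (ite (.eq (get .support (var .e)) (lit 2))
       (put .modErased (var .e) (lit 1)) (put .modErased (var .e) (lit 0)) ;;
     incr .e)

/-- The peeling decoder on the erasure `modErased`: build a spanning forest by exploration, then
peel it, leaves first. When the leaf `v` still carries a syndrome bit, its edge joins the correction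
and the bit at the other endpoint is flipped. -/
def peel : Cmd :=
  set .v (lit 1) ;;
  loop (.lt (var .v) (add (var .numV) (lit 1)))
    (put .seen (var .v) (lit 0) ;;
     put .rest (var .v) (get .syn (var .v)) ;;
     incr .v) ;;
  set .e (lit 0) ;;
  loop (.lt (var .e) (var .numE))
    (put .correction (var .e) (lit 0) ;;
     incr .e) ;;
  set .front (lit 0) ;;
  set .back (lit 0) ;;
  set .r (lit 1) ;;
  loop (.lt (var .r) (add (var .numV) (lit 1)))
    (ite (.eq (get .seen (var .r)) (lit 0))
      (put .seen (var .r) (lit 1) ;;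
       put .treeParent (var .r) (lit 0) ;;
       put .queue (var .back) (var .r) ;;
       incr .back ;;
       loop (.lt (var .front) (var .back))
         (set .v (get .queue (var .front)) ;;
          incr .front ;;
          forEnds .v
            (set .w (get .target (var .d)) ;;
             ite (.eq (get .modErased (get .edge (var .d))) (lit 1))
               (ite (.eq (get .seen (var .w)) (lit 0))
                 (put .seen (var .w) (lit 1) ;;
                  put .treeParent (var .w) (var .v) ;;
                  put .treeEdge (var .w) (get .edge (var .d)) ;;
                  put .queue (var .back) (var .w) ;;
                  incr .back) skip) skip))) skip ;;
     incr .r) ;;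
  loop (.lt (lit 0) (var .back))
    (set .back (sub (var .back) (lit 1)) ;;
     set .v (get .queue (var .back)) ;;
     ite (.ne (get .treeParent (var .v)) (lit 0))
       (ite (.eq (get .rest (var .v)) (lit 1))
         (put .correction (get .treeEdge (var .v)) (lit 1) ;;
          put .rest (var .v) (lit 0) ;;
          flip .rest (get .treeParent (var .v))) skip) skip)

/-- One round of syndrome validation. -/
def growthRound : Cmd :=
  growClusters ;; fuseClusters ;; fuseBoundaryLists ;; updateRoots ;; updateBoundaryLists ;;
  removeEvenRoots

/-- The Union-Find decoder. -/
def unionFindDecoder : Cmd :=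
  charge .initialization (initTables ;; initClusters) ;;
  charge .growth (loop (.ne (var .lenL) (lit 0)) growthRound) ;;
  charge .peeling (eraseGrown ;; peel)

end Cmd

open Classical in
/-- The initial store for the lattice `G`, the erasure `ε` and the syndrome `σ`. -/
noncomputable def inputStore (G : Lattice) (ε : Finset (Fin G.numE)) (σ : Finset (Fin G.numV)) :
    Store where
  var
    | .numV => G.numV
    | .numE => G.numE
    | _ => 0
  tab
    | .src => fun i => if h : i < G.numE then (G.src ⟨i, h⟩).val + 1 else 0
    | .dst => fun i => if h : i < G.numE then (G.dst ⟨i, h⟩).val + 1 else 0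
    | .erased => fun i => if ∃ e ∈ ε, e.val = i then 1 else 0
    | .syn => fun i => if ∃ v ∈ σ, v.val + 1 = i then 1 else 0
    | _ => fun _ => 0

/-- The set of edges whose entry in the table `a` is `1`. -/
def edgeSet (G : Lattice) (s : Store) (a : Tab) : Finset (Fin G.numE) :=
  Finset.univ.filter fun e => s.tab a e.val = 1

end UFDecoder

set_option linter.constructorNameAsVariable false

/-! The proof couples an invariant for the data structures with potentials that pay for the steps.
`Wp` asserts that a run ends in a store and at a time with a given property, so correctness and
running time are carried through the program together. `Frame` supplies for free everything that a
command visibly leaves alone.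

Growth is correct because of the invariant `Represents`. The parent table is a forest whose root map
labels exactly the components of the grown edges, the roots carry sizes and parities, every boundary
vertex stands on the list of its cluster, the lists of odd clusters contain nothing else, and
`roots` lists exactly the odd roots. An edge that is not grown has two boundary vertices as
endpoints, so running over the lists of the odd roots adds precisely the half-edges of `growRound`
(`Represents.growRound_eq`). A cluster that is odd after the fusions contains one that was odd
before (`exists_odd_of_odd_synCount`), so the Find images of the old odd roots include all new ones.

The linear bounds rest on `growthPotential`. A visit to a vertex costs its degree plus one, up to a
constant. When a boundary vertex grows, all its edges that are not grown advance, so its `credit`,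
the maximum of 2 minus the state over its edges, drops; it starts at 2 or less. Hence the total
weight of the vertices that grow during the whole run is at most 2(2n + |V|), and |V| ≤ 2n because
no vertex is isolated. The numbers of odd roots and of fusion edges in a round are bounded by the
same weight. For the roots this needs that the list of an odd cluster is nonempty: a cluster without
boundary vertices is closed under all edges, so by the handshake lemma it contains an even part of
the syndrome of E_Z (`Represents.list_ne_nil`). In the cleaning of lists, an inspected vertex either
leaves its list, which is paid by `listedWeight`, a quantity that never increases, or it stays on
the list of an odd cluster and grows in the next round, which pays for it one round late.

For Find and Union, the rank of a vertex is the binary logarithm of its stored size; for a non-root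
that size is frozen (0 in the initial stars). Ranks increase strictly towards the root. With h_k the
functions of `hierarchy`, a vertex of rank r whose parent has rank p has as potential the number of
pairs (k, i) with k < A, 1 ≤ i ≤ r and p < h_k^i(r). Path compression raises the ranks of parents,
and every vertex of positive rank whose level recurs later on the path loses a unit
(`potential_lt_of_level_eq`). At most A + 1 vertices of a path escape (`Path.potential_compress`). A
union raises the rank of one root by at most one, which adds at most A. The initial potential is at
most A|V|, so every operation costs O(A) amortized, for each A with log₂|V| < h_A(1). By comparison
with Ackermann's function, A = α(n) + 3 qualifies (`log_lt_hierarchy`).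

Peeling uses that the exploration queue holds parents before children, so that its reversal removes
leaves first. The syndrome bit of a vertex with a parent is settled when it is peeled and never
touched again. In each tree only the root may be wrong, and it is not: the given syndrome is even
there, since no odd cluster remains, and the syndrome of the correction is even by the handshake
lemma (`PeelInv.syndrome_eq`). -/

namespace UFDecoder

/-! ### A program logic with time -/

/-- `t` with `k` further steps under the heading `p`. -/
def tick (p : Phase) (k : ℕ) (t : Phase → ℕ) : Phase → ℕ := t + Pi.single p k

@[simp] theorem tick_apply (p q : Phase) (k : ℕ) (t : Phase → ℕ) :
    tick p k t q = if q = p then t q + k else t q := by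
  by_cases h : q = p
  · subst h; simp [tick]
  · simp [tick, h]

@[simp] theorem tick_tick (p : Phase) (k l : ℕ) (t : Phase → ℕ) :
    tick p k (tick p l t) = tick p (l + k) t := by
  simp [tick, add_assoc, ← Pi.single_add]

theorem le_tick (p : Phase) (k : ℕ) (t : Phase → ℕ) : t ≤ tick p k t := by
  intro q; simp; split <;> omega

@[simp] theorem Store.setVar_var (s : Store) (x y : Var) (k : ℕ) :
    (s.setVar x k).var y = if y = x then k else s.var y := by
  simp [Store.setVar, Function.update_apply]

@[simp] theorem Store.setVar_tab (s : Store) (x : Var) (k : ℕ) : (s.setVar x k).tab = s.tab := rfl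

@[simp] theorem Store.setTab_var (s : Store) (a : Tab) (i k : ℕ) :
    (s.setTab a i k).var = s.var := rfl

@[simp] theorem Store.setTab_tab (s : Store) (a b : Tab) (i k : ℕ) :
    (s.setTab a i k).tab b = if b = a then Function.update (s.tab a) i k else s.tab b := by
  simp [Store.setTab, Function.update_apply]

/-- All numbers in memory are at most `W`. -/
structure Store.Bounded (W : ℕ) (s : Store) : Prop where
  var : ∀ x, s.var x ≤ W
  tab : ∀ a i, s.tab a i ≤ W

theorem Store.Bounded.setVar {W : ℕ} {s : Store} (h : s.Bounded W) {x : Var} {k : ℕ}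
    (hk : k ≤ W) : (s.setVar x k).Bounded W :=
  ⟨fun y => by rw [Store.setVar_var]; split; exacts [hk, h.var y], h.tab⟩

theorem Store.Bounded.setTab {W : ℕ} {s : Store} (h : s.Bounded W) {a : Tab} {i k : ℕ}
    (hk : k ≤ W) : (s.setTab a i k).Bounded W :=
  ⟨h.var, fun b j => by
    rw [Store.setTab_tab]; split
    · rw [Function.update_apply]; split
      exacts [hk, h.tab _ _]
    · exact h.tab _ _⟩

theorem Exec.bounded {W p c s t s'} (h : Exec W p c s t s') (hs : s.Bounded W) :
    s'.Bounded W := by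
  induction h with
  | skip => exact hs
  | set p x e s h => exact hs.setVar h
  | put p a i e s h => exact hs.setTab h
  | seq _ _ _ _ _ _ _ _ _ _ ih₁ ih₂ => exact ih₂ (ih₁ hs)
  | ite_true _ _ _ _ _ _ _ _ _ ih => exact ih hs
  | ite_false _ _ _ _ _ _ _ _ _ ih => exact ih hs
  | loop_true _ _ _ _ _ _ _ _ _ _ _ ih₁ ih₂ => exact ih₂ (ih₁ hs)
  | loop_false => exact hs
  | charge _ _ _ _ _ _ _ ih => exact ih hs

/-! ### Syntactic frame conditions. -/

namespace Cmd

/-- Whether the command contains an assignment to the register. -/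
def writesVar : Cmd → Var → Bool
  | skip, _ => false
  | set x _, y => decide (y = x)
  | put _ _ _, _ => false
  | seq c c', y => c.writesVar y || c'.writesVar y
  | ite _ c c', y => c.writesVar y || c'.writesVar y
  | loop _ c, y => c.writesVar y
  | charge _ c, y => c.writesVar y

/-- Whether the command contains an assignment to the table. -/
def writesTab : Cmd → Tab → Bool
  | skip, _ => false
  | set _ _, _ => false
  | put a _ _, b => decide (b = a)
  | seq c c', y => c.writesTab y || c'.writesTab y
  | ite _ c c', y => c.writesTab y || c'.writesTab y
  | loop _ c, y => c.writesTab y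
  | charge _ c, y => c.writesTab y

/-- Whether the command, run under the heading `p`, counts steps under the heading `q`. -/
def charges (p : Phase) : Cmd → Phase → Bool
  | skip, q => decide (q = p)
  | set _ _, q => decide (q = p)
  | put _ _ _, q => decide (q = p)
  | seq c c', q => c.charges p q || c'.charges p q
  | ite _ c c', q => decide (q = p) || c.charges p q || c'.charges p q
  | loop _ c, q => decide (q = p) || c.charges p q
  | charge r c, q => c.charges r q

end Cmd

/-- What a run of `c` from `s` (at time `t`) to `s'` (at time `t'`) certainly leaves unchanged. -/
structure Frame (W : ℕ) (p : Phase) (c : Cmd) (s : Store) (t : Phase → ℕ) (s' : Store)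
    (t' : Phase → ℕ) : Prop where
  bounded : s'.Bounded W
  var : ∀ x, c.writesVar x = false → s'.var x = s.var x
  tab : ∀ a, c.writesTab a = false → s'.tab a = s.tab a
  time : ∀ q, c.charges p q = false → t' q = t q
  le : t ≤ t'

theorem Exec.var_eq {W p c s t s'} (h : Exec W p c s t s') {x : Var}
    (hx : c.writesVar x = false) : s'.var x = s.var x := by
  induction h with
  | skip | put | loop_false => rfl
  | set p y e s h => simp [Cmd.writesVar] at hx; simp [hx]
  | seq _ _ _ _ _ _ _ _ _ _ ih₁ ih₂ =>
    simp [Cmd.writesVar] at hx; rw [ih₂ hx.2, ih₁ hx.1]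
  | ite_true _ _ _ _ _ _ _ _ _ ih => simp [Cmd.writesVar] at hx; exact ih hx.1
  | ite_false _ _ _ _ _ _ _ _ _ ih => simp [Cmd.writesVar] at hx; exact ih hx.2
  | loop_true _ _ _ _ _ _ _ _ _ _ _ ih₁ ih₂ =>
    rw [ih₂ hx, ih₁ hx]
  | charge _ _ _ _ _ _ _ ih => exact ih hx

theorem Exec.tab_eq {W p c s t s'} (h : Exec W p c s t s') {a : Tab}
    (hx : c.writesTab a = false) : s'.tab a = s.tab a := by
  induction h with
  | skip | set | loop_false => rfl
  | put p y e s h => simp [Cmd.writesTab] at hx; simp [hx]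
  | seq _ _ _ _ _ _ _ _ _ _ ih₁ ih₂ =>
    simp [Cmd.writesTab] at hx; rw [ih₂ hx.2, ih₁ hx.1]
  | ite_true _ _ _ _ _ _ _ _ _ ih => simp [Cmd.writesTab] at hx; exact ih hx.1
  | ite_false _ _ _ _ _ _ _ _ _ ih => simp [Cmd.writesTab] at hx; exact ih hx.2
  | loop_true _ _ _ _ _ _ _ _ _ _ _ ih₁ ih₂ =>
    rw [ih₂ hx, ih₁ hx]
  | charge _ _ _ _ _ _ _ ih => exact ih hx

theorem Exec.time_eq {W p c s t s'} (h : Exec W p c s t s') {q : Phase}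
    (hq : c.charges p q = false) : t q = 0 := by
  induction h with
  | skip | put | loop_false | set => simp_all [Cmd.charges]
  | seq _ _ _ _ _ _ _ _ _ _ ih₁ ih₂ =>
    simp [Cmd.charges] at hq; simp [ih₂ hq.2, ih₁ hq.1]
  | ite_true _ _ _ _ _ _ _ _ _ ih => simp [Cmd.charges] at hq; simp [ih hq.1.2, hq.1.1]
  | ite_false _ _ _ _ _ _ _ _ _ ih => simp [Cmd.charges] at hq; simp [ih hq.2, hq.1.1]
  | loop_true _ _ _ _ _ _ _ _ _ _ _ ih₁ ih₂ =>
    have h2 := ih₂ hq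
    simp [Cmd.charges] at hq; simp [h2, ih₁ hq.2, hq.1]
  | charge _ _ _ _ _ _ _ ih => exact ih hq

/-- Started in the store `s` at time `t`, the command `c` terminates, and the final store and
time satisfy `Q`. -/
def Wp (W : ℕ) (p : Phase) (c : Cmd) (Q : Store → (Phase → ℕ) → Prop) (s : Store)
    (t : Phase → ℕ) : Prop :=
  ∃ t' s', Exec W p c s t' s' ∧ Q s' (t + t')

/-! ### Rules for the commands. -/

section Rules

variable {W : ℕ} {p : Phase} {Q Q' : Store → (Phase → ℕ) → Prop} {s : Store} {t : Phase → ℕ}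
  {c c' : Cmd}

@[simp] theorem wp_skip : Wp W p .skip Q s t ↔ Q s (tick p 1 t) :=
  ⟨fun ⟨_, _, h, hQ⟩ => by cases h; exact hQ, fun h => ⟨_, _, .skip _ _, h⟩⟩

@[simp] theorem wp_set {x : Var} {e : Expr} :
    Wp W p (.set x e) Q s t ↔
      e.eval s ≤ W ∧ Q (s.setVar x (e.eval s)) (tick p (e.cost + 1) t) :=
  ⟨fun ⟨_, _, h, hQ⟩ => by cases h with | set _ _ _ _ h => exact ⟨h, hQ⟩,
    fun h => ⟨_, _, .set _ _ _ _ h.1, h.2⟩⟩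

@[simp] theorem wp_put {a : Tab} {i e : Expr} :
    Wp W p (.put a i e) Q s t ↔
      e.eval s ≤ W ∧ Q (s.setTab a (i.eval s) (e.eval s)) (tick p (i.cost + e.cost + 1) t) :=
  ⟨fun ⟨_, _, h, hQ⟩ => by cases h with | put _ _ _ _ _ h => exact ⟨h, hQ⟩,
    fun h => ⟨_, _, .put _ _ _ _ _ h.1, h.2⟩⟩

@[simp] theorem wp_seq : Wp W p (.seq c c') Q s t ↔ Wp W p c (Wp W p c' Q) s t := by
  constructor
  · rintro ⟨_, _, h, hQ⟩
    cases h with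
    | seq _ _ _ _ s₁ s₂ t₁ t₂ h₁ h₂ => exact ⟨_, _, h₁, _, _, h₂, by rwa [add_assoc]⟩
  · rintro ⟨_, _, h₁, _, _, h₂, hQ⟩
    exact ⟨_, _, .seq _ _ _ _ _ _ _ _ h₁ h₂, by rwa [← add_assoc]⟩

@[simp] theorem wp_ite {b : Test} :
    Wp W p (.ite b c c') Q s t ↔
      (b.Holds s → Wp W p c Q s (tick p b.cost t)) ∧
        (¬ b.Holds s → Wp W p c' Q s (tick p b.cost t)) := by
  constructor
  · rintro ⟨_, _, h, hQ⟩
    cases h with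
    | ite_true _ _ _ _ _ _ _ hb h =>
      exact ⟨fun _ => ⟨_, _, h, by rwa [tick, add_assoc]⟩, fun h => absurd hb h⟩
    | ite_false _ _ _ _ _ _ _ hb h =>
      exact ⟨fun h => absurd h hb, fun _ => ⟨_, _, h, by rwa [tick, add_assoc]⟩⟩
  · rintro ⟨h₁, h₂⟩
    by_cases hb : b.Holds s
    · obtain ⟨_, _, h, hQ⟩ := h₁ hb
      exact ⟨_, _, .ite_true _ _ _ _ _ _ _ hb h, by rwa [tick, add_assoc] at hQ⟩
    · obtain ⟨_, _, h, hQ⟩ := h₂ hb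
      exact ⟨_, _, .ite_false _ _ _ _ _ _ _ hb h, by rwa [tick, add_assoc] at hQ⟩

@[simp] theorem wp_charge {q : Phase} : Wp W p (.charge q c) Q s t ↔ Wp W q c Q s t :=
  ⟨fun ⟨_, _, h, hQ⟩ => by cases h with | charge _ _ _ _ _ _ h => exact ⟨_, _, h, hQ⟩,
    fun ⟨_, _, h, hQ⟩ => ⟨_, _, .charge _ _ _ _ _ _ h, hQ⟩⟩

/-- This keeps specifications small: a postcondition only has to mention what changes. Everything
else is recovered from `Frame`, whose side conditions are Boolean computations on the syntax, closed
by `rfl`. -/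
theorem Wp.frame (hs : s.Bounded W) (h : Wp W p c Q s t)
    (hQ : ∀ s' t', Frame W p c s t s' t' → Q s' t' → Q' s' t') : Wp W p c Q' s t := by
  obtain ⟨t', s', h, hq⟩ := h
  refine ⟨t', s', h, hQ _ _ ⟨h.bounded hs, fun _ => h.var_eq, fun _ => h.tab_eq, fun q hq => ?_,
    fun q => by simp⟩ hq⟩
  simp [h.time_eq hq]

theorem Wp.mono (h : Wp W p c Q s t) (hQ : ∀ s' t', Q s' t' → Q' s' t') : Wp W p c Q' s t := by
  obtain ⟨t', s', h, hq⟩ := h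
  exact ⟨t', s', h, hQ _ _ hq⟩

theorem Frame.refl (hs : s.Bounded W) : Frame W p c s t s t :=
  ⟨hs, fun _ _ => rfl, fun _ _ => rfl, fun _ _ => rfl, le_rfl⟩

theorem wp_loop_true {b : Test} (hb : b.Holds s)
    (h : Wp W p c (Wp W p (.loop b c) Q) s (tick p b.cost t)) : Wp W p (.loop b c) Q s t := by
  obtain ⟨t₁, s₁, h₁, t₂, s₂, h₂, hQ⟩ := h
  exact ⟨_, _, .loop_true _ _ _ _ _ _ _ _ hb h₁ h₂, by
    rwa [tick, add_assoc, add_assoc, ← add_assoc (Pi.single _ _)] at hQ⟩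

theorem wp_loop_false {b : Test} (hb : ¬ b.Holds s) (h : Q s (tick p b.cost t)) :
    Wp W p (.loop b c) Q s t :=
  ⟨_, _, .loop_false _ _ _ _ hb, h⟩

/-- A loop that terminates because `m` decreases. -/
theorem Wp.loop {b : Test} {I : Store → (Phase → ℕ) → Prop} (m : Store → ℕ)
    (hs : s.Bounded W) (h0 : I s t)
    (step : ∀ s₁ t₁, Frame W p (.loop b c) s t s₁ t₁ → I s₁ t₁ → b.Holds s₁ →
      Wp W p c (fun s₂ t₂ => I s₂ t₂ ∧ m s₂ < m s₁) s₁ (tick p b.cost t₁))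
    (exit : ∀ s₁ t₁, Frame W p (.loop b c) s t s₁ t₁ → I s₁ t₁ → ¬ b.Holds s₁ →
      Q s₁ (tick p b.cost t₁)) : Wp W p (.loop b c) Q s t := by
  -- The frame is always taken relative to the start of the loop, so that facts about the initial
  -- store remain available in every iteration.
  suffices H : ∀ n s₁ t₁, m s₁ = n → Frame W p (.loop b c) s t s₁ t₁ → I s₁ t₁ →
      Wp W p (.loop b c) Q s₁ t₁ from H _ _ _ rfl (Frame.refl hs) h0
  intro n
  induction n using Nat.strong_induction_on with
  | _ n ih =>
    intro s₁ t₁ hm hf hI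
    by_cases hb : b.Holds s₁
    · refine wp_loop_true hb ((step s₁ t₁ hf hI hb).frame hf.bounded ?_)
      rintro s₂ t₂ hf₂ ⟨hI₂, hm₂⟩
      refine ih _ (hm ▸ hm₂) s₂ t₂ rfl ⟨hf₂.bounded, fun x hx => ?_, fun a ha => ?_,
        fun q hq => ?_, ?_⟩ hI₂
      · rw [hf₂.var x hx, hf.var x hx]
      · rw [hf₂.tab a ha, hf.tab a ha]
      · have := hf.time q hq
        simp [Cmd.charges] at hq
        rw [hf₂.time q hq.2]; simp [hq.1, this]
      · exact hf.le.trans ((le_tick _ _ _).trans hf₂.le)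
    · exact wp_loop_false hb (exit _ _ hf hI hb)

/-- A loop that runs over a list; the invariant depends on the lists of the items that have been
treated and that remain. -/
theorem Wp.loopList {α : Type} {b : Test} {l : List α}
    {I : List α → List α → Store → (Phase → ℕ) → Prop}
    (hs : s.Bounded W) (h0 : I [] l s t)
    (step : ∀ l₁ x l₂ s₁ t₁, l = l₁ ++ x :: l₂ → Frame W p (.loop b c) s t s₁ t₁ →
      I l₁ (x :: l₂) s₁ t₁ →
      b.Holds s₁ ∧ Wp W p c (I (l₁ ++ [x]) l₂) s₁ (tick p b.cost t₁))
    (exit : ∀ s₁ t₁, Frame W p (.loop b c) s t s₁ t₁ → I l [] s₁ t₁ →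
      ¬ b.Holds s₁ ∧ Q s₁ (tick p b.cost t₁)) : Wp W p (.loop b c) Q s t := by
  suffices H : ∀ l₂ l₁ s₁ t₁, l = l₁ ++ l₂ → Frame W p (.loop b c) s t s₁ t₁ → I l₁ l₂ s₁ t₁ →
      Wp W p (.loop b c) Q s₁ t₁ from H l [] s t rfl (Frame.refl hs) h0
  intro l₂
  induction l₂ with
  | nil =>
    intro l₁ s₁ t₁ hl hf hI
    simp only [List.append_nil] at hl
    subst hl
    obtain ⟨hb, hQ⟩ := exit _ _ hf hI
    exact wp_loop_false hb hQ
  | cons x l₂ ih =>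
    intro l₁ s₁ t₁ hl hf hI
    obtain ⟨hb, hW⟩ := step _ _ _ _ _ hl hf hI
    refine wp_loop_true hb (hW.frame hf.bounded ?_)
    intro s₂ t₂ hf₂ hI₂
    refine ih _ s₂ t₂ (by simp [hl]) ⟨hf₂.bounded, fun x hx => ?_, fun a ha => ?_,
        fun q hq => ?_, ?_⟩ hI₂
    · rw [hf₂.var x hx, hf.var x hx]
    · rw [hf₂.tab a ha, hf.tab a ha]
    · have := hf.time q hq
      simp [Cmd.charges] at hq
      rw [hf₂.time q hq.2]; simp [hq.1, this]
    · exact hf.le.trans ((le_tick _ _ _).trans hf₂.le)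

end Rules

attribute [simp] Expr.eval Expr.cost Test.Holds Test.cost Cmd.incr Cmd.flip

/-! ### Linked lists and arrays -/

/-- The linked list with the links `nxt` and the first entry `x` is `l`; it ends with `0`. -/
def Chain (nxt : ℕ → ℕ) : ℕ → List ℕ → Prop
  | x, [] => x = 0
  | x, y :: l => x = y ∧ y ≠ 0 ∧ Chain nxt (nxt y) l

theorem Chain.update {nxt : ℕ → ℕ} {x : ℕ} {l : List ℕ} (h : Chain nxt x l) {i : ℕ} (hi : i ∉ l)
    (k : ℕ) : Chain (Function.update nxt i k) x l := by
  induction l generalizing x with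
  | nil => exact h
  | cons y l ih =>
    simp only [List.mem_cons, not_or] at hi
    refine ⟨h.1, h.2.1, ?_⟩
    rw [Function.update_of_ne (Ne.symm hi.1)]
    exact ih h.2.2 hi.2

theorem Chain.congr {nxt nxt' : ℕ → ℕ} {x : ℕ} {l : List ℕ} (h : Chain nxt x l)
    (hi : ∀ i ∈ l, nxt' i = nxt i) : Chain nxt' x l := by
  induction l generalizing x with
  | nil => exact h
  | cons y l ih =>
    simp only [List.mem_cons, forall_eq_or_imp] at hi
    refine ⟨h.1, h.2.1, ?_⟩
    rw [hi.1]
    exact ih h.2.2 hi.2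

theorem Chain.eq_zero_iff {nxt : ℕ → ℕ} {x : ℕ} {l : List ℕ} (h : Chain nxt x l) :
    x = 0 ↔ l = [] := by
  cases l with
  | nil => simpa [Chain] using h
  | cons y l => simpa [h.1] using h.2.1

/-- Concatenation of linked lists. -/
theorem Chain.append {nxt : ℕ → ℕ} {x y z : ℕ} {l l' : List ℕ} (h : Chain nxt x (l ++ [z]))
    (h' : Chain nxt y l') (hn : (l ++ [z]).Nodup) (hz : z ∉ l') :
    Chain (Function.update nxt z y) x (l ++ [z] ++ l') := by
  induction l generalizing x with
  | nil =>
    refine ⟨h.1, h.2.1, ?_⟩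
    simpa using h'.update hz y
  | cons a l ih =>
    simp only [List.cons_append, List.nodup_cons] at hn
    refine ⟨h.1, h.2.1, ?_⟩
    have : a ≠ z := fun h => hn.1 (by simp [h])
    rw [Function.update_of_ne this]
    exact ih h.2.2 hn.2

/-- The entries of the array `f` from the index `j` on are those of the list. -/
def Stores (f : ℕ → ℕ) : ℕ → List ℕ → Prop
  | _, [] => True
  | j, x :: l => f j = x ∧ Stores f (j + 1) l

theorem Stores.congr {f g : ℕ → ℕ} {j : ℕ} {l : List ℕ} (h : Stores f j l)
    (hg : ∀ i, j ≤ i → i < j + l.length → g i = f i) : Stores g j l := by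
  induction l generalizing j with
  | nil => trivial
  | cons x l ih =>
    refine ⟨by rw [hg j le_rfl (by simp)]; exact h.1, ih h.2 fun i hi hi' => hg i (by omega) ?_⟩
    simp; omega

theorem Stores.update {f : ℕ → ℕ} {j : ℕ} {l : List ℕ} (h : Stores f j l) {i : ℕ}
    (hi : i < j ∨ j + l.length ≤ i) (k : ℕ) : Stores (Function.update f i k) j l :=
  h.congr fun i' _ _ => Function.update_of_ne (by omega) _ _

theorem Stores.append_iff {f : ℕ → ℕ} {j : ℕ} {l l' : List ℕ} :
    Stores f j (l ++ l') ↔ Stores f j l ∧ Stores f (j + l.length) l' := by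
  induction l generalizing j with
  | nil => simp [Stores]
  | cons x l ih => simp [Stores, ih, and_assoc, Nat.add_assoc, Nat.add_comm 1]

theorem Stores.push {f : ℕ → ℕ} {j : ℕ} {l : List ℕ} (h : Stores f j l) (k : ℕ) :
    Stores (Function.update f (j + l.length) k) j (l ++ [k]) :=
  Stores.append_iff.2 ⟨h.update (Or.inr le_rfl) k, by simp [Stores]⟩

theorem Stores.push_zero {f : ℕ → ℕ} {l : List ℕ} (h : Stores f 0 l) {i : ℕ} (hi : i = l.length)
    (k : ℕ) : Stores (Function.update f i k) 0 (l ++ [k]) := by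
  simpa [hi] using h.push k

/-- Iteration over the edge ends at a vertex. -/
theorem Wp.forEnds {W : ℕ} {p : Phase} {Q : Store → (Phase → ℕ) → Prop} {s : Store}
    {t : Phase → ℕ} {c : Cmd} {x : Var} {l : List ℕ}
    {I : List ℕ → List ℕ → Store → (Phase → ℕ) → Prop}
    (hs : s.Bounded W) (hl : Chain (s.tab .next) (s.tab .first (s.var x)) l)
    (hd : c.writesVar .d = false) (hn : c.writesTab .next = false)
    (h0 : I [] l (s.setVar .d (s.tab .first (s.var x))) (tick p 3 t))
    (step : ∀ l₁ d l₂ s₁ t₁, l = l₁ ++ d :: l₂ → Frame W p (.forEnds x c) s t s₁ t₁ →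
      s₁.var .d = d → I l₁ (d :: l₂) s₁ t₁ →
      Wp W p c (fun s₂ t₂ => I (l₁ ++ [d]) l₂ (s₂.setVar .d (s.tab .next d)) (tick p 3 t₂)) s₁
        (tick p 3 t₁))
    (exit : ∀ s₁ t₁, Frame W p (.forEnds x c) s t s₁ t₁ → I l [] s₁ t₁ → Q s₁ (tick p 3 t₁)) :
    Wp W p (.forEnds x c) Q s t := by
  have hB : (s.setVar .d (s.tab .first (s.var x))).Bounded W := hs.setVar (hs.tab _ _)
  rw [Cmd.forEnds, wp_seq, wp_set]
  refine ⟨hs.tab _ _, ?_⟩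
  -- The inner loop starts after the assignment to `d`. Its frame is still one for the whole
  -- command, since a register protected by the whole command differs from `d`.
  have hF : ∀ {s₁ t₁}, Frame W p (.loop (.ne (.var .d) (.lit 0)) (c ;; .set .d (.get .next (.var .d))))
      (s.setVar .d (s.tab .first (s.var x))) (tick p 3 t) s₁ t₁ →
      Frame W p (.forEnds x c) s t s₁ t₁ := by
    intro s₁ t₁ h
    refine ⟨h.bounded, fun y hy => ?_, fun a ha => ?_, fun q hq => ?_, (le_tick _ _ _).trans h.le⟩
    · simp [Cmd.forEnds, Cmd.writesVar] at hy
      rw [h.var y (by simpa [Cmd.writesVar] using hy.2)]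
      simp [hy.1]
    · simp [Cmd.forEnds, Cmd.writesTab] at ha
      rw [h.tab a (by simpa [Cmd.writesTab] using ha)]
      simp
    · simp [Cmd.forEnds, Cmd.charges] at hq
      rw [h.time q (by simpa [Cmd.charges] using hq)]
      simp [hq.1]
  refine Wp.loopList (l := l)
    (I := fun l₁ l₂ s₁ t₁ => I l₁ l₂ s₁ t₁ ∧ Chain (s.tab .next) (s₁.var .d) l₂) hB
    ⟨h0, by simpa [Expr.eval] using hl⟩ ?_ ?_
  · rintro l₁ d l₂ s₁ t₁ hl hf ⟨hI, hc⟩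
    refine ⟨?_, ?_⟩
    · simpa [Test.Holds, Expr.eval, hc.1] using hc.2.1
    · rw [wp_seq]
      refine (step l₁ d l₂ s₁ t₁ hl (hF hf) hc.1 hI).frame hf.bounded ?_
      intro s₂ t₂ hf₂ hI₂
      rw [wp_set]
      have e1 : s₂.var .d = d := by rw [hf₂.var _ hd, hc.1]
      have e2 : s₂.tab .next = s.tab .next := by
        rw [hf₂.tab _ hn, (hF hf).tab _ (by simpa [Cmd.forEnds, Cmd.writesTab] using hn)]
      refine ⟨hf₂.bounded.tab _ _, ?_⟩
      simp only [Expr.eval, e1, e2, Expr.cost]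
      exact ⟨hI₂, by simpa using hc.2.2⟩
  · rintro s₁ t₁ hf ⟨hI, hc⟩
    exact ⟨by simpa [Test.Holds, Expr.eval, Chain] using hc, exit _ _ (hF hf) hI⟩

/-! ### The Ackermann hierarchy -/

/-- The hierarchy of functions used in the potential. -/
def hierarchy : ℕ → ℕ → ℕ
  | 0, j => j + 1
  | k + 1, j => (hierarchy k)^[j + 1] j

theorem lt_hierarchy (k j : ℕ) : j < hierarchy k j := by
  induction k generalizing j with
  | zero => simp [hierarchy]
  | succ k ih =>
    have H : ∀ n, j + n ≤ (hierarchy k)^[n] j := by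
      intro n
      induction n with
      | zero => simp
      | succ n ihn =>
        rw [Function.iterate_succ_apply']
        have := ih ((hierarchy k)^[n] j)
        omega
    have := H (j + 1)
    simp only [hierarchy]; omega

theorem hierarchy_iterate_mono_right (k j : ℕ) : Monotone fun n => (hierarchy k)^[n] j :=
  monotone_nat_of_le_succ fun n => by
    rw [Function.iterate_succ_apply']; exact (lt_hierarchy _ _).le

theorem hierarchy_monotone (k : ℕ) : Monotone (hierarchy k) := by
  induction k with
  | zero => intro a b h; simpa [hierarchy] using h
  | succ k ih =>
    intro a b h
    exact (ih.iterate _ h).trans (hierarchy_iterate_mono_right k b (by omega))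

theorem hierarchy_le_succ (k j : ℕ) : hierarchy k j ≤ hierarchy (k + 1) j :=
  hierarchy_iterate_mono_right k j (by omega : 1 ≤ j + 1)

theorem hierarchy_mono_left (j : ℕ) : Monotone fun k => hierarchy k j :=
  monotone_nat_of_le_succ fun k => hierarchy_le_succ k j

/-! ### Comparison with Ackermann's function. -/

theorem ackermannA_succ_succ (i j : ℕ) (hj : 1 ≤ j) :
    ackermannA (i + 1) (j + 1) = ackermannA i (ackermannA (i + 1) j) := by
  obtain ⟨j, rfl⟩ := Nat.exists_eq_add_of_le' hj
  rw [ackermannA]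

theorem lt_ackermannA (i j : ℕ) (hj : 1 ≤ j) : j < ackermannA i j := by
  induction i generalizing j with
  | zero => simp [ackermannA]; omega
  | succ i ih =>
    induction j, hj using Nat.le_induction with
    | base => simp [ackermannA]
    | succ j hj ihj =>
      rw [ackermannA_succ_succ _ _ hj]
      have := ih (ackermannA (i + 1) j) (by omega)
      omega

theorem ackermannA_strictMono (i : ℕ) : StrictMono (ackermannA i) := by
  cases i with
  | zero => intro a b h; simp [ackermannA]; omega
  | succ i =>
    refine strictMono_nat_of_lt_succ fun j => ?_
    rcases Nat.eq_zero_or_pos j with rfl | hj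
    · simp [ackermannA]
    · rw [ackermannA_succ_succ _ _ hj]
      exact lt_ackermannA _ _ (by have := lt_ackermannA (i + 1) j hj; omega)

/-- The index shifts by one because `hierarchy 0` is the successor while `ackermannA 0` doubles. In
the induction step, each increment of the second argument of `ackermannA (i + 1)` is one application
of `ackermannA i`, hence is dominated by one application of `hierarchy (i + 1)`, started at `j`. -/
theorem ackermannA_le_hierarchy (i j : ℕ) (hj : 1 ≤ j) : ackermannA i j ≤ hierarchy (i + 1) j := by
  induction i generalizing j with
  | zero =>
    have H : ∀ n, (hierarchy 0)^[n] j = j + n := by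
      intro n
      induction n with
      | zero => rfl
      | succ n ih => rw [Function.iterate_succ_apply', ih]; simp [hierarchy]; omega
    simp only [hierarchy, ackermannA]
    change 2 * j ≤ (hierarchy 0)^[j + 1] j
    rw [H]; omega
  | succ i ih =>
    have H : ∀ n, 1 ≤ n → ackermannA (i + 1) n ≤ (hierarchy (i + 1))^[n] j := by
      intro n hn
      induction n, hn using Nat.le_induction with
      | base =>
        have := lt_hierarchy (i + 1) j
        simp only [ackermannA, Function.iterate_one]; omega
      | succ n hn ihn =>
        rw [ackermannA_succ_succ _ _ hn, Function.iterate_succ_apply']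
        refine (ih _ ?_).trans (hierarchy_monotone _ ihn)
        have := lt_ackermannA (i + 1) n hn
        omega
    exact (H j hj).trans (hierarchy_iterate_mono_right (i + 1) j (by omega))

theorem ackermannA_two (i : ℕ) : ackermannA i 2 = 4 := by
  induction i with
  | zero => simp [ackermannA]
  | succ i ih => rw [ackermannA_succ_succ _ 1 le_rfl]; simpa [ackermannA] using ih

/-- Ensures that the set whose infimum is the inverse Ackermann function is nonempty; the infimum of
the empty set would be the default value 0. The growth comes from A(i+1, 4) = A(i, A(i+1, 3)) with
A(i+1, 3) = A(i, 4) > 4. -/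
theorem le_ackermannA_four (i : ℕ) : i ≤ ackermannA i 4 := by
  induction i with
  | zero => simp
  | succ i ih =>
    rw [ackermannA_succ_succ _ 3 (by norm_num)]
    have h : 4 < ackermannA (i + 1) 3 := by
      rw [ackermannA_succ_succ _ 2 (by norm_num), ackermannA_two]
      exact lt_ackermannA i 4 (by norm_num)
    have := ackermannA_strictMono i h
    omega

theorem logb_le_ackermannA (n : ℕ) :
    Real.logb 2 (n : ℝ) ≤ (ackermannA (inverseAckermann n) 4 : ℝ) := by
  have hne : {i : ℕ | Real.logb 2 (n : ℝ) ≤ (ackermannA i 4 : ℝ)}.Nonempty := by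
    obtain ⟨i, hi⟩ := exists_nat_ge (Real.logb 2 (n : ℝ))
    exact ⟨i, hi.trans (by exact_mod_cast le_ackermannA_four i)⟩
  exact Nat.sInf_mem hne

/-- A number of levels beyond which the hierarchy exceeds all ranks. -/
theorem log_lt_hierarchy {n N : ℕ} (hN : N ≤ 2 * n) :
    Nat.log 2 N < hierarchy (inverseAckermann n + 3) 1 := by
  set i := inverseAckermann n
  have h1 : Nat.log 2 N ≤ ackermannA i 4 + 1 := by
    rcases Nat.eq_zero_or_pos n with rfl | hn
    · simp [show N = 0 by omega]
    have h2 : Nat.log 2 n ≤ ackermannA i 4 := by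
      have := logb_le_ackermannA n
      have h3 := Real.natLog_le_logb n 2
      exact_mod_cast h3.trans this
    calc Nat.log 2 N ≤ Nat.log 2 (n * 2) := Nat.log_mono_right (by omega)
      _ = Nat.log 2 n + 1 := Nat.log_mul_base (by norm_num) (by omega)
      _ ≤ _ := by omega
  -- The chain is log₂ N ≤ A(i,4) + 1 ≤ A(i,5) < A(i,7) ≤ h_{i+1}(7) ≤ h_{i+2}(7) ≤
  -- h_{i+2}(h_{i+2}(1)) = h_{i+3}(1). The value 7 is h_2(1), as h_1(j) = 2j + 1.
  have h2 : 7 ≤ hierarchy (i + 2) 1 :=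
    (show 7 ≤ hierarchy 2 1 by simp [hierarchy]).trans (hierarchy_mono_left 1 (by omega))
  have h3 : hierarchy (i + 2) 7 ≤ hierarchy (i + 3) 1 := hierarchy_monotone (i + 2) h2
  have h4 : hierarchy (i + 1) 7 ≤ hierarchy (i + 2) 7 := hierarchy_le_succ (i + 1) 7
  have h5 := ackermannA_le_hierarchy i 7 (by norm_num)
  have h6 := ackermannA_strictMono i (show 4 < 5 by norm_num)
  have h7 := ackermannA_strictMono i (show 5 < 7 by norm_num)
  omega

/-- Source of the threshold on n: A(0,4) = 8 = log₂ 256. For smaller n the inverse is 0 and a bound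
by a multiple of n α(n) would be false. -/
theorem one_le_inverseAckermann {n : ℕ} (hn : 257 ≤ n) : 1 ≤ inverseAckermann n := by
  by_contra h
  have h0 : inverseAckermann n = 0 := by omega
  have := logb_le_ackermannA n
  rw [h0] at this
  have h8 : Real.logb 2 (n : ℝ) ≤ 8 := by simpa [ackermannA] using this
  rw [Real.logb_le_iff_le_rpow (by norm_num) (by positivity)] at h8
  norm_num at h8
  have : (257 : ℝ) ≤ n := by exact_mod_cast hn
  linarith

/-! ### The potential of a cluster-forest -/

/-- The potential of a vertex of rank `r` whose parent has the rank `p` (a root is its own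
parent). -/
def potential (A r p : ℕ) : ℕ :=
  ((Finset.range A ×ˢ Finset.Icc 1 r).filter fun x => p < (hierarchy x.1)^[x.2] r).card

theorem potential_anti (A r : ℕ) : Antitone (potential A r) := fun p p' h =>
  Finset.card_le_card fun x hx => by
    simp only [Finset.mem_filter] at hx ⊢
    exact ⟨hx.1, h.trans_lt hx.2⟩

theorem potential_le (A r p : ℕ) : potential A r p ≤ A * r :=
  (Finset.card_filter_le _ _).trans (by simp)

/-- A root has the largest possible potential: all iterates exceed r, so no pair is excluded. -/
theorem potential_self (A r : ℕ) : potential A r r = A * r := by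
  rw [potential, Finset.filter_true_of_mem]
  · simp
  · rintro ⟨k, i⟩ hx
    simp only [Finset.mem_product, Finset.mem_Icc] at hx
    exact (lt_hierarchy k r).trans_le (hierarchy_iterate_mono_right k r hx.2.1)

/-- The pair (k, i) is counted for the parent rank `p` and no longer for `R`, while no pair is
gained. -/
theorem potential_lt {A r p R k i : ℕ} (hk : k < A) (hi : 1 ≤ i) (hir : i ≤ r)
    (h₁ : p < (hierarchy k)^[i] r) (h₂ : (hierarchy k)^[i] r ≤ R) :
    potential A r R < potential A r p := by
  refine Finset.card_lt_card (Finset.ssubset_iff_of_subset ?_ |>.2 ⟨(k, i), ?_, ?_⟩)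
  · intro x hx
    simp only [Finset.mem_filter] at hx ⊢
    exact ⟨hx.1, h₁.trans_le (h₂.trans hx.2.le)⟩
  · simp [*]
  · simp [*]

/-- The level of a vertex of rank `r` whose parent has the rank `p`. -/
def level (A r p : ℕ) : ℕ := Nat.findGreatest (fun k => hierarchy k r ≤ p) A

/-- Level 0 always qualifies, because `hierarchy 0 r = r + 1` and the parent has larger rank; so the
greatest level is not a default value. -/
theorem hierarchy_level_le {A r p : ℕ} (h : r < p) : hierarchy (level A r p) r ≤ p :=
  Nat.findGreatest_spec (P := fun k => hierarchy k r ≤ p) (Nat.zero_le A) h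

theorem level_lt {A r p : ℕ} (h : r < p) (hA : p < hierarchy A r) : level A r p < A := by
  refine lt_of_le_of_ne (Nat.findGreatest_le A) fun he => ?_
  have := hierarchy_level_le (A := A) h
  rw [he] at this
  omega

theorem lt_hierarchy_level_succ {A r p : ℕ} (h : r < p) (hA : p < hierarchy A r) :
    p < hierarchy (level A r p + 1) r := by
  have := Nat.findGreatest_is_greatest (P := fun k => hierarchy k r ≤ p) (n := A)
    (Nat.lt_succ_self (level A r p)) (level_lt h hA)
  simpa using this

/-- Path compression decreases the potential of a vertex if a later vertex of the path has the
same level. -/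
theorem potential_lt_of_level_eq {A r p r' p' R : ℕ} (hr : 1 ≤ r) (h₁ : r < p) (h₂ : p ≤ r')
    (h₃ : r' < p') (h₄ : p' ≤ R) (hA : R < hierarchy A 1) (hl : level A r' p' = level A r p) :
    potential A r R < potential A r p := by
  have hAr : R < hierarchy A r := hA.trans_le (hierarchy_monotone A hr)
  set k := level A r p with hk
  have hkA : k < A := level_lt h₁ (by omega)
  set P : ℕ → Prop := fun i => (hierarchy k)^[i] r ≤ p
  -- `i` is the largest number of iterations of h_k, at most r, that stays below the parent's rank.
  -- The later vertex of the same level k contributes one more application of h_k on the way to the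
  -- root, so iteration `i + 1` does not exceed `R`.
  set i := Nat.findGreatest P r with hi
  have hP1 : P 1 := hierarchy_level_le h₁
  have hPi : P i := Nat.findGreatest_spec hr hP1
  have hi1 : 1 ≤ i := Nat.le_findGreatest hr hP1
  have hir : i ≤ r := Nat.findGreatest_le r
  have hR : (hierarchy k)^[i + 1] r ≤ R := by
    rw [Function.iterate_succ_apply']
    calc hierarchy k ((hierarchy k)^[i] r) ≤ hierarchy k r' := hierarchy_monotone k (hPi.trans h₂)
      _ ≤ p' := by rw [← hl]; exact hierarchy_level_le h₃
      _ ≤ R := h₄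
  rcases Nat.lt_or_ge i r with hlt | hge
  · refine potential_lt hkA (by omega) hlt ?_ hR
    have := Nat.findGreatest_is_greatest (P := P) (n := r) (Nat.lt_succ_self i) hlt
    simpa [P] using this
  -- There is no pair (k, r+1) to lose, but r + 1 iterations of h_k are h_{k+1}, so the pair (k+1,
  -- 1) is lost. It is in range: for k + 1 = A the rank `R` would reach h_A(r), against `hAr`.
  · have hir' : i = r := le_antisymm hir hge
    have e : hierarchy (k + 1) r = (hierarchy k)^[i + 1] r := by rw [hir']; rfl
    have hk1 : k + 1 < A := by
      by_contra hcon
      have : k + 1 = A := by omega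
      rw [this] at e
      omega
    refine potential_lt hk1 le_rfl hr ?_ ?_
    · exact lt_hierarchy_level_succ h₁ (by omega)
    · exact e.le.trans hR

/-- `l` lists the vertices before `z` on the path along `par` from `x` to `z`. -/
def Path (par : ℕ → ℕ) (z : ℕ) : ℕ → List ℕ → Prop
  | x, [] => x = z
  | x, y :: l => x = y ∧ y ≠ z ∧ Path par z (par y) l

theorem Path.rank_le {par rk : ℕ → ℕ} {z x : ℕ} {l : List ℕ} (h : Path par z x l)
    (hr : ∀ v ∈ l, rk v < rk (par v)) : (∀ v ∈ l, rk x ≤ rk v) ∧ rk x ≤ rk z := by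
  induction l generalizing x with
  | nil => rw [show x = z from h]; simp
  | cons y l ih =>
    obtain ⟨rfl, _, h⟩ := h
    simp only [List.mem_cons, forall_eq_or_imp] at hr
    obtain ⟨h1, h2⟩ := ih h hr.2
    refine ⟨?_, hr.1.le.trans h2⟩
    simp only [List.mem_cons, forall_eq_or_imp]
    exact ⟨le_rfl, fun v hv => hr.1.le.trans (h1 v hv)⟩

theorem Path.parent_rank_le {par rk : ℕ → ℕ} {z x : ℕ} {l : List ℕ} (h : Path par z x l)
    (hr : ∀ v ∈ l, rk v < rk (par v)) : ∀ v ∈ l, rk (par v) ≤ rk z := by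
  induction l generalizing x with
  | nil => simp
  | cons y l ih =>
    obtain ⟨rfl, _, h⟩ := h
    simp only [List.mem_cons, forall_eq_or_imp] at hr ⊢
    exact ⟨(h.rank_le hr.2).2, ih h hr.2⟩

theorem Path.nodup {par rk : ℕ → ℕ} {z x : ℕ} {l : List ℕ} (h : Path par z x l)
    (hr : ∀ v ∈ l, rk v < rk (par v)) : l.Nodup := by
  induction l generalizing x with
  | nil => simp
  | cons y l ih =>
    obtain ⟨rfl, _, h⟩ := h
    simp only [List.mem_cons, forall_eq_or_imp] at hr
    refine List.nodup_cons.2 ⟨fun hx => ?_, ih h hr.2⟩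
    have := (h.rank_le hr.2).1 x hx
    omega

/-- Of the vertices of positive rank, those followed on the path by another vertex of the same level
lose a unit each; the others are the last of their level, hence at most `A` many. The additional 1
stands for the start of the path, the only vertex on it that can have rank 0. -/
theorem Path.potential_compress {A : ℕ} {par rk : ℕ → ℕ} {z x : ℕ} {l : List ℕ}
    (h : Path par z x l) (hr : ∀ v ∈ l, rk v < rk (par v)) (hA : rk z < hierarchy A 1) :
    (l.map fun v => potential A (rk v) (rk z)).sum + l.length ≤
      (l.map fun v => potential A (rk v) (rk (par v))).sum + A + 1 := by
  have H : ∀ (l : List ℕ) (x : ℕ), Path par z x l → (∀ v ∈ l, rk v < rk (par v)) →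
      (∀ v ∈ l, 1 ≤ rk v) → (l.map fun v => potential A (rk v) (rk z)).sum + l.length ≤
      (l.map fun v => potential A (rk v) (rk (par v))).sum +
        (l.map fun v => level A (rk v) (rk (par v))).toFinset.card := by
    intro l
    induction l with
    | nil => simp
    | cons y l ih =>
      rintro x ⟨rfl, _, h⟩ hr h1
      have hp := h.parent_rank_le (rk := rk) fun v hv => hr v (List.mem_cons_of_mem _ hv)
      have hle := h.rank_le (rk := rk) fun v hv => hr v (List.mem_cons_of_mem _ hv)
      simp only [List.mem_cons, forall_eq_or_imp] at hr h1
      have := ih _ h hr.2 h1.2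
      simp only [List.map_cons, List.sum_cons, List.length_cons, List.toFinset_cons]
      have ha := potential_anti A (rk x) hle.2
      -- If the level recurs, the set of levels stays the same and the potential of `x` drops.
      -- Otherwise the set of levels gains an element, which pays for `x`.
      by_cases hm : level A (rk x) (rk (par x)) ∈
          (l.map fun v => level A (rk v) (rk (par v))).toFinset
      · rw [Finset.insert_eq_of_mem hm]
        simp only [List.mem_toFinset, List.mem_map] at hm
        obtain ⟨v, hv, he⟩ := hm
        have := potential_lt_of_level_eq h1.1 hr.1 (hle.1 v hv) (hr.2 v hv) (hp v hv) hA he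
        omega
      · rw [Finset.card_insert_of_notMem hm]
        omega
  have H' : ∀ (l : List ℕ) (x : ℕ), Path par z x l → (∀ v ∈ l, rk v < rk (par v)) →
      (∀ v ∈ l, 1 ≤ rk v) → (l.map fun v => potential A (rk v) (rk z)).sum + l.length ≤
      (l.map fun v => potential A (rk v) (rk (par v))).sum + A := by
    intro l x h hr h1
    refine (H l x h hr h1).trans (Nat.add_le_add_left ?_ _)
    calc _ ≤ (Finset.range A).card := Finset.card_le_card fun k hk => ?_
      _ = A := by simp
    simp only [List.mem_toFinset, List.mem_map] at hk
    obtain ⟨v, hv, rfl⟩ := hk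
    have := h.parent_rank_le hr v hv
    exact Finset.mem_range.2 (level_lt (hr v hv) (by
      have := hierarchy_monotone A (h1 v hv); omega))
  cases l with
  | nil => simp
  | cons y l =>
    obtain ⟨rfl, _, h⟩ := h
    have hle := h.rank_le (rk := rk) fun v hv => hr v (List.mem_cons_of_mem _ hv)
    simp only [List.mem_cons, forall_eq_or_imp] at hr
    have := H' l _ h hr.2 fun v hv => by have := hle.1 v hv; omega
    have ha := potential_anti A (rk x) hle.2
    simp only [List.map_cons, List.sum_cons, List.length_cons]
    omega

/-! ### Cluster-forests -/

/-- The parent links `par` on the vertices `1, …, N` form a forest in which `ρ v` is the root of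
`v`; the sizes are correct at the roots and bound the depth. -/
structure IsForest (N : ℕ) (par size ρ : ℕ → ℕ) : Prop where
  par_mem : ∀ v ∈ Finset.Icc 1 N, par v ∈ Finset.Icc 1 N
  root_mem : ∀ v ∈ Finset.Icc 1 N, ρ v ∈ Finset.Icc 1 N
  root_par : ∀ v ∈ Finset.Icc 1 N, ρ (par v) = ρ v
  root_of_fixed : ∀ v ∈ Finset.Icc 1 N, par v = v → ρ v = v
  par_root : ∀ v ∈ Finset.Icc 1 N, par (ρ v) = ρ v
  rank_lt : ∀ v ∈ Finset.Icc 1 N, par v ≠ v → Nat.log 2 (size v) < Nat.log 2 (size (par v))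
  size_root : ∀ v ∈ Finset.Icc 1 N, ρ v = v →
    size v = ((Finset.Icc 1 N).filter fun w => ρ w = v).card
  size_le : ∀ v ∈ Finset.Icc 1 N, size v ≤ N

/-- The total potential of a cluster-forest. -/
def totalPotential (A N : ℕ) (par size : ℕ → ℕ) : ℕ :=
  ∑ v ∈ Finset.Icc 1 N, potential A (Nat.log 2 (size v)) (Nat.log 2 (size (par v)))

namespace IsForest

variable {N : ℕ} {par size ρ : ℕ → ℕ}

theorem root_root (h : IsForest N par size ρ) {v : ℕ} (hv : v ∈ Finset.Icc 1 N) :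
    ρ (ρ v) = ρ v :=
  h.root_of_fixed _ (h.root_mem v hv) (h.par_root v hv)

/-- The walk towards the root ends because ranks increase strictly along parent links and are
bounded by `N`; the induction is on the distance of the rank from `N`. -/
theorem exists_path (h : IsForest N par size ρ) {x : ℕ} (hx : x ∈ Finset.Icc 1 N) :
    ∃ l, Path par (ρ x) x l ∧
      ∀ v ∈ l, v ∈ Finset.Icc 1 N ∧ ρ v = ρ x ∧ v ≠ ρ x ∧ par v ≠ v := by
  obtain ⟨n, hn⟩ : ∃ n, n = N - Nat.log 2 (size x) := ⟨_, rfl⟩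
  induction n using Nat.strong_induction_on generalizing x with
  | _ n ih =>
    by_cases hr : par x = x
    · exact ⟨[], (h.root_of_fixed x hx hr).symm, by simp⟩
    · have hlt := h.rank_lt x hx hr
      have hle : Nat.log 2 (size (par x)) ≤ N :=
        (Nat.log_le_self _ _).trans (h.size_le _ (h.par_mem x hx))
      obtain ⟨l, hl, hm⟩ := ih _ (by omega) (h.par_mem x hx) rfl
      rw [h.root_par x hx] at hl hm
      have hne : x ≠ ρ x := fun he => hr (by have := h.par_root x hx; rwa [← he] at this)
      refine ⟨x :: l, ⟨rfl, hne, hl⟩, ?_⟩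
      simp only [List.mem_cons, forall_eq_or_imp]
      exact ⟨⟨hx, trivial, hne, hr⟩, hm⟩

theorem rank_le_root (h : IsForest N par size ρ) {x : ℕ} (hx : x ∈ Finset.Icc 1 N) :
    Nat.log 2 (size x) ≤ Nat.log 2 (size (ρ x)) := by
  obtain ⟨l, hl, hm⟩ := h.exists_path hx
  exact (hl.rank_le (rk := fun v => Nat.log 2 (size v))
    fun v hv => h.rank_lt v (hm v hv).1 (hm v hv).2.2.2).2

/-- Ranks still increase along the new links, since the root has at least the rank of the former
parent. The stored sizes are not touched. -/
theorem compress (h : IsForest N par size ρ) {x : ℕ} {l : List ℕ} {par' : ℕ → ℕ}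
    (hx : x ∈ Finset.Icc 1 N)
    (hl : ∀ v ∈ l, v ∈ Finset.Icc 1 N ∧ ρ v = ρ x ∧ v ≠ ρ x ∧ par v ≠ v)
    (hp : ∀ v, par' v = if v ∈ l then ρ x else par v) : IsForest N par' size ρ where
  par_mem v hv := by
    rw [hp]; split
    exacts [h.root_mem x hx, h.par_mem v hv]
  root_mem := h.root_mem
  root_par v hv := by
    rw [hp]; split
    · rw [h.root_root hx, (hl v ‹_›).2.1]
    · exact h.root_par v hv
  root_of_fixed v hv := by
    rw [hp]; split
    · intro he; exact absurd he.symm (hl v ‹_›).2.2.1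
    · exact h.root_of_fixed v hv
  par_root v hv := by
    rw [hp, if_neg, h.par_root v hv]
    intro hm
    exact (hl _ hm).2.2.2 (h.par_root v hv)
  rank_lt v hv := by
    rw [hp]; split
    · intro _
      refine (h.rank_lt v hv (hl v ‹_›).2.2.2).trans_le ?_
      have := h.rank_le_root (h.par_mem v hv)
      rwa [h.root_par v hv, (hl v ‹_›).2.1] at this
    · exact h.rank_lt v hv
  size_root := h.size_root
  size_le := h.size_le

theorem totalPotential_compress (h : IsForest N par size ρ) {A x : ℕ} {l : List ℕ}
    {par' : ℕ → ℕ} (hx : x ∈ Finset.Icc 1 N) (hpath : Path par (ρ x) x l)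
    (hl : ∀ v ∈ l, v ∈ Finset.Icc 1 N ∧ ρ v = ρ x ∧ v ≠ ρ x ∧ par v ≠ v)
    (hp : ∀ v, par' v = if v ∈ l then ρ x else par v) (hA : Nat.log 2 N < hierarchy A 1) :
    totalPotential A N par' size + l.length ≤ totalPotential A N par size + A + 1 := by
  set rk : ℕ → ℕ := fun v => Nat.log 2 (size v)
  have hr : ∀ v ∈ l, rk v < rk (par v) := fun v hv => h.rank_lt v (hl v hv).1 (hl v hv).2.2.2
  have hz : rk (ρ x) < hierarchy A 1 :=
    (Nat.log_mono_right (h.size_le _ (h.root_mem x hx))).trans_lt hA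
  have hc := hpath.potential_compress hr hz
  have hnd := hpath.nodup hr
  have hsub : l.toFinset ⊆ Finset.Icc 1 N := fun v hv => (hl v (List.mem_toFinset.1 hv)).1
  unfold totalPotential
  rw [← Finset.sum_sdiff hsub,
    ← Finset.sum_sdiff (f := fun v => potential A (Nat.log 2 (size v)) (Nat.log 2 (size (par v))))
      hsub, List.sum_toFinset _ hnd, List.sum_toFinset _ hnd]
  have e1 : ∑ v ∈ Finset.Icc 1 N \ l.toFinset,
        potential A (Nat.log 2 (size v)) (Nat.log 2 (size (par' v))) =
      ∑ v ∈ Finset.Icc 1 N \ l.toFinset,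
        potential A (Nat.log 2 (size v)) (Nat.log 2 (size (par v))) := by
    refine Finset.sum_congr rfl fun v hv => ?_
    have : v ∉ l := by simpa using (Finset.mem_sdiff.1 hv).2
    rw [hp, if_neg this]
  have e2 : (l.map fun v => potential A (Nat.log 2 (size v)) (Nat.log 2 (size (par' v)))) =
      l.map fun v => potential A (rk v) (rk (ρ x)) := by
    refine List.map_congr_left fun v hv => ?_
    rw [hp, if_pos hv]
  rw [e1, e2]
  change _ ≤ _ + (l.map fun v => potential A (rk v) (rk (par v))).sum + A + 1
  omega

/-- The root map after the tree with the root `b` has been hung below the root `a`. -/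
def _root_.UFDecoder.mergeRoot (ρ : ℕ → ℕ) (a b : ℕ) : ℕ → ℕ := fun v => if ρ v = b then a else ρ v

/-- Hanging the smaller tree below the larger one keeps ranks strictly increasing: the new size of
`a` is at least twice the size of `b`. The rank of `a` itself does not drop, so the other children
of `a` are unaffected. -/
theorem union (h : IsForest N par size ρ) {a b : ℕ} (ha : a ∈ Finset.Icc 1 N)
    (hb : b ∈ Finset.Icc 1 N) (hra : ρ a = a) (hrb : ρ b = b) (hab : a ≠ b)
    (hs : size b ≤ size a) :
    IsForest N (Function.update par b a) (Function.update size a (size a + size b))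
      (mergeRoot ρ a b) := by
  have hpa : par a = a := by have := h.par_root a ha; rwa [hra] at this
  have hpb : par b = b := by have := h.par_root b hb; rwa [hrb] at this
  have hsum : size a + size b =
      ((Finset.Icc 1 N).filter fun w => mergeRoot ρ a b w = a).card := by
    rw [h.size_root a ha hra, h.size_root b hb hrb, ← Finset.card_union_of_disjoint]
    · congr 1
      ext w
      rw [Finset.mem_union, Finset.mem_filter, Finset.mem_filter, Finset.mem_filter, ← and_or_left,
        mergeRoot]
      refine and_congr_right fun _ => ?_
      split <;> simp [*]
    · exact Finset.disjoint_filter.2 fun w _ h1 h2 => hab (h1.symm.trans h2)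
  have hb1 : 1 ≤ size b := by
    rw [h.size_root b hb hrb]
    exact Finset.card_pos.2 ⟨b, by simp only [Finset.mem_filter]; exact ⟨hb, hrb⟩⟩
  have hup : Nat.log 2 (size a) ≤ Nat.log 2 (size a + size b) := Nat.log_mono_right (by omega)
  have hup' : Nat.log 2 (size b) < Nat.log 2 (size a + size b) := by
    have : Nat.log 2 (size b * 2) ≤ Nat.log 2 (size a + size b) := Nat.log_mono_right (by omega)
    rw [Nat.log_mul_base (by norm_num) (by omega)] at this
    omega
  refine ⟨fun v hv => ?_, fun v hv => ?_, fun v hv => ?_, fun v hv => ?_, fun v hv => ?_,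
    fun v hv => ?_, fun v hv => ?_, fun v hv => ?_⟩
  · rw [Function.update_apply]; split
    exacts [ha, h.par_mem v hv]
  · unfold mergeRoot; split
    exacts [ha, h.root_mem v hv]
  · rw [Function.update_apply]; split
    · subst v; simp [mergeRoot, hra, hrb]
    · simp [mergeRoot, h.root_par v hv]
  · rw [Function.update_apply]; split
    · subst v; intro he; exact absurd he hab
    · intro he
      have := h.root_of_fixed v hv he
      simp [mergeRoot, *]
  · unfold mergeRoot; split
    · rw [Function.update_of_ne hab, hpa]
    · rw [Function.update_of_ne ‹_›, h.par_root v hv]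
  · by_cases hvb : v = b
    · subst hvb
      intro _
      rw [Function.update_self, Function.update_self, Function.update_of_ne (Ne.symm hab)]
      exact hup'
    · rw [Function.update_of_ne hvb]
      intro hv'
      have hva : v ≠ a := fun he => hv' (he ▸ hpa)
      rw [Function.update_of_ne hva, Function.update_apply]
      have := h.rank_lt v hv hv'
      split
      · rename_i he; rw [he] at this; omega
      · exact this
  · intro he
    by_cases hva : v = a
    · subst hva; rw [Function.update_self, hsum]
    · rw [Function.update_of_ne hva]
      have hvb : ρ v = v ∧ v ≠ b := by
        unfold mergeRoot at he
        split at he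
        · exact absurd he.symm hva
        · exact ⟨he, fun hh => ‹¬ _› (by rw [he, hh])⟩
      rw [h.size_root v hv hvb.1]
      congr 1
      refine Finset.filter_congr fun w _ => ?_
      unfold mergeRoot
      split
      · rename_i hw; rw [hw]; exact ⟨fun hh => absurd hh.symm hvb.2, fun hh => absurd hh.symm hva⟩
      · rfl
  · rw [Function.update_apply]; split
    · rw [hsum]; exact (Finset.card_filter_le _ _).trans (by simp)
    · exact h.size_le v hv

/-- Only the root `a` can gain. Its size at most doubles, so its rank rises by at most one, and a
root of rank r has potential A·r. All other vertices keep their rank while the rank of their parent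
does not decrease, and the potential is antitone in the latter. -/
theorem totalPotential_union (h : IsForest N par size ρ) (A : ℕ) {a b : ℕ}
    (ha : a ∈ Finset.Icc 1 N) (hb : b ∈ Finset.Icc 1 N) (hra : ρ a = a) (hrb : ρ b = b)
    (hab : a ≠ b) (hs : size b ≤ size a) :
    totalPotential A N (Function.update par b a) (Function.update size a (size a + size b)) ≤
      totalPotential A N par size + A := by
  have hpa : par a = a := by have := h.par_root a ha; rwa [hra] at this
  have hpb : par b = b := by have := h.par_root b hb; rwa [hrb] at this
  have hup : Nat.log 2 (size a) ≤ Nat.log 2 (size a + size b) := Nat.log_mono_right (by omega)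
  have hup' : Nat.log 2 (size a + size b) ≤ Nat.log 2 (size a) + 1 := by
    rcases Nat.eq_zero_or_pos (size a) with h0 | h0
    · simp [h0, show size b = 0 by omega]
    · rw [← Nat.log_mul_base (by norm_num) (by omega)]
      exact Nat.log_mono_right (by omega)
  have hsb : Nat.log 2 (size b) ≤ Nat.log 2 (size a) := Nat.log_mono_right hs
  calc _ ≤ ∑ v ∈ Finset.Icc 1 N, (potential A (Nat.log 2 (size v)) (Nat.log 2 (size (par v))) +
        if v = a then A else 0) := Finset.sum_le_sum fun v hv => ?_
    _ = _ := by rw [Finset.sum_add_distrib, Finset.sum_ite_eq' _ a]; simp only [ha, if_true]; rfl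
  by_cases hva : v = a
  · subst hva
    rw [Function.update_of_ne hab, hpa, Function.update_self, potential_self, potential_self,
      if_pos rfl]
    calc A * _ ≤ A * (Nat.log 2 (size v) + 1) := Nat.mul_le_mul_left _ hup'
      _ = _ := by ring
  · rw [Function.update_of_ne hva, if_neg hva, add_zero]
    refine potential_anti _ _ ?_
    rw [Function.update_apply par]
    split
    · subst v; rw [Function.update_self, hpb]; omega
    · rw [Function.update_apply]; split
      · rename_i he; rw [he]; exact hup
      · exact le_rfl

end IsForest

namespace Lattice

variable (G : Lattice)

/-! ### Connectivity -/

section Connectivity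

variable {G} {A B : Finset (Fin G.numE)} {u v w : Fin G.numV} {σ : Finset (Fin G.numV)}
  {ρ : ℕ → ℕ}

theorem Connected.refl (u : Fin G.numV) : G.Connected A u u := Relation.EqvGen.refl _

theorem Connected.symm (h : G.Connected A u v) : G.Connected A v u := Relation.EqvGen.symm _ _ h

theorem Connected.trans (h : G.Connected A u v) (h' : G.Connected A v w) : G.Connected A u w :=
  Relation.EqvGen.trans _ _ _ h h'

theorem connected_edge {e : Fin G.numE} (h : e ∈ A) : G.Connected A (G.src e) (G.dst e) :=
  Relation.EqvGen.rel _ _ ⟨e, h, rfl, rfl⟩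

/-- Applied with the identity to enlarge the edge set, and with a retraction of a leaf to its
neighbour to remove an edge. -/
theorem Connected.lift (h : G.Connected A u v) (f : Fin G.numV → Fin G.numV)
    (hf : ∀ e ∈ A, G.Connected B (f (G.src e)) (f (G.dst e))) : G.Connected B (f u) (f v) := by
  induction h with
  | rel _ _ h => obtain ⟨e, he, rfl, rfl⟩ := h; exact hf e he
  | refl => exact .refl _
  | symm _ _ _ ih => exact ih.symm
  | trans _ _ _ _ _ ih ih' => exact ih.trans ih'

theorem Connected.mono (h : G.Connected A u v) (hAB : A ⊆ B) : G.Connected B u v :=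
  h.lift id fun _ he => connected_edge (hAB he)

theorem Connected.eq_of_edges {α : Type*} (h : G.Connected A u v) (f : Fin G.numV → α)
    (hf : ∀ e ∈ A, f (G.src e) = f (G.dst e)) : f u = f v := by
  induction h with
  | rel _ _ h => obtain ⟨e, he, rfl, rfl⟩ := h; exact hf e he
  | refl => rfl
  | symm _ _ _ ih => exact ih.symm
  | trans _ _ _ _ _ ih ih' => exact ih.trans ih'

/-- The labels `ρ` distinguish the components of `(V, A)`. Vertices are numbered from `1`. -/
def Labels (A : Finset (Fin G.numE)) (ρ : ℕ → ℕ) : Prop :=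
  ∀ u v : Fin G.numV, G.Connected A u v ↔ ρ (u + 1) = ρ (v + 1)

/-- The hypothesis is symmetric in the two endpoints because the sizes decide which of the two roots
survives. -/
theorem Labels.union (h : Labels A ρ) {e : Fin G.numE} {a b : ℕ}
    (hab : (ρ (G.src e + 1) = a ∧ ρ (G.dst e + 1) = b) ∨
      (ρ (G.src e + 1) = b ∧ ρ (G.dst e + 1) = a)) :
    Labels (insert e A) (mergeRoot ρ a b) := by
  have hedge := connected_edge (Finset.mem_insert_self e A)
  have hmono : ∀ {x y : Fin G.numV}, ρ (x + 1) = ρ (y + 1) → G.Connected (insert e A) x y :=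
    fun hxy => ((h _ _).2 hxy).mono (Finset.subset_insert e A)
  intro u v
  constructor
  · intro huv
    refine huv.eq_of_edges (fun x => mergeRoot ρ a b (x + 1)) fun f hf => ?_
    rcases Finset.mem_insert.1 hf with rfl | hf
    · rcases hab with ⟨h1, h2⟩ | ⟨h1, h2⟩ <;> simp [mergeRoot, h1, h2]
    · have := (h _ _).1 (connected_edge hf)
      simp [mergeRoot, this]
  · intro huv
    have key : ∀ x y : Fin G.numV, ρ (x + 1) = a → ρ (y + 1) = b →
        G.Connected (insert e A) x y := by
      intro x y hx hy
      rcases hab with ⟨h1, h2⟩ | ⟨h1, h2⟩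
      · exact (hmono (hx.trans h1.symm)).trans (hedge.trans (hmono (h2.trans hy.symm)))
      · exact (hmono (hx.trans h2.symm)).trans (hedge.symm.trans (hmono (h1.trans hy.symm)))
    simp only [mergeRoot] at huv
    split at huv <;> split at huv
    · exact hmono (by simp [*])
    · exact (key _ _ huv.symm ‹_›).symm
    · exact key _ _ huv ‹_›
    · exact hmono huv

theorem Labels.of_mem (h : Labels A ρ) {e : Fin G.numE}
    (he : ρ (G.src e + 1) = ρ (G.dst e + 1)) : Labels (insert e A) ρ := by
  intro u v
  refine ⟨fun huv => huv.eq_of_edges (fun x => ρ (x + 1)) fun f hf => ?_,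
    fun huv => ((h _ _).2 huv).mono (Finset.subset_insert e A)⟩
  rcases Finset.mem_insert.1 hf with rfl | hf
  exacts [he, (h _ _).1 (connected_edge hf)]

/-- The number of syndrome vertices with the label `r`. -/
def synCount (σ : Finset (Fin G.numV)) (ρ : ℕ → ℕ) (r : ℕ) : ℕ :=
  (σ.filter fun w => ρ (w.val + 1) = r).card

open Classical in
theorem Labels.inOddCluster_iff {S : Fin G.numE → ℕ} (h : Labels (G.grown S) ρ) :
    G.InOddCluster σ S v ↔ Odd (synCount σ ρ (ρ (v + 1))) := by
  unfold InOddCluster synCount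
  have : (σ.filter fun w => G.Connected (G.grown S) v w) =
      σ.filter fun w => ρ (w.val + 1) = ρ (v.val + 1) := by
    ext w; simp [h v w, eq_comm]
  rw [this]

theorem synCount_mergeRoot {a b r : ℕ} (hab : a ≠ b) :
    synCount σ (mergeRoot ρ a b) r =
      if r = a then synCount σ ρ a + synCount σ ρ b
      else if r = b then 0 else synCount σ ρ r := by
  unfold synCount mergeRoot
  split
  · subst r
    rw [← Finset.card_union_of_disjoint]
    · congr 1
      ext w
      rw [Finset.mem_union, Finset.mem_filter, Finset.mem_filter, Finset.mem_filter, ← and_or_left]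
      refine and_congr_right fun _ => ?_
      split <;> simp [*]
    · exact Finset.disjoint_filter.2 fun w _ h1 h2 => hab (h1.symm.trans h2)
  · split
    · subst r
      rw [Finset.card_eq_zero, Finset.filter_eq_empty_iff]
      intro w _
      split
      exacts [hab, ‹_›]
    · congr 1
      refine Finset.filter_congr fun w _ => ?_
      split
      · rename_i h1 h2 h3
        rw [h3]
        exact ⟨fun h => absurd h.symm ‹¬r = a›, fun h => absurd h.symm ‹¬r = b›⟩
      · rfl

/-- The handshake lemma: a union of components contains an even number of syndrome vertices. -/
theorem even_card_syndrome_filter (E : Finset (Fin G.numE)) (X : Fin G.numV → Prop)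
    [DecidablePred X] (hX : ∀ e ∈ E, X (G.src e) ↔ X (G.dst e)) :
    Even ((G.syndrome E).filter X).card := by
  set f : Fin G.numV → ℕ := fun v =>
    (E.filter fun e => G.src e = v).card + (E.filter fun e => G.dst e = v).card
  have h1 : (G.syndrome E).filter X = (Finset.univ.filter X).filter fun v => Odd (f v) := by
    ext v; simp [syndrome, f, and_comm]
  rw [h1, ← Finset.even_sum_iff_even_card_odd, Finset.sum_add_distrib]
  -- Double counting: the ends given by `g` that lie in `X` are counted once by vertices and once by
  -- edges. For sources and targets the results agree, since `X` does not separate endpoints of an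
  -- edge, so the total is twice a number.
  have hs : ∀ g : Fin G.numE → Fin G.numV, ∑ v ∈ Finset.univ.filter X,
      (E.filter fun e => g e = v).card = (E.filter fun e => X (g e)).card := by
    intro g
    rw [Finset.card_eq_sum_card_fiberwise (f := g) (t := Finset.univ.filter X)]
    · refine Finset.sum_congr rfl fun v hv => ?_
      congr 1
      ext e
      simp only [Finset.mem_filter, Finset.mem_univ, true_and] at hv ⊢
      constructor
      · rintro ⟨h, rfl⟩; exact ⟨⟨h, hv⟩, rfl⟩
      · rintro ⟨⟨h, _⟩, rfl⟩; exact ⟨h, rfl⟩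
    · intro e he; simpa using (Finset.mem_filter.1 he).2
  rw [hs, hs, Finset.filter_congr hX]
  exact Even.add_self _

/-! ### Forests -/

theorem not_connected_of_isolated (hw : ∀ f ∈ A, G.src f ≠ w ∧ G.dst f ≠ w) (h : v ≠ w) :
    ¬ G.Connected A v w := fun hc => by
  have := hc.eq_of_edges (fun x => decide (x = w)) fun f hf => by simp [hw f hf]
  simp [h] at this

/-- Adding a leaf `w` to an acyclic edge set. -/
theorem acyclic_insert {e : Fin G.numE} (hA : ∀ f ∈ A, ¬ G.Connected (A.erase f) (G.src f) (G.dst f))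
    (hw : ∀ f ∈ A, G.src f ≠ w ∧ G.dst f ≠ w) (hvw : v ≠ w)
    (he : (G.src e = v ∧ G.dst e = w) ∨ (G.src e = w ∧ G.dst e = v)) :
    ∀ f ∈ insert e A, ¬ G.Connected ((insert e A).erase f) (G.src f) (G.dst f) := by
  have heA : e ∉ A := fun h => by have := hw e h; tauto
  intro f hf
  rcases Finset.mem_insert.1 hf with rfl | hf
  · rw [Finset.erase_insert heA]
    rcases he with ⟨h1, h2⟩ | ⟨h1, h2⟩ <;> rw [h1, h2]
    · exact not_connected_of_isolated hw hvw
    · exact fun h => not_connected_of_isolated hw hvw h.symm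
  · intro hc
    have hfe : e ≠ f := fun h => heA (h ▸ hf)
    rw [Finset.erase_insert_of_ne hfe] at hc
    refine hA f hf ?_
    -- Folding the leaf `w` onto its only neighbour `v` contracts the edge `e` and fixes all other
    -- edges, so a connection that uses `e` becomes one without it.
    have := hc.lift (B := A.erase f) (fun x => if x = w then v else x) fun g hg => ?_
    · simpa [hw f hf] using this
    · rcases Finset.mem_insert.1 hg with rfl | hg
      · rcases he with ⟨h1, h2⟩ | ⟨h1, h2⟩ <;> simp [h1, h2, hvw, Connected.refl]
      · have h' := hw g (Finset.mem_of_mem_erase hg)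
        simpa [h'] using connected_edge hg

/-- A new edge toggles the parity at each of its two endpoints. A loop would contribute two ends at
the same vertex and toggle nothing, hence `hl`. -/
theorem mem_syndrome_insert {C : Finset (Fin G.numE)} {e : Fin G.numE} (he : e ∉ C)
    (hl : G.src e ≠ G.dst e) :
    v ∈ G.syndrome (insert e C) ↔ ((v = G.src e ∨ v = G.dst e) ↔ v ∉ G.syndrome C) := by
  have hc : ∀ g : Fin G.numE → Fin G.numV, ((insert e C).filter fun e => g e = v).card =
      (C.filter fun e => g e = v).card + if v = g e then 1 else 0 := by
    intro g
    rw [Finset.filter_insert]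
    by_cases h : g e = v
    · rw [if_pos h, if_pos h.symm, Finset.card_insert_of_notMem (by simp [he])]
    · rw [if_neg h, if_neg (Ne.symm h), add_zero]
  simp only [syndrome, Finset.mem_filter, Finset.mem_univ, true_and, hc]
  generalize (C.filter fun e => G.src e = v).card = a
  generalize (C.filter fun e => G.dst e = v).card = b
  by_cases h1 : v = G.src e
  · have h2 : v ≠ G.dst e := fun h => hl (h1.symm.trans h)
    simp only [h1, if_true, true_or, true_iff]
    rw [if_neg hl]
    simp only [Nat.odd_iff]; omega
  · by_cases h2 : v = G.dst e
    · simp only [h2, if_true, or_true, true_iff]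
      rw [if_neg (Ne.symm hl)]
      simp only [Nat.odd_iff]; omega
    · simp [h1, h2]

end Connectivity

/-! ### Edge ends -/

/-- The source of an edge in memory. -/
def srcN (e : ℕ) : ℕ := if h : e < G.numE then (G.src ⟨e, h⟩).val + 1 else 0

/-- The other endpoint of an edge in memory. -/
def dstN (e : ℕ) : ℕ := if h : e < G.numE then (G.dst ⟨e, h⟩).val + 1 else 0

/-- The edge of an edge end. -/
def edgeN (d : ℕ) : ℕ := (d - 1) / 2

/-- The vertex at which an edge end lies. -/
def endN (d : ℕ) : ℕ := if d % 2 = 1 then G.srcN (edgeN d) else G.dstN (edgeN d)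

/-- The far vertex of an edge end. -/
def farN (d : ℕ) : ℕ := if d % 2 = 1 then G.dstN (edgeN d) else G.srcN (edgeN d)

/-- The edge ends at the vertex `v` among the first `k` ones. -/
def endsUpTo (k v : ℕ) : List ℕ := ((List.range' 1 k).filter fun d => G.endN d = v).reverse

/-- The edge ends at the vertex `v`. -/
def ends (v : ℕ) : List ℕ := G.endsUpTo (2 * G.numE) v

variable {G}

theorem srcN_coe (e : Fin G.numE) : G.srcN e = G.src e + 1 := by simp [srcN]

theorem dstN_coe (e : Fin G.numE) : G.dstN e = G.dst e + 1 := by simp [dstN]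

theorem srcN_mem {e : ℕ} (he : e < G.numE) : G.srcN e ∈ Finset.Icc 1 G.numV := by
  have := (G.src ⟨e, he⟩).isLt
  simp [srcN, he]

theorem dstN_mem {e : ℕ} (he : e < G.numE) : G.dstN e ∈ Finset.Icc 1 G.numV := by
  have := (G.dst ⟨e, he⟩).isLt
  simp [dstN, he]

theorem edgeN_lt {d : ℕ} (h1 : 1 ≤ d) (h2 : d ≤ 2 * G.numE) : edgeN d < G.numE := by
  unfold edgeN; omega

@[simp] theorem edgeN_odd (e : ℕ) : edgeN (2 * e + 1) = e := by unfold edgeN; omega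

@[simp] theorem edgeN_even (e : ℕ) : edgeN (2 * e + 2) = e := by unfold edgeN; omega

@[simp] theorem endN_odd (e : ℕ) : G.endN (2 * e + 1) = G.srcN e := by
  rw [endN, if_pos (by omega), edgeN_odd]

@[simp] theorem endN_even (e : ℕ) : G.endN (2 * e + 2) = G.dstN e := by
  rw [endN, if_neg (by omega), edgeN_even]

@[simp] theorem farN_odd (e : ℕ) : G.farN (2 * e + 1) = G.dstN e := by
  rw [farN, if_pos (by omega), edgeN_odd]

@[simp] theorem farN_even (e : ℕ) : G.farN (2 * e + 2) = G.srcN e := by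
  rw [farN, if_neg (by omega), edgeN_even]

theorem farN_mem {d : ℕ} (h1 : 1 ≤ d) (h2 : d ≤ 2 * G.numE) : G.farN d ∈ Finset.Icc 1 G.numV := by
  unfold farN; split
  exacts [dstN_mem (edgeN_lt h1 h2), srcN_mem (edgeN_lt h1 h2)]

theorem mem_endsUpTo {k v d : ℕ} : d ∈ G.endsUpTo k v ↔ 1 ≤ d ∧ d ≤ k ∧ G.endN d = v := by
  simp [endsUpTo, List.mem_range'_1, and_assoc]
  intro _ _
  omega

theorem mem_ends {v d : ℕ} : d ∈ G.ends v ↔ 1 ≤ d ∧ d ≤ 2 * G.numE ∧ G.endN d = v :=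
  mem_endsUpTo

/-- The reversal in `endsUpTo` reflects that `initTables` inserts each edge end at the head of the
linked list of its vertex. -/
theorem endsUpTo_succ (k v : ℕ) : G.endsUpTo (k + 1) v =
    if G.endN (k + 1) = v then (k + 1) :: G.endsUpTo k v else G.endsUpTo k v := by
  rw [endsUpTo, List.range'_concat, List.filter_append, List.reverse_append]
  simp only [Nat.one_mul, Nat.add_comm 1 k]
  split <;> simp [*, endsUpTo]

theorem nodup_ends (v : ℕ) : (G.ends v).Nodup := by
  unfold ends endsUpTo
  rw [List.nodup_reverse]
  exact List.Nodup.filter _ List.nodup_range'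

theorem sum_length_ends : ∑ v ∈ Finset.Icc 1 G.numV, (G.ends v).length ≤ 2 * G.numE := by
  have : ∀ k, ∑ v ∈ Finset.Icc 1 G.numV, (G.endsUpTo k v).length ≤ k := by
    intro k
    induction k with
    | zero => simp [endsUpTo]
    | succ k ih =>
      calc _ = ∑ v ∈ Finset.Icc 1 G.numV,
            ((G.endsUpTo k v).length + if G.endN (k + 1) = v then 1 else 0) := by
            refine Finset.sum_congr rfl fun v _ => ?_
            rw [endsUpTo_succ]; split <;> simp
        _ ≤ k + 1 := by
            rw [Finset.sum_add_distrib, Finset.sum_ite_eq]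
            split <;> omega
  exact this _

/-- Each vertex owns at least one of the 2n edge ends. This turns all bounds in terms of |V| into
bounds in terms of n. -/
theorem NoIsolatedVertex.numV_le (h : G.NoIsolatedVertex) : G.numV ≤ 2 * G.numE := by
  have hle : ∀ v ∈ Finset.Icc 1 G.numV, 1 ≤ (G.ends v).length := by
    intro v hv
    rw [Finset.mem_Icc] at hv
    obtain ⟨e, he⟩ := h ⟨v - 1, by omega⟩
    have hlt := e.isLt
    refine List.length_pos_iff_exists_mem.2 ?_
    rcases he with he | he
    · refine ⟨2 * e + 1, mem_ends.2 ⟨by omega, by omega, ?_⟩⟩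
      rw [endN_odd, srcN_coe, he]; simp; omega
    · refine ⟨2 * e + 2, mem_ends.2 ⟨by omega, by omega, ?_⟩⟩
      rw [endN_even, dstN_coe, he]; simp; omega
  have := (Finset.card_nsmul_le_sum _ _ _ hle).trans sum_length_ends
  simpa using this

/-! ### The potential of the growth -/

variable (G)

/-- In the growth state `f`, the vertex `v` is a boundary vertex. -/
def IsBoundary (f : ℕ → ℕ) (v : ℕ) : Prop := ∃ d ∈ G.ends v, f (edgeN d) ≠ 2

instance (f : ℕ → ℕ) (v : ℕ) : Decidable (G.IsBoundary f v) := by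
  unfold IsBoundary; infer_instance

/-- The number of steps for a visit to `v`, up to a constant. -/
def weight (v : ℕ) : ℕ := (G.ends v).length + 1

/-- An upper bound for the number of rounds in which `v` can still grow. -/
def credit (f : ℕ → ℕ) (v : ℕ) : ℕ := (G.ends v).toFinset.sup fun d => 2 - f (edgeN d)

/-- The potential of the growth state. -/
def growthPotential (f : ℕ → ℕ) : ℕ := ∑ v ∈ Finset.Icc 1 G.numV, G.weight v * G.credit f v

variable {G}

theorem sum_weight_le : ∑ v ∈ Finset.Icc 1 G.numV, G.weight v ≤ 2 * G.numE + G.numV := by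
  unfold weight
  rw [Finset.sum_add_distrib]
  have := sum_length_ends (G := G)
  simp; omega

theorem growthPotential_le (f : ℕ → ℕ) :
    G.growthPotential f ≤ 2 * (2 * G.numE + G.numV) := by
  calc _ ≤ ∑ v ∈ Finset.Icc 1 G.numV, G.weight v * 2 := Finset.sum_le_sum fun v _ =>
        Nat.mul_le_mul_left _ (Finset.sup_le fun d _ => by omega)
    _ ≤ _ := by
        rw [← Finset.sum_mul]
        have := sum_weight_le (G := G)
        omega

theorem credit_anti {f f' : ℕ → ℕ} (h : ∀ e < G.numE, f e ≤ f' e) (v : ℕ) :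
    G.credit f' v ≤ G.credit f v := by
  refine Finset.sup_mono_fun fun d hd => ?_
  obtain ⟨h1, h2, _⟩ := mem_ends.1 (List.mem_toFinset.1 hd)
  have := h _ (edgeN_lt h1 h2)
  omega

/-- The credit of a boundary vertex is positive, as one of its edges is not grown. If all its edges
that are not grown advance by a half-edge, every positive term of the maximum drops by at least one.
-/
theorem credit_lt {f f' : ℕ → ℕ} {v : ℕ} (hv : G.IsBoundary f v) (hf : ∀ e < G.numE, f e ≤ 2)
    (h : ∀ d ∈ G.ends v, min 2 (f (edgeN d) + 1) ≤ f' (edgeN d)) :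
    G.credit f' v + 1 ≤ G.credit f v := by
  obtain ⟨d₀, hd₀, hne⟩ := hv
  have h0 : 1 ≤ G.credit f v := by
    refine le_trans ?_ (Finset.le_sup (f := fun d => 2 - f (edgeN d)) (List.mem_toFinset.2 hd₀))
    obtain ⟨h1, h2, _⟩ := mem_ends.1 hd₀
    have := hf _ (edgeN_lt h1 h2)
    show 1 ≤ 2 - f (edgeN d₀)
    omega
  suffices G.credit f' v ≤ G.credit f v - 1 by omega
  refine Finset.sup_le fun d hd => ?_
  have h1 := Finset.le_sup (f := fun d => 2 - f (edgeN d)) hd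
  have h2 := h d (List.mem_toFinset.1 hd)
  change 2 - f (edgeN d) ≤ G.credit f v at h1
  omega

/-- The central estimate for the linear bounds: a round in which the vertices of `l` grow is paid,
with their full weight, by the decrease of the potential. Summed over all rounds, the weights of the
growing vertices stay below the initial potential. -/
theorem growthPotential_grow {f f' : ℕ → ℕ} {l : List ℕ} (hl : l.Nodup)
    (hlV : ∀ v ∈ l, v ∈ Finset.Icc 1 G.numV) (hb : ∀ v ∈ l, G.IsBoundary f v)
    (hf : ∀ e < G.numE, f e ≤ 2) (hff : ∀ e < G.numE, f e ≤ f' e)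
    (h : ∀ v ∈ l, ∀ d ∈ G.ends v, min 2 (f (edgeN d) + 1) ≤ f' (edgeN d)) :
    G.growthPotential f' + (l.map G.weight).sum ≤ G.growthPotential f := by
  rw [← List.sum_toFinset _ hl]
  have e1 : ∑ v ∈ l.toFinset, G.weight v =
      ∑ v ∈ Finset.Icc 1 G.numV, if v ∈ l.toFinset then G.weight v else 0 := by
    rw [Finset.sum_ite_mem, Finset.inter_eq_right.2]
    intro v hv; exact hlV v (List.mem_toFinset.1 hv)
  rw [e1, growthPotential, ← Finset.sum_add_distrib]
  refine Finset.sum_le_sum fun v _ => ?_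
  split
  · rename_i hv
    rw [List.mem_toFinset] at hv
    have := Nat.mul_le_mul_left (G.weight v) (credit_lt (hb v hv) hf (h v hv))
    rwa [Nat.mul_add, Nat.mul_one] at this
  · exact Nat.mul_le_mul_left _ (credit_anti hff v)

end Lattice

open UFDecoder.Lattice

/-! ### The incidence tables -/

/-- The store contains the lattice and its incidence lists. -/
structure Incidence (G : Lattice) (s : Store) : Prop where
  numV : s.var .numV = G.numV
  numE : s.var .numE = G.numE
  src : s.tab .src = G.srcN
  dst : s.tab .dst = G.dstN
  chain : ∀ v ∈ Finset.Icc 1 G.numV, Chain (s.tab .next) (s.tab .first v) (G.ends v)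
  edge : ∀ d, 1 ≤ d → d ≤ 2 * G.numE → s.tab .edge d = edgeN d
  target : ∀ d, 1 ≤ d → d ≤ 2 * G.numE → s.tab .target d = G.farN d

/-- The command does not change the lattice and the incidence lists. -/
def Cmd.keepsIncidence (c : Cmd) : Bool :=
  !(c.writesVar .numV || c.writesVar .numE || c.writesTab .src || c.writesTab .dst ||
    c.writesTab .next || c.writesTab .first || c.writesTab .edge || c.writesTab .target)

theorem Incidence.frame {G : Lattice} {W p c s t s' t'} (h : Incidence G s)
    (hf : Frame W p c s t s' t') (hc : c.keepsIncidence = true) : Incidence G s' := by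
  simp [Cmd.keepsIncidence] at hc
  obtain ⟨⟨⟨⟨⟨⟨⟨h1, h2⟩, h3⟩, h4⟩, h5⟩, h6⟩, h7⟩, h8⟩ := hc
  constructor
  · rw [hf.var _ h1, h.numV]
  · rw [hf.var _ h2, h.numE]
  · rw [hf.tab _ h3, h.src]
  · rw [hf.tab _ h4, h.dst]
  · rw [hf.tab _ h5, hf.tab _ h6]; exact h.chain
  · rw [hf.tab _ h7]; exact h.edge
  · rw [hf.tab _ h8]; exact h.target

theorem Incidence.setVar {G : Lattice} {s : Store} (h : Incidence G s) {x : Var} {k : ℕ}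
    (hx : x ≠ .numV ∧ x ≠ .numE := by decide) : Incidence G (s.setVar x k) := by
  obtain ⟨h1, h2, h3, h4, h5, h6, h7⟩ := h
  constructor <;> simp_all [Ne.symm hx.1, Ne.symm hx.2, -Finset.mem_Icc]

theorem Incidence.setTab {G : Lattice} {s : Store} (h : Incidence G s) {a : Tab} {i k : ℕ}
    (ha : a ≠ .src ∧ a ≠ .dst ∧ a ≠ .next ∧ a ≠ .first ∧ a ≠ .edge ∧ a ≠ .target := by decide) :
    Incidence G (s.setTab a i k) := by
  obtain ⟨h1, h2, h3, h4, h5, h6, h7⟩ := h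
  obtain ⟨a1, a2, a3, a4, a5, a6⟩ := ha
  constructor <;> simp_all [Ne.symm a1, Ne.symm a2, Ne.symm a3, Ne.symm a4, Ne.symm a5,
    Ne.symm a6, -Finset.mem_Icc]

/-- Head insertion of the edge end k + 1 at its vertex. The link of k + 1 was not used before, so
the lists of the other vertices survive. -/
theorem chain_insert_end {G : Lattice} {nxt fst : ℕ → ℕ} {k : ℕ}
    (h : ∀ v ∈ Finset.Icc 1 G.numV, Chain nxt (fst v) (G.endsUpTo k v)) :
    ∀ v ∈ Finset.Icc 1 G.numV,
      Chain (Function.update nxt (k + 1) (fst (G.endN (k + 1))))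
        (Function.update fst (G.endN (k + 1)) (k + 1) v) (G.endsUpTo (k + 1) v) := by
  intro v hv
  have hn : k + 1 ∉ G.endsUpTo k v := fun h => by have := mem_endsUpTo.1 h; omega
  have h' := (h v hv).update hn (fst (G.endN (k + 1)))
  rw [endsUpTo_succ]
  by_cases he : G.endN (k + 1) = v
  · rw [if_pos he, he, Function.update_self]
    refine ⟨rfl, by omega, ?_⟩
    rw [Function.update_self, ← he]; rwa [← he] at h'
  · rw [if_neg he, Function.update_of_ne (Ne.symm he)]; exact h'

theorem wp_initTables {G : Lattice} {W : ℕ} {p : Phase} {s : Store} {t : Phase → ℕ}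
    (hB : s.Bounded W) (hW : G.numV + 1 ≤ W) (hW' : 2 * G.numE + 2 ≤ W)
    (hV : s.var .numV = G.numV) (hE : s.var .numE = G.numE) (hsrc : s.tab .src = G.srcN)
    (hdst : s.tab .dst = G.dstN) :
    Wp W p .initTables (fun s' t' => Incidence G s' ∧
      (∀ v ∈ Finset.Icc 1 G.numV, s'.tab .seen v = 0 ∧ s'.tab .mark v = 0) ∧
      (∀ e < G.numE, s'.tab .support e = if s.tab .erased e = 1 then 2 else 0) ∧
      t' p ≤ t p + 30 + 100 * G.numE + 30 * G.numV) s t := by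
  have hB1 : (s.setVar .v 1).Bounded W := hB.setVar (by omega)
  simp [Cmd.initTables, -Finset.mem_Icc]
  refine ⟨by omega, ?_⟩
  -- Vertices are counted from 1, so the time bound is 22(v - 1); adding 22 on the left avoids
  -- truncated subtraction.
  refine (Wp.loop (I := fun s₁ t₁ => 1 ≤ s₁.var .v ∧ s₁.var .v ≤ G.numV + 1 ∧
      (∀ v, 1 ≤ v → v < s₁.var .v →
        s₁.tab .first v = 0 ∧ s₁.tab .seen v = 0 ∧ s₁.tab .mark v = 0) ∧
      t₁ p + 22 ≤ t p + 2 + 22 * s₁.var .v)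
    (Q := fun s₁ t₁ => (∀ v ∈ Finset.Icc 1 G.numV,
      s₁.tab .first v = 0 ∧ s₁.tab .seen v = 0 ∧ s₁.tab .mark v = 0) ∧
      t₁ p ≤ t p + 10 + 22 * G.numV)
    (fun s₁ => G.numV + 1 - s₁.var .v) hB1 ?_ ?_ ?_).frame hB1 ?_
  · simp; omega
  · rintro s₁ t₁ hf ⟨h1, h2, h3, h4⟩ hb
    have hN : s₁.var .numV = G.numV := by rw [hf.var _ rfl]; simpa using hV
    simp [hN] at hb ⊢
    refine ⟨by omega, ⟨hb, fun v hv hv' => ?_, by omega⟩, by omega⟩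
    simp only [Function.update_apply]
    split
    · simp
    · exact h3 v hv (by omega)
  · rintro s₁ t₁ hf ⟨h1, h2, h3, h4⟩ hb
    have hN : s₁.var .numV = G.numV := by rw [hf.var _ rfl]; simpa using hV
    simp [hN] at hb ⊢
    exact ⟨fun v hv hv' => h3 v hv (by omega), by omega⟩
  · rintro s₁ t₁ hf ⟨h1, h2⟩
    have hN : s₁.var .numE = G.numE := by rw [hf.var _ rfl]; simpa using hE
    have hB2 : ((s₁.setVar .e 0).setVar .d 1).Bounded W :=
      (hf.bounded.setVar (by omega)).setVar (by omega)
    simp [-Finset.mem_Icc]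
    refine ⟨by omega, ?_⟩
    refine (Wp.loop (I := fun s₂ t₂ => s₂.var .e ≤ G.numE ∧ s₂.var .d = 2 * s₂.var .e + 1 ∧
        (∀ v ∈ Finset.Icc 1 G.numV,
          Chain (s₂.tab .next) (s₂.tab .first v) (G.endsUpTo (2 * s₂.var .e) v)) ∧
        (∀ d, 1 ≤ d → d ≤ 2 * s₂.var .e →
          s₂.tab .edge d = edgeN d ∧ s₂.tab .target d = G.farN d) ∧
        (∀ e < s₂.var .e, s₂.tab .support e = if s.tab .erased e = 1 then 2 else 0) ∧
        t₂ p ≤ t p + 14 + 22 * G.numV + 100 * s₂.var .e)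
      (Q := fun s₂ t₂ =>
        (∀ v ∈ Finset.Icc 1 G.numV, Chain (s₂.tab .next) (s₂.tab .first v) (G.ends v)) ∧
        (∀ d, 1 ≤ d → d ≤ 2 * G.numE → s₂.tab .edge d = edgeN d ∧ s₂.tab .target d = G.farN d) ∧
        (∀ e < G.numE, s₂.tab .support e = if s.tab .erased e = 1 then 2 else 0) ∧
        t₂ p ≤ t p + 30 + 22 * G.numV + 100 * G.numE)
      (fun s₂ => G.numE - s₂.var .e) hB2 ?_ ?_ ?_).frame hB2 ?_
    · simp [endsUpTo, Chain, -Finset.mem_Icc]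
      exact ⟨fun v hv => (h1 v hv).1, fun d hd hd' => by omega, by omega⟩
    · rintro s₂ t₂ hf₂ ⟨g1, g2, g3, g4, g5, g6⟩ hb
      have hNE : s₂.var .numE = G.numE := by rw [hf₂.var _ rfl]; simpa using hN
      have hsrc' : s₂.tab .src = G.srcN := by
        rw [hf₂.tab _ rfl]; simp; rw [hf.tab _ rfl]; simpa using hsrc
      have hdst' : s₂.tab .dst = G.dstN := by
        rw [hf₂.tab _ rfl]; simp; rw [hf.tab _ rfl]; simpa using hdst
      have her : s₂.tab .erased = s.tab .erased := by
        rw [hf₂.tab _ rfl]; simp; rw [hf.tab _ rfl]; simp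
      simp [hNE, hsrc', hdst', her, -Finset.mem_Icc] at hb ⊢
      have he1 : G.endN (s₂.var .d) = G.srcN (s₂.var .e) := by rw [g2, endN_odd]
      have he2 : G.endN (s₂.var .d + 1) = G.dstN (s₂.var .e) := by rw [g2]; exact endN_even _
      have hchain := chain_insert_end (chain_insert_end g3)
      rw [← g2, he1, he2] at hchain
      have hd2 : s₂.var .d + 1 = 2 * (s₂.var .e + 1) := by omega
      have htab : ∀ d, 1 ≤ d → d ≤ 2 * (s₂.var .e + 1) →
          Function.update (Function.update (s₂.tab .edge) (s₂.var .d) (s₂.var .e))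
            (s₂.var .d + 1) (s₂.var .e) d = edgeN d ∧
          Function.update (Function.update (s₂.tab .target) (s₂.var .d) (G.dstN (s₂.var .e)))
            (s₂.var .d + 1) (G.srcN (s₂.var .e)) d = G.farN d := by
        intro d hd hd'
        simp only [Function.update_apply]
        split
        · subst d; rw [g2]; exact ⟨(edgeN_even _).symm, (farN_even _).symm⟩
        · split
          · subst d; rw [g2]; exact ⟨(edgeN_odd _).symm, (farN_odd _).symm⟩
          · exact g4 d hd (by omega)
      rw [hd2] at htab hchain ⊢
      have hsW := hf₂.bounded.tab .src (s₂.var .e)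
      have hdW := hf₂.bounded.tab .dst (s₂.var .e)
      -- If the edge is a loop, the second insertion reads the head that the first one has just
      -- written.
      have hfW : Function.update (s₂.tab .first) (G.srcN (s₂.var .e)) (s₂.var .d)
          (G.dstN (s₂.var .e)) ≤ W := by
        rw [Function.update_apply]; split
        exacts [hf₂.bounded.var _, hf₂.bounded.tab _ _]
      rw [hsrc'] at hsW
      rw [hdst'] at hdW
      refine ⟨by omega, hdW, hf₂.bounded.tab _ _, by omega, by omega, by omega, hsW, hfW, by omega,
        by omega, fun h => ⟨by omega, by omega, ⟨hb, rfl, hchain, htab, ?_, by omega⟩, by omega⟩,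
        fun h => ⟨by omega, ⟨hb, rfl, hchain, htab, ?_, by omega⟩, by omega⟩⟩
      all_goals
        intro e he
        rw [Function.update_apply]; split
        · subst e; simp [h]
        · exact g5 e (by omega)
    · rintro s₂ t₂ hf₂ ⟨g1, g2, g3, g4, g5, g6⟩ hb
      have hNE : s₂.var .numE = G.numE := by rw [hf₂.var _ rfl]; simpa using hN
      simp [hNE, -Finset.mem_Icc] at hb ⊢
      have he : s₂.var .e = G.numE := by omega
      rw [he] at g3 g4 g5 g6
      exact ⟨g3, g4, g5, by omega⟩
    · rintro s₂ t₂ hf₂ ⟨g1, g2, g3, g4⟩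
      refine ⟨⟨?_, ?_, ?_, ?_, g1, fun d h h' => (g2 d h h').1, fun d h h' => (g2 d h h').2⟩,
        fun v hv => ?_, g3, by omega⟩
      · rw [hf₂.var _ rfl]; simp; rw [hf.var _ rfl]; simpa using hV
      · rw [hf₂.var _ rfl]; simpa using hN
      · rw [hf₂.tab _ rfl]; simp; rw [hf.tab _ rfl]; simpa using hsrc
      · rw [hf₂.tab _ rfl]; simp; rw [hf.tab _ rfl]; simpa using hdst
      · rw [hf₂.tab _ rfl, hf₂.tab _ rfl]; exact (h1 v hv).2

/-! ### Find and Union -/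

/-- The factor 18 is the cost of a vertex on the path: 7 steps in the upward walk and 11 in the
compression. By `IsForest.totalPotential_compress` the potential pays for all but A + 1 vertices,
which leaves 18A + 18, and 11 steps are independent of the path. -/
theorem wp_find {W N A : ℕ} {p : Phase} {s : Store} {t : Phase → ℕ} {x y : Var} {ρ : ℕ → ℕ}
    (hB : s.Bounded W) (hxy : x ≠ y) (hyz : y ≠ .z) (hyw : y ≠ .w)
    (h : IsForest N (s.tab .parent) (s.tab .size) ρ) (hx : s.var x ∈ Finset.Icc 1 N)
    (hA : Nat.log 2 N < hierarchy A 1) :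
    Wp W p (.find x y) (fun s' t' => s'.var y = ρ (s.var x) ∧
      IsForest N (s'.tab .parent) (s.tab .size) ρ ∧
      t' .unionFind + 18 * totalPotential A N (s'.tab .parent) (s.tab .size) ≤
        t .unionFind + 18 * totalPotential A N (s.tab .parent) (s.tab .size) + 18 * A + 29) s t := by
  obtain ⟨l, hl, hm⟩ := h.exists_path hx
  have hrank : ∀ v ∈ l, Nat.log 2 (s.tab .size v) < Nat.log 2 (s.tab .size (s.tab .parent v)) :=
    fun v hv => h.rank_lt v (hm v hv).1 (hm v hv).2.2.2
  have hnd : l.Nodup := hl.nodup (rk := fun v => Nat.log 2 (s.tab .size v)) hrank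
  rw [Cmd.find, wp_charge, wp_seq, wp_set]
  refine ⟨hB.var _, ?_⟩
  have hB1 : (s.setVar y (s.var x)).Bounded W := hB.setVar (hB.var _)
  rw [wp_seq]
  refine (Wp.loopList (l := l) (I := fun l₁ l₂ s₁ t₁ =>
      Path (s.tab .parent) (ρ (s.var x)) (s₁.var y) l₂ ∧
      t₁ .unionFind = t .unionFind + 2 + 7 * l₁.length)
    (Q := fun s₁ t₁ => s₁.var y = ρ (s.var x) ∧
      t₁ .unionFind = t .unionFind + 6 + 7 * l.length) hB1 ?_ ?_ ?_).frame hB1 ?_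
  · simp [hl]
  · rintro l₁ v l₂ s₁ t₁ hll hf ⟨⟨h1, h2, h3⟩, h4⟩
    have hpar : s₁.tab .parent = s.tab .parent := hf.tab _ rfl
    have hv := hm v (by simp [hll])
    simp [hpar, h1, h3, h4]
    exact ⟨hv.2.2.2, by rw [← hpar]; exact hf.bounded.tab _ _, by omega⟩
  · rintro s₁ t₁ hf ⟨h1, h2⟩
    have hpar : s₁.tab .parent = s.tab .parent := hf.tab _ rfl
    simp [hpar, show s₁.var y = ρ (s.var x) from h1, h2, h.par_root _ hx]
    omega
  · rintro s₁ t₁ hf ⟨h1, h2⟩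
    have hpar : s₁.tab .parent = s.tab .parent := hf.tab _ rfl
    have hxs : s₁.var x = s.var x := by
      rw [hf.var x (by simp [Cmd.writesVar, hxy])]; simp [hxy]
    rw [wp_seq, wp_set]
    refine ⟨hf.bounded.var _, ?_⟩
    have hB2 : (s₁.setVar .z (s₁.var x)).Bounded W := hf.bounded.setVar (hf.bounded.var _)
    -- The second walk follows the original parents: the path has no repetitions, so the link of a
    -- vertex is still the old one when it is read into `w`, just before it is overwritten.
    refine Wp.loopList (l := l) (I := fun l₁ l₂ s₂ t₂ =>
      Path (s.tab .parent) (ρ (s.var x)) (s₂.var .z) l₂ ∧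
      (∀ v, s₂.tab .parent v = if v ∈ l₁ then ρ (s.var x) else s.tab .parent v) ∧
      t₂ .unionFind = t .unionFind + 8 + 7 * l.length + 11 * l₁.length) hB2 ?_ ?_ ?_
    · simp [hxs, hl, hpar, h2]
      omega
    · rintro l₁ v l₂ s₂ t₂ hll hf₂ ⟨⟨g1, g2, g3⟩, g4, g5⟩
      have hys : s₂.var y = ρ (s.var x) := by
        rw [hf₂.var y (by simp [Cmd.writesVar, hyz, hyw])]; simpa [hyz] using h1
      have hv : v ∉ l₁ := fun hv => by
        rw [hll, List.nodup_append] at hnd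
        exact hnd.2.2 v hv v (by simp) rfl
      simp [hys, g1, g2, hyw]
      refine ⟨hf₂.bounded.tab _ _, by rw [← hys]; exact hf₂.bounded.var _,
        hf₂.bounded.tab _ _, ?_, ?_, ?_⟩
      · rw [g4, if_neg hv]; exact g3
      · intro v'
        rw [Function.update_apply, g4]
        by_cases hvv : v' = v <;> simp [hvv]
      · omega
    · rintro s₂ t₂ hf₂ ⟨g1, g2, g3⟩
      have hys : s₂.var y = ρ (s.var x) := by
        rw [hf₂.var y (by simp [Cmd.writesVar, hyz, hyw])]; simpa [hyz] using h1
      have hpot := h.totalPotential_compress hx hl hm g2 hA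
      simp only [tick_apply, if_true]
      refine ⟨by simp [hys, show s₂.var .z = _ from g1], hys, h.compress hx hm g2, ?_⟩
      simp
      omega

/-- The result leaves open which of the two roots is now in `a`, since the registers are exchanged
if the first tree is smaller. The term 18A pays for the growth of the potential, in the same unit as
in `wp_find`. -/
theorem wp_union {W N A : ℕ} {p : Phase} {s : Store} {t : Phase → ℕ} {ρ : ℕ → ℕ}
    (hB : s.Bounded W) (hNW : N ≤ W) (hW : 1 ≤ W)
    (h : IsForest N (s.tab .parent) (s.tab .size) ρ) (ha : s.var .a ∈ Finset.Icc 1 N)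
    (hb : s.var .b ∈ Finset.Icc 1 N) (hra : ρ (s.var .a) = s.var .a)
    (hrb : ρ (s.var .b) = s.var .b) (hab : s.var .a ≠ s.var .b) :
    Wp W p .union (fun s' t' =>
      ((s'.var .a = s.var .a ∧ s'.var .b = s.var .b) ∨
        (s'.var .a = s.var .b ∧ s'.var .b = s.var .a)) ∧
      IsForest N (s'.tab .parent) (s'.tab .size) (mergeRoot ρ (s'.var .a) (s'.var .b)) ∧
      s'.tab .parity = (if s.tab .parity (s'.var .b) = 1 then Function.update (s.tab .parity)
        (s'.var .a) (1 - s.tab .parity (s'.var .a)) else s.tab .parity) ∧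
      t' .unionFind + 18 * totalPotential A N (s'.tab .parent) (s'.tab .size) ≤
        t .unionFind + 18 * totalPotential A N (s.tab .parent) (s.tab .size) + 18 * A + 50) s t := by
  have key : ∀ {a b : ℕ}, a ∈ Finset.Icc 1 N → b ∈ Finset.Icc 1 N → ρ a = a → ρ b = b → a ≠ b →
      s.tab .size b ≤ s.tab .size a → s.tab .size a + s.tab .size b ≤ W := by
    intro a b ha hb hra hrb hab hs
    have := (h.union ha hb hra hrb hab hs).size_le a ha
    rw [Function.update_self] at this
    omega
  rw [Cmd.union, wp_charge, wp_seq, wp_ite]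
  constructor
  · intro hlt
    simp at hlt
    have hu := h.union hb ha hrb hra (Ne.symm hab) hlt.le
    have hp := h.totalPotential_union A hb ha hrb hra (Ne.symm hab) hlt.le
    simp
    refine ⟨hB.var _, hB.var _, hB.var _, hB.var _, key hb ha hrb hra (Ne.symm hab) hlt.le, ?_, ?_⟩
    · intro hpar
      refine ⟨by omega, hu, by simp [hpar], by omega⟩
    · intro hpar
      refine ⟨hu, by simp [hpar], by omega⟩
  · intro hlt
    simp at hlt
    have hu := h.union ha hb hra hrb hab hlt
    have hp := h.totalPotential_union A ha hb hra hrb hab hlt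
    simp
    refine ⟨hB.var _, key ha hb hra hrb hab hlt, ?_, ?_⟩
    · intro hpar
      refine ⟨by omega, hu, by simp [hpar], by omega⟩
    · intro hpar
      refine ⟨hu, by simp [hpar], by omega⟩

/-! ### Growth of the clusters -/

/-- The number of edge ends of `e` in a list. -/
def endCount (e : ℕ) (l : List ℕ) : ℕ := l.countP fun d => edgeN d = e

theorem endCount_append (e : ℕ) (l l' : List ℕ) :
    endCount e (l ++ l') = endCount e l + endCount e l' := List.countP_append

theorem endCount_singleton (e d : ℕ) : endCount e [d] = if edgeN d = e then 1 else 0 := by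
  simp [endCount, List.countP_cons]

/-- The ends of `e` are 2e + 1 and 2e + 2. The index 0 must be excluded because truncated
subtraction makes `edgeN 0 = 0`. -/
theorem endCount_of_nodup {l : List ℕ} (hl : l.Nodup) (h0 : ∀ d ∈ l, 1 ≤ d) (e : ℕ) :
    endCount e l = (if 2 * e + 1 ∈ l then 1 else 0) + if 2 * e + 2 ∈ l then 1 else 0 := by
  induction l with
  | nil => simp [endCount]
  | cons d l ih =>
    simp only [List.mem_cons, forall_eq_or_imp, List.nodup_cons] at h0 hl
    have := ih hl.2 h0.2
    rw [show d :: l = [d] ++ l from rfl, endCount_append, this, endCount_singleton]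
    simp only [List.singleton_append, List.mem_cons]
    by_cases h1 : 2 * e + 1 = d
    · have h2 : 2 * e + 2 ≠ d := by omega
      subst h1
      simp [hl.1]
    · by_cases h2 : 2 * e + 2 = d
      · subst h2
        simp [hl.1]
        omega
      · have h3 : edgeN d ≠ e := by unfold edgeN; omega
        simp [h1, h2, h3]

/-- Growth tables after the edge ends in `l` have grown from the state `f`; the newly grown edges
form the array `fus` of length `k`. -/
def GrowInv (M : ℕ) (f : ℕ → ℕ) (l : List ℕ) (sup fus : ℕ → ℕ) (k : ℕ) : Prop :=
  (∀ e < M, sup e = min 2 (f e + endCount e l)) ∧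
  ∃ F : List ℕ, Stores fus 0 F ∧ k = F.length ∧ F.Nodup ∧
    ∀ e, e ∈ F ↔ e < M ∧ f e < 2 ∧ 2 ≤ f e + endCount e l

namespace GrowInv

variable {M : ℕ} {f : ℕ → ℕ} {l : List ℕ} {sup fus : ℕ → ℕ} {k d : ℕ}

theorem step_zero (h : GrowInv M f l sup fus k) (hd : edgeN d < M) (h0 : sup (edgeN d) = 0) :
    GrowInv M f (l ++ [d]) (Function.update sup (edgeN d) 1) fus k := by
  obtain ⟨h1, F, h2, h3, h4, h5⟩ := h
  have hs := h1 _ hd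
  refine ⟨fun e he => ?_, F, h2, h3, h4, fun e => (h5 e).trans ?_⟩
  · rw [Function.update_apply, endCount_append, endCount_singleton]
    split
    · subst e; simp; omega
    · rw [if_neg (Ne.symm ‹_›)]; exact h1 e he
  · rw [endCount_append, endCount_singleton]
    split
    · subst e; omega
    · simp

theorem step_one (h : GrowInv M f l sup fus k) (hd : edgeN d < M) (h0 : sup (edgeN d) = 1) :
    GrowInv M f (l ++ [d]) (Function.update sup (edgeN d) 2) (Function.update fus k (edgeN d))
      (k + 1) := by
  obtain ⟨h1, F, h2, h3, h4, h5⟩ := h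
  have hs := h1 _ hd
  refine ⟨fun e he => ?_, F ++ [edgeN d], h2.push_zero h3 _, by simp [h3], ?_, fun e => ?_⟩
  · rw [Function.update_apply, endCount_append, endCount_singleton]
    split
    · subst e; simp; omega
    · rw [if_neg (Ne.symm ‹_›)]; exact h1 e he
  · have : edgeN d ∉ F := fun hF => by have := (h5 _).1 hF; omega
    simp [List.nodup_append, h4]
    rintro a ha rfl
    exact this ha
  · rw [List.mem_append, h5, endCount_append, endCount_singleton, List.mem_singleton]
    split
    · subst e; constructor
      · rintro (h | h) <;> omega
      · intro _; right; rfl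
    · simp [Ne.symm ‹edgeN d ≠ e›]

theorem step_two (h : GrowInv M f l sup fus k) (hd : edgeN d < M) (h0 : sup (edgeN d) ≠ 0)
    (h0' : sup (edgeN d) ≠ 1) : GrowInv M f (l ++ [d]) sup fus k := by
  obtain ⟨h1, F, h2, h3, h4, h5⟩ := h
  have hs := h1 _ hd
  refine ⟨fun e he => ?_, F, h2, h3, h4, fun e => (h5 e).trans ?_⟩
  · rw [endCount_append, endCount_singleton, h1 e he]
    split
    · subst e; omega
    · simp
  · rw [endCount_append, endCount_singleton]
    split
    · subst e; omega
    · simp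

/-- The edge `edgeN d` is about to become grown and is not in the list yet, and the list has no
repetitions. This bounds the counter of fusion edges. -/
theorem lt (h : GrowInv M f l sup fus k) (hd : edgeN d < M) (h0 : sup (edgeN d) = 1) : k < M := by
  obtain ⟨_, F, _, h3, h4, _⟩ := h.step_one hd h0
  have : F.toFinset ⊆ Finset.range M := fun e he => by
    have := (‹∀ e, e ∈ F ↔ _› e).1 (List.mem_toFinset.1 he)
    simpa using this.1
  have := Finset.card_le_card this
  rw [List.toFinset_card_of_nodup h4, Finset.card_range] at this
  omega

end GrowInv

/-- The edge ends are treated one after the other, but the state of an edge only depends on how many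
of its ends have been treated. So the outcome is that of simultaneous growth, including edges with
both ends in odd clusters. An edge enters the fusion list exactly when it receives its last
half-edge. -/
theorem wp_growClusters {G : Lattice} {W : ℕ} {p : Phase} {s : Store} {t : Phase → ℕ}
    {L : List ℕ} {B : ℕ → List ℕ} (hB : s.Bounded W) (hW : G.numE + 2 ≤ W) (hG : Incidence G s)
    (hf2 : ∀ e < G.numE, s.tab .support e ≤ 2)
    (hL : Stores (s.tab .roots) 0 L) (hlen : s.var .lenL = L.length)
    (hLB : ∀ r ∈ L, Chain (s.tab .bNext) (s.tab .bFirst r) (B r))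
    (hBV : ∀ r ∈ L, ∀ v ∈ B r, v ∈ Finset.Icc 1 G.numV) :
    Wp W p .growClusters (fun s' t' =>
      GrowInv G.numE (s.tab .support) ((L.flatMap B).flatMap G.ends) (s'.tab .support)
        (s'.tab .fusion) (s'.var .lenF) ∧
      t' .growth ≤ t .growth + 10 + 20 * L.length +
        40 * ((L.flatMap B).map G.weight).sum) s t := by
  set f := s.tab .support with hf
  have hLW : L.length ≤ W := hlen ▸ hB.var _
  simp [Cmd.growClusters]
  have hB1 : ((s.setVar .lenF 0).setVar .j 0).Bounded W :=
    (hB.setVar (by omega)).setVar (by omega)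
  refine Wp.loopList (l := L) (I := fun L₁ L₂ s₁ t₁ =>
    s₁.var .j = L₁.length ∧ Stores (s.tab .roots) L₁.length L₂ ∧
    GrowInv G.numE f ((L₁.flatMap B).flatMap G.ends) (s₁.tab .support) (s₁.tab .fusion)
      (s₁.var .lenF) ∧
    t₁ .growth ≤ t .growth + 4 + 20 * L₁.length + 40 * ((L₁.flatMap B).map G.weight).sum)
    hB1 ?_ ?_ ?_
  · simp [hL]
    refine ⟨fun e he => by simpa [endCount, hf] using hf2 e he, [], trivial, rfl, List.nodup_nil, fun e => ?_⟩
    simp [endCount]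
  · rintro L₁ r L₂ s₁ t₁ hl hfr ⟨h1, h2, h3, h4⟩
    have hlenL : s₁.var .lenL = L.length := by rw [hfr.var _ rfl]; simpa using hlen
    have hroots : s₁.tab .roots = s.tab .roots := by rw [hfr.tab _ rfl]; simp
    have hbF : s₁.tab .bFirst = s.tab .bFirst := by rw [hfr.tab _ rfl]; simp
    have hrL : r ∈ L := by simp [hl]
    have hlt : L₁.length < L.length := by simp [hl]
    simp [hlenL, h1, hroots, hbF, h2.1, hlt]
    refine ⟨by rw [← hbF]; exact hfr.bounded.tab _ _, ?_⟩
    have hB2 : (s₁.setVar .v (s.tab .bFirst r)).Bounded W :=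
      hfr.bounded.setVar (hB.tab _ _)
    refine (Wp.loopList (l := B r) (I := fun b₁ b₂ s₂ t₂ =>
      Chain (s.tab .bNext) (s₂.var .v) b₂ ∧
      GrowInv G.numE f ((L₁.flatMap B).flatMap G.ends ++ b₁.flatMap G.ends) (s₂.tab .support)
        (s₂.tab .fusion) (s₂.var .lenF) ∧
      t₂ .growth ≤ t .growth + 4 + 20 * L₁.length + 40 * ((L₁.flatMap B).map G.weight).sum +
        8 + 40 * (b₁.map G.weight).sum)
      (Q := fun s₂ t₂ => GrowInv G.numE f ((L₁.flatMap B).flatMap G.ends ++ (B r).flatMap G.ends)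
          (s₂.tab .support) (s₂.tab .fusion) (s₂.var .lenF) ∧
        t₂ .growth ≤ t .growth + 4 + 20 * L₁.length + 40 * ((L₁.flatMap B).map G.weight).sum +
          12 + 40 * ((B r).map G.weight).sum) hB2 ?_ ?_ ?_).frame hB2 ?_
    · simp
      exact ⟨hLB r hrL, h3, by omega⟩
    · rintro b₁ v b₂ s₂ t₂ hbl hfr₂ ⟨⟨g1, g2, g3⟩, g4, g5⟩
      have hbN : s₂.tab .bNext = s.tab .bNext := by
        rw [hfr₂.tab _ rfl]; simp; rw [hfr.tab _ rfl]; simp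
      have hG₂ : Incidence G s₂ :=
        ((hG.setVar.setVar.frame hfr rfl).setVar).frame hfr₂ rfl
      have hvV : v ∈ Finset.Icc 1 G.numV := hBV r hrL v (by simp [hbl])
      refine ⟨by simp [g1, g2], ?_⟩
      rw [wp_seq]
      have hfst := hG₂.chain v hvV
      rw [← g1] at hfst
      refine (Wp.forEnds (l := G.ends (s₂.var .v)) (I := fun l₁ l₂ s₃ t₃ =>
        GrowInv G.numE f ((L₁.flatMap B).flatMap G.ends ++ b₁.flatMap G.ends ++ l₁)
          (s₃.tab .support) (s₃.tab .fusion) (s₃.var .lenF) ∧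
        t₃ .growth ≤ t₂ .growth + 6 + 30 * l₁.length)
        (Q := fun s₃ t₃ =>
        GrowInv G.numE f ((L₁.flatMap B).flatMap G.ends ++ b₁.flatMap G.ends ++ G.ends v)
          (s₃.tab .support) (s₃.tab .fusion) (s₃.var .lenF) ∧
        t₃ .growth ≤ t₂ .growth + 9 + 30 * (G.ends v).length) hfr₂.bounded hfst rfl rfl ?_ ?_ ?_).frame
          hfr₂.bounded ?_
      · simp [g4]
      · rintro l₁ d l₂ s₃ t₃ hll hfr₃ hd ⟨k1, k2⟩
        have hdm : d ∈ G.ends (s₂.var .v) := by simp [hll]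
        obtain ⟨hd1, hd2, _⟩ := mem_ends.1 hdm
        have hed : s₃.tab .edge d = edgeN d := (hG₂.frame hfr₃ rfl).edge d hd1 hd2
        have hlt := edgeN_lt hd1 hd2
        simp [hd, hed]
        refine ⟨by omega, fun h => ⟨by omega, hfr₃.bounded.var _, ?_, by omega⟩,
          fun h => ⟨fun h' => ⟨by omega, by omega, ?_, ?_, by omega⟩, fun h' => ⟨?_, by omega⟩⟩⟩
        · simpa using k1.step_zero hlt h
        · have := k1.lt hlt h'
          omega
        · simpa using k1.step_one hlt h'
        · simpa using k1.step_two hlt h h'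
      · rintro s₃ t₃ hfr₃ ⟨k1, k2⟩
        rw [g1] at k1 k2
        exact ⟨k1, by simp only [tick_apply, if_true]; omega⟩
      · rintro s₃ t₃ hfr₃ ⟨k1, k2⟩
        have hv₃ : s₃.var .v = v := by rw [hfr₃.var _ rfl, g1]
        have hbN₃ : s₃.tab .bNext = s.tab .bNext := by rw [hfr₃.tab _ rfl, hbN]
        simp [hv₃, hbN₃, g3, weight]
        refine ⟨by rw [← hbN₃]; exact hfr₃.bounded.tab _ _, by simpa using k1, by omega⟩
    · rintro s₂ t₂ hfr₂ ⟨g1, g2, g3⟩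
      simp [Chain] at g1
      simp [g1]
      exact ⟨g2, by omega⟩
    · rintro s₂ t₂ hfr₂ ⟨g1, g2⟩
      have hj : s₂.var .j = L₁.length := by rw [hfr₂.var _ rfl]; simpa using h1
      simp [hj]
      refine ⟨by omega, h2.2, g1, by omega⟩
  · rintro s₁ t₁ hfr ⟨h1, h2, h3, h4⟩
    have hlenL : s₁.var .lenL = L.length := by rw [hfr.var _ rfl]; simpa using hlen
    simp [h1, hlenL]
    exact ⟨h3, by simpa using by omega⟩

/-! ### Fusion of the clusters -/

/-- The root map after a sequence of fusions. -/
def mergeAll (ρ : ℕ → ℕ) (l : List (ℕ × ℕ)) : ℕ → ℕ :=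
  l.foldl (fun ρ m => mergeRoot ρ m.1 m.2) ρ

/-- Both trees of each fusion are given by their roots. -/
def ValidMerges (N : ℕ) : (ℕ → ℕ) → List (ℕ × ℕ) → Prop
  | _, [] => True
  | ρ, m :: l => (m.1 ∈ Finset.Icc 1 N ∧ m.2 ∈ Finset.Icc 1 N ∧ ρ m.1 = m.1 ∧ ρ m.2 = m.2 ∧
      m.1 ≠ m.2) ∧ ValidMerges N (mergeRoot ρ m.1 m.2) l

@[simp] theorem mergeAll_nil (ρ : ℕ → ℕ) : mergeAll ρ [] = ρ := rfl

theorem mergeAll_append (ρ : ℕ → ℕ) (l : List (ℕ × ℕ)) (m : ℕ × ℕ) :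
    mergeAll ρ (l ++ [m]) = mergeRoot (mergeAll ρ l) m.1 m.2 := by
  simp [mergeAll]

theorem ValidMerges.append {N : ℕ} {ρ : ℕ → ℕ} {l : List (ℕ × ℕ)} {m : ℕ × ℕ}
    (h : ValidMerges N ρ l) (hm : m.1 ∈ Finset.Icc 1 N ∧ m.2 ∈ Finset.Icc 1 N ∧
      mergeAll ρ l m.1 = m.1 ∧ mergeAll ρ l m.2 = m.2 ∧ m.1 ≠ m.2) :
    ValidMerges N ρ (l ++ [m]) := by
  induction l generalizing ρ with
  | nil => exact ⟨hm, trivial⟩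
  | cons m' l ih => exact ⟨h.1, ih h.2 hm⟩

theorem mergeRoot_fixed_iff {ρ : ℕ → ℕ} {a b r : ℕ} (ha : ρ a = a) (hab : a ≠ b) :
    mergeRoot ρ a b r = r ↔ ρ r = r ∧ r ≠ b := by
  unfold mergeRoot
  split
  · rename_i h
    constructor
    · rintro rfl; exact absurd (ha.symm.trans h) hab
    · rintro ⟨h1, h2⟩; exact absurd (h1.symm.trans h) h2
  · rename_i h
    exact ⟨fun h1 => ⟨h1, fun h2 => h (h1.trans h2)⟩, And.left⟩

theorem mergeAll_congr {ρ : ℕ → ℕ} {u v : ℕ} (h : ρ u = ρ v) (l : List (ℕ × ℕ)) :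
    mergeAll ρ l u = mergeAll ρ l v := by
  induction l generalizing ρ with
  | nil => exact h
  | cons m l ih => exact ih (by simp [mergeRoot, h])

/-- The parities at the roots. -/
def ParityInv {G : Lattice} (σ : Finset (Fin G.numV)) (ρ par : ℕ → ℕ) : Prop :=
  ∀ r ∈ Finset.Icc 1 G.numV, ρ r = r → par r = synCount σ ρ r % 2

/-- The merged cluster contains the sum of the two counts. Flipping the bit of `a` exactly when that
of `b` is 1 is addition modulo 2. -/
theorem ParityInv.union {G : Lattice} {σ : Finset (Fin G.numV)} {ρ par : ℕ → ℕ} {a b : ℕ}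
    (h : ParityInv σ ρ par) (ha : a ∈ Finset.Icc 1 G.numV) (hb : b ∈ Finset.Icc 1 G.numV)
    (hra : ρ a = a) (hrb : ρ b = b) (hab : a ≠ b) :
    ParityInv σ (mergeRoot ρ a b)
      (if par b = 1 then Function.update par a (1 - par a) else par) := by
  intro r hr hrr
  rw [mergeRoot_fixed_iff hra hab] at hrr
  have h1 := h a ha hra
  have h2 := h b hb hrb
  have h3 := h r hr hrr.1
  rw [synCount_mergeRoot hab, if_neg hrr.2]
  by_cases hra' : r = a
  · subst hra'
    rw [if_pos rfl]
    split
    · rw [Function.update_self]; omega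
    · omega
  · rw [if_neg hra', ← h3]
    split
    · rw [Function.update_of_ne hra']
    · rfl

/-- Each edge costs two calls of Find and at most one Union, hence 2(18A + 29) + (18A + 50) = 54A +
108 amortized steps. The list `l` records the fusions in their order; edges with both ends in one
cluster leave the labels as they are. -/
theorem wp_fuseClusters {G : Lattice} {σ : Finset (Fin G.numV)} {W A : ℕ} {p : Phase} {s : Store}
    {t : Phase → ℕ} {ρ : ℕ → ℕ} {F : List ℕ} {E : Finset (Fin G.numE)} (hB : s.Bounded W)
    (hW : G.numV + 2 ≤ W) (hG : Incidence G s)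
    (hforest : IsForest G.numV (s.tab .parent) (s.tab .size) ρ)
    (hpar : ParityInv σ ρ (s.tab .parity)) (hlab : Labels E ρ)
    (hA : Nat.log 2 G.numV < hierarchy A 1)
    (hF : Stores (s.tab .fusion) 0 F) (hlen : s.var .lenF = F.length) (hFM : ∀ e ∈ F, e < G.numE) :
    Wp W p .fuseClusters (fun s' t' => ∃ l : List (ℕ × ℕ), ValidMerges G.numV ρ l ∧
      l.length ≤ F.length ∧
      IsForest G.numV (s'.tab .parent) (s'.tab .size) (mergeAll ρ l) ∧
      ParityInv σ (mergeAll ρ l) (s'.tab .parity) ∧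
      Labels (E ∪ Finset.univ.filter fun e => e.val ∈ F) (mergeAll ρ l) ∧
      Stores (s'.tab .fLarge) 0 (l.map Prod.fst) ∧ Stores (s'.tab .fSmall) 0 (l.map Prod.snd) ∧
      s'.var .lenF = l.length ∧
      t' .growth ≤ t .growth + 20 + 60 * F.length ∧
      t' .unionFind + 18 * totalPotential A G.numV (s'.tab .parent) (s'.tab .size) ≤
        t .unionFind + 18 * totalPotential A G.numV (s.tab .parent) (s.tab .size) +
          (54 * A + 108) * F.length) s t := by
  have hFW : F.length ≤ W := hlen ▸ hB.var _
  simp [Cmd.fuseClusters, -Finset.mem_Icc]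
  have hB1 : ((s.setVar .k 0).setVar .j 0).Bounded W :=
    (hB.setVar (by omega)).setVar (by omega)
  refine Wp.loopList (l := F) (I := fun F₁ F₂ s₁ t₁ =>
    s₁.var .j = F₁.length ∧ Stores (s₁.tab .fusion) F₁.length F₂ ∧
    ∃ l : List (ℕ × ℕ), ValidMerges G.numV ρ l ∧ s₁.var .k = l.length ∧ l.length ≤ F₁.length ∧
      IsForest G.numV (s₁.tab .parent) (s₁.tab .size) (mergeAll ρ l) ∧
      ParityInv σ (mergeAll ρ l) (s₁.tab .parity) ∧
      Labels (E ∪ Finset.univ.filter fun e => e.val ∈ F₁) (mergeAll ρ l) ∧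
      Stores (s₁.tab .fLarge) 0 (l.map Prod.fst) ∧ Stores (s₁.tab .fSmall) 0 (l.map Prod.snd) ∧
      t₁ .growth ≤ t .growth + 4 + 60 * F₁.length ∧
      t₁ .unionFind + 18 * totalPotential A G.numV (s₁.tab .parent) (s₁.tab .size) ≤
        t .unionFind + 18 * totalPotential A G.numV (s.tab .parent) (s.tab .size) +
          (54 * A + 108) * F₁.length) hB1 ?_ ?_ ?_
  · refine ⟨by simp, by simpa using hF, [], trivial, by simp, by simp, by simpa using hforest,
      by simpa using hpar, by simpa using hlab, trivial, trivial, by simp, by simp⟩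
  · rintro F₁ e F₂ s₁ t₁ hl hfr ⟨h1, h2, l, h3, h4, h5, h6, h7, h8, h9, h10, h11, h12⟩
    have hlenF : s₁.var .lenF = F.length := by rw [hfr.var _ rfl]; simpa using hlen
    have hG₁ : Incidence G s₁ := hG.setVar.setVar.frame hfr rfl
    have hlt : F₁.length < F.length := by simp [hl]
    have heM : e < G.numE := hFM e (by simp [hl])
    have hsrc : G.srcN e ∈ Finset.Icc 1 G.numV := srcN_mem heM
    have hdst : G.dstN e ∈ Finset.Icc 1 G.numV := dstN_mem heM
    have hsrcW : G.srcN e ≤ W := by rw [← hG₁.src]; exact hfr.bounded.tab _ _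
    have hdstW : G.dstN e ≤ W := by rw [← hG₁.dst]; exact hfr.bounded.tab _ _
    have heW : e ≤ W := by rw [← h2.1]; exact hfr.bounded.tab _ _
    set ρ' := mergeAll ρ l
    simp [hlenF, h1, h2.1, hlt, hG₁.src, -Finset.mem_Icc]
    refine ⟨heW, hsrcW, ?_⟩
    have hB2 : ((s₁.setVar .e e).setVar .u (G.srcN e)).Bounded W :=
      (hfr.bounded.setVar heW).setVar hsrcW
    refine (wp_find (ρ := ρ') (A := A) hB2 (by decide) (by decide) (by decide)
      (by simpa using h6) (by simpa using hsrc) hA).frame hB2 ?_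
    rintro s₂ t₂ hfr₂ ⟨g1, g2, g3⟩
    have hG₂ : Incidence G s₂ := hG₁.setVar.setVar.frame hfr₂ rfl
    have he₂ : s₂.var .e = e := by rw [hfr₂.var _ rfl]; simp
    simp [he₂, hG₂.dst, -Finset.mem_Icc] at g1 g2 g3 ⊢
    refine ⟨hdstW, ?_⟩
    have hB3 : (s₂.setVar .v (G.dstN e)).Bounded W := hfr₂.bounded.setVar hdstW
    have hsize₂ : s₂.tab .size = s₁.tab .size := hfr₂.tab _ rfl
    refine (wp_find (ρ := ρ') (A := A) hB3 (by decide) (by decide) (by decide)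
      (by simpa [hsize₂] using g2) (by simpa using hdst) hA).frame hB3 ?_
    rintro s₃ t₃ hfr₃ ⟨k1, k2, k3⟩
    have he₃ : s₃.var .e = e := by rw [hfr₃.var _ rfl]; simpa using he₂
    have ha₃ : s₃.var .a = ρ' (G.srcN e) := by rw [hfr₃.var _ rfl]; simpa using g1
    have hsize₃ : s₃.tab .size = s₁.tab .size := (hfr₃.tab _ rfl).trans hsize₂
    have hj₃ : s₃.var .j = F₁.length := by
      rw [hfr₃.var _ rfl]; simp; rw [hfr₂.var _ rfl]; simpa using h1
    have hk₃ : s₃.var .k = l.length := by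
      rw [hfr₃.var _ rfl]; simp; rw [hfr₂.var _ rfl]; simpa using h4
    have hfus₃ : s₃.tab .fusion = s₁.tab .fusion := (hfr₃.tab _ rfl).trans (hfr₂.tab _ rfl)
    have hfL₃ : s₃.tab .fLarge = s₁.tab .fLarge := (hfr₃.tab _ rfl).trans (hfr₂.tab _ rfl)
    have hfS₃ : s₃.tab .fSmall = s₁.tab .fSmall := (hfr₃.tab _ rfl).trans (hfr₂.tab _ rfl)
    have hpar₃ : s₃.tab .parity = s₁.tab .parity := (hfr₃.tab _ rfl).trans (hfr₂.tab _ rfl)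
    have htg₃ : t₃ .growth = t₁ .growth + 12 := by
      rw [hfr₃.time _ rfl]; simp; rw [hfr₂.time _ rfl]; simp
    simp [hsize₂, -Finset.mem_Icc] at k1 k2 k3
    have hF₁ : (E ∪ Finset.univ.filter fun x => x.val ∈ F₁ ++ [e]) =
        insert ⟨e, heM⟩ (E ∪ Finset.univ.filter fun e => e.val ∈ F₁) := by
      ext x
      simp only [Finset.mem_union, Finset.mem_filter, Finset.mem_univ, true_and, List.mem_append,
        List.mem_singleton, Finset.mem_insert, Fin.ext_iff]
      tauto
    have hsu : ρ' ((G.src ⟨e, heM⟩).val + 1) = s₃.var .a := by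
      rw [ha₃, ← srcN_coe]
    have hdv : ρ' ((G.dst ⟨e, heM⟩).val + 1) = s₃.var .b := by
      rw [k1, ← dstN_coe]
    -- The bound contains a product of `A` with a length; it is expanded once so that only linear
    -- arithmetic remains.
    have hrec : ∀ k, (54 * A + 108) * (k + 1) = (54 * A + 108) * k + (54 * A + 108) :=
      fun k => by ring
    rw [wp_seq, wp_ite]
    constructor
    · intro hne
      simp only [Test.Holds, Expr.eval] at hne
      have haI : s₃.var .a ∈ Finset.Icc 1 G.numV := ha₃ ▸ h6.root_mem _ hsrc
      have hbI : s₃.var .b ∈ Finset.Icc 1 G.numV := k1 ▸ h6.root_mem _ hdst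
      have hra : ρ' (s₃.var .a) = s₃.var .a := by rw [ha₃, h6.root_root hsrc]
      have hrb : ρ' (s₃.var .b) = s₃.var .b := by rw [k1, h6.root_root hdst]
      rw [wp_seq]
      refine (wp_union (A := A) hfr₃.bounded (by omega) (by omega) (by rw [hsize₃]; exact k2)
        haI hbI hra hrb hne).frame hfr₃.bounded ?_
      rintro s₄ t₄ hfr₄ ⟨m1, m2, m3, m4⟩
      have he₄ : s₄.var .e = e := by rw [hfr₄.var _ rfl, he₃]
      have hj₄ : s₄.var .j = F₁.length := by rw [hfr₄.var _ rfl, hj₃]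
      have hk₄ : s₄.var .k = l.length := by rw [hfr₄.var _ rfl, hk₃]
      have hfus₄ : s₄.tab .fusion = s₁.tab .fusion := (hfr₄.tab _ rfl).trans hfus₃
      have hfL₄ : s₄.tab .fLarge = s₁.tab .fLarge := (hfr₄.tab _ rfl).trans hfL₃
      have hfS₄ : s₄.tab .fSmall = s₁.tab .fSmall := (hfr₄.tab _ rfl).trans hfS₃
      have htg₄ : t₄ .growth = t₁ .growth + 15 := by rw [hfr₄.time _ rfl]; simp [htg₃]
      simp [he₄, hj₄, hk₄, hfus₄, hfL₄, hfS₄, -Finset.mem_Icc]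
      have hvalid : s₄.var .a ∈ Finset.Icc 1 G.numV ∧ s₄.var .b ∈ Finset.Icc 1 G.numV ∧
          ρ' (s₄.var .a) = s₄.var .a ∧ ρ' (s₄.var .b) = s₄.var .b ∧ s₄.var .a ≠ s₄.var .b := by
        rcases m1 with ⟨e1, e2⟩ | ⟨e1, e2⟩ <;> rw [e1, e2]
        exacts [⟨haI, hbI, hra, hrb, hne⟩, ⟨hbI, haI, hrb, hra, Ne.symm hne⟩]
      refine ⟨heW, hfr₄.bounded.var _, hfr₄.bounded.var _, by omega, by omega,
        h2.2.update (by omega) _, l ++ [(s₄.var .a, s₄.var .b)], h3.append hvalid, by simp,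
        by simp; omega, ?_, ?_, ?_, ?_, ?_, by omega, ?_⟩
      · rw [mergeAll_append]; exact m2
      · rw [mergeAll_append, m3, hpar₃]
        exact h7.union hvalid.1 hvalid.2.1 hvalid.2.2.1 hvalid.2.2.2.1 hvalid.2.2.2.2
      · rw [mergeAll_append]
        simp only [List.mem_append, List.mem_singleton] at hF₁
        rw [hF₁]
        refine h8.union ?_
        rw [hsu, hdv]
        rcases m1 with ⟨e1, e2⟩ | ⟨e1, e2⟩ <;> simp [e1, e2]
      · simpa using h9.push_zero (i := l.length) (by simp) (s₄.var .a)
      · simpa using h10.push_zero (i := l.length) (by simp) (s₄.var .b)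
      · rw [hrec]
        simp [hsize₃] at m4
        omega
    · intro hne
      simp only [Test.Holds, Expr.eval, not_not] at hne
      simp [hj₃, hk₃, hfus₃, hfL₃, hfS₃, hpar₃, hsize₃, -Finset.mem_Icc]
      refine ⟨by omega, h2.2, l, h3, rfl, by omega, k2, h7, ?_, h9, h10, by omega, ?_⟩
      · simp only [List.mem_append, List.mem_singleton] at hF₁
        rw [hF₁]
        exact h8.of_mem (by rw [hsu, hdv, hne])
      · rw [hrec]
        omega
  · rintro s₁ t₁ hfr ⟨h1, h2, l, h3, h4, h5, h6, h7, h8, h9, h10, h11, h12⟩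
    have hlenF : s₁.var .lenF = F.length := by rw [hfr.var _ rfl]; simpa using hlen
    simp [h1, hlenF]
    refine ⟨hfr.bounded.var _, l, h3, h5, h6, h7, h8, h9, h10, h4, by omega, h12⟩

/-! ### Boundary lists -/

/-- `B r` is the boundary list of the root `r`. -/
def BoundaryLists (N : ℕ) (fst lst nxt ρ : ℕ → ℕ) (B : ℕ → List ℕ) : Prop :=
  ∀ r ∈ Finset.Icc 1 N, ρ r = r → Chain nxt (fst r) (B r) ∧
    (B r = [] ∨ ∃ l, B r = l ++ [lst r]) ∧ (B r).Nodup ∧ ∀ v ∈ B r, v ∈ Finset.Icc 1 N ∧ ρ v = r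

namespace BoundaryLists

variable {N : ℕ} {fst lst nxt ρ : ℕ → ℕ} {B : ℕ → List ℕ} {a b : ℕ}

/-- Vertices on a list carry the label of its root, so lists of different roots are disjoint.
Relinking only at vertices labelled `a` therefore cannot damage a third list. -/
theorem fuse {fst' lst' nxt' : ℕ → ℕ} (h : BoundaryLists N fst lst nxt ρ B)
    (hra : ρ a = a) (hrb : ρ b = b) (hab : a ≠ b)
    (hb : b ∈ Finset.Icc 1 N)
    (hfst : ∀ r, r ≠ a → fst' r = fst r) (hlst : ∀ r, r ≠ a → lst' r = lst r)
    (hnxt : ∀ v, ρ v ≠ a → nxt' v = nxt v)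
    (ha : Chain nxt' (fst' a) (B a ++ B b))
    (ha' : B a ++ B b = [] ∨ ∃ l, B a ++ B b = l ++ [lst' a]) (haN : a ∈ Finset.Icc 1 N) :
    BoundaryLists N fst' lst' nxt' (mergeRoot ρ a b) (Function.update B a (B a ++ B b)) := by
  intro r hr hrr
  rw [mergeRoot_fixed_iff hra hab] at hrr
  by_cases hr' : r = a
  · subst hr'
    rw [Function.update_self]
    refine ⟨ha, ha', ?_, ?_⟩
    · refine List.nodup_append.2 ⟨(h r hr hra).2.2.1, (h b hb hrb).2.2.1, ?_⟩
      rintro x hx y hy rfl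
      exact hab (((h r hr hra).2.2.2 x hx).2.symm.trans ((h b hb hrb).2.2.2 x hy).2)
    · intro v hv
      rcases List.mem_append.1 hv with hv | hv
      · have := (h r hr hra).2.2.2 v hv
        exact ⟨this.1, by simp [mergeRoot, this.2]⟩
      · have := (h b hb hrb).2.2.2 v hv
        exact ⟨this.1, by simp [mergeRoot, this.2]⟩
  · obtain ⟨h1, h2, h3, h4⟩ := h r hr hrr.1
    rw [Function.update_of_ne hr', hfst r hr', hlst r hr']
    refine ⟨h1.congr fun v hv => hnxt v ?_, h2, h3, fun v hv => ⟨(h4 v hv).1, ?_⟩⟩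
    · rw [(h4 v hv).2]; exact hr'
    · simp [mergeRoot, (h4 v hv).2, hrr.2]

end BoundaryLists

/-- Appending neither adds nor loses listed vertices. By disjointness, a vertex of the cluster `b`
on the joint list comes from the part of `b`, and likewise for `a`. -/
theorem mem_fused_iff {N : ℕ} {fst lst nxt ρ : ℕ → ℕ} {B : ℕ → List ℕ} {a b v : ℕ}
    (h : BoundaryLists N fst lst nxt ρ B) (hra : ρ a = a) (hrb : ρ b = b)
    (ha : a ∈ Finset.Icc 1 N) (hb : b ∈ Finset.Icc 1 N) (hab : a ≠ b) :
    v ∈ Function.update B a (B a ++ B b) (mergeRoot ρ a b v) ↔ v ∈ B (ρ v) := by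
  unfold mergeRoot
  split
  · rename_i hv
    rw [Function.update_self, List.mem_append, hv]
    refine ⟨fun h' => h'.resolve_left fun h'' => ?_, Or.inr⟩
    exact hab (((h a ha hra).2.2.2 v h'').2.symm.trans hv)
  · rename_i hv
    rw [Function.update_apply]
    split
    · rename_i hv'
      rw [List.mem_append, hv']
      refine ⟨fun h' => h'.resolve_right fun h'' => hv ((h b hb hrb).2.2.2 v h'').2, Or.inl⟩
    · rfl

/-- The stored pairs of roots are those valid at the moment of each union. Replaying them in the
same order moves the lists through the same intermediate root maps, although the forest itself is
already in its final state. First and last entries make each step constant time. -/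
theorem wp_fuseBoundaryLists {N W : ℕ} {p : Phase} {s : Store} {t : Phase → ℕ} {ρ : ℕ → ℕ}
    {l : List (ℕ × ℕ)} {B : ℕ → List ℕ} (hB : s.Bounded W) (hW : l.length + 1 ≤ W)
    (hlists : BoundaryLists N (s.tab .bFirst) (s.tab .bLast) (s.tab .bNext) ρ B)
    (hl : ValidMerges N ρ l)
    (hL : Stores (s.tab .fLarge) 0 (l.map Prod.fst)) (hS : Stores (s.tab .fSmall) 0 (l.map Prod.snd))
    (hlen : s.var .lenF = l.length) :
    Wp W p .fuseBoundaryLists (fun s' t' => ∃ B' : ℕ → List ℕ,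
      BoundaryLists N (s'.tab .bFirst) (s'.tab .bLast) (s'.tab .bNext) (mergeAll ρ l) B' ∧
      (∀ v, v ∈ B' (mergeAll ρ l v) ↔ v ∈ B (ρ v)) ∧
      t' .boundaryLists ≤ t .boundaryLists + 10 + 60 * l.length) s t := by
  simp [Cmd.fuseBoundaryLists, -Finset.mem_Icc]
  have hB1 : (s.setVar .j 0).Bounded W := hB.setVar (by omega)
  refine Wp.loopList (l := l) (I := fun l₁ l₂ s₁ t₁ =>
    s₁.var .j = l₁.length ∧ Stores (s.tab .fLarge) l₁.length (l₂.map Prod.fst) ∧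
    Stores (s.tab .fSmall) l₁.length (l₂.map Prod.snd) ∧
    ValidMerges N (mergeAll ρ l₁) l₂ ∧
    ∃ B' : ℕ → List ℕ,
      BoundaryLists N (s₁.tab .bFirst) (s₁.tab .bLast) (s₁.tab .bNext) (mergeAll ρ l₁) B' ∧
      (∀ v, v ∈ B' (mergeAll ρ l₁ v) ↔ v ∈ B (ρ v)) ∧
      t₁ .boundaryLists ≤ t .boundaryLists + 2 + 60 * l₁.length) hB1 ?_ ?_ ?_
  · exact ⟨by simp, hL, hS, hl, B, by simpa using hlists, fun v => Iff.rfl, by simp⟩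
  · rintro l₁ ⟨a, b⟩ l₂ s₁ t₁ hll hfr ⟨h1, h2, h3, h4, B', h5, h6, h7⟩
    have hlenF : s₁.var .lenF = l.length := by rw [hfr.var _ rfl]; simpa using hlen
    have hlt : l₁.length < l.length := by simp [hll]
    have hfL : s₁.tab .fLarge = s.tab .fLarge := hfr.tab _ rfl
    have hfS : s₁.tab .fSmall = s.tab .fSmall := hfr.tab _ rfl
    have haW : a ≤ W := by have := hB.tab .fLarge l₁.length; rwa [h2.1] at this
    have hbW : b ≤ W := by have := hB.tab .fSmall l₁.length; rwa [h3.1] at this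
    obtain ⟨⟨ha, hb, hra, hrb, hab⟩, h4⟩ := h4
    simp only at ha hb hra hrb hab
    obtain ⟨a1, a2, a3, a4⟩ := h5 a ha hra
    obtain ⟨b1, b2, b3, b4⟩ := h5 b hb hrb
    have hmem : ∀ v, v ∈ Function.update B' a (B' a ++ B' b) (mergeAll ρ (l₁ ++ [(a, b)]) v) ↔
        v ∈ B (ρ v) := fun v => by
      rw [mergeAll_append, mem_fused_iff h5 hra hrb ha hb hab, h6]
    have hjW : l₁.length < W := by omega
    simp [hlenF, hlt, h1, hfL, hfS, h2.1, h3.1, Cmd.appendList, hjW, haW, hbW, -Finset.mem_Icc]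
    have h2' := h2.2
    have h3' := h3.2
    have hv' : ValidMerges N (mergeAll ρ (l₁ ++ [(a, b)])) l₂ := by rw [mergeAll_append]; exact h4
    refine ⟨fun he => ⟨h2', h3', hv', _, ?_, hmem, by omega⟩, fun he => ⟨fun he' =>
      ⟨hfr.bounded.tab _ _, hfr.bounded.tab _ _, h2', h3', hv', _, ?_, hmem, by omega⟩,
      fun he' => ⟨hfr.bounded.tab _ _, hfr.bounded.tab _ _, h2', h3', hv', _, ?_, hmem, by omega⟩⟩⟩
    · rw [mergeAll_append]
      have hbe : B' b = [] := b1.eq_zero_iff.1 he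
      refine h5.fuse hra hrb hab hb (fun _ _ => rfl) (fun _ _ => rfl) (fun _ _ => rfl) ?_ ?_ ha
      · simpa [hbe] using a1
      · simpa [hbe] using a2
    · rw [mergeAll_append]
      have hae : B' a = [] := a1.eq_zero_iff.1 he'
      refine h5.fuse hra hrb hab hb (fun r hr => Function.update_of_ne hr _ _)
        (fun r hr => Function.update_of_ne hr _ _) (fun _ _ => rfl) ?_ ?_ ha
      · simpa [hae] using b1
      · simpa [hae] using b2
    · rw [mergeAll_append]
      have hbe : B' b ≠ [] := fun h => he (b1.eq_zero_iff.2 h)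
      have hae : B' a ≠ [] := fun h => he' (a1.eq_zero_iff.2 h)
      obtain ⟨la, hla⟩ := a2.resolve_left hae
      obtain ⟨lb, hlb⟩ := b2.resolve_left hbe
      have hlst : s₁.tab .bLast a ∈ B' a := by rw [hla]; simp
      refine h5.fuse hra hrb hab hb (fun r hr => rfl)
        (fun r hr => Function.update_of_ne hr _ _) (fun v hv => Function.update_of_ne ?_ _ _) ?_ ?_ ha
      · rintro rfl; exact hv (a4 _ hlst).2
      · rw [hla] at a1 a3 ⊢
        refine a1.append b1 a3 fun hm => hab ?_
        rw [← (a4 _ hlst).2, (b4 _ hm).2]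
      · right
        exact ⟨B' a ++ lb, by rw [Function.update_self, List.append_assoc, ← hlb]⟩
  · rintro s₁ t₁ hfr ⟨h1, h2, h3, h4, B', h5, h6, h7⟩
    have hlenF : s₁.var .lenF = l.length := by rw [hfr.var _ rfl]; simpa using hlen
    simp [h1, hlenF, -Finset.mem_Icc]
    exact ⟨B', h5, h6, by omega⟩

/-! ### Maintenance of the root list and of the boundary lists -/

/-- `L` is the list of marked vertices. -/
def RootList (N : ℕ) (roots mark : ℕ → ℕ) (k : ℕ) (L : List ℕ) : Prop :=
  Stores roots 0 L ∧ k = L.length ∧ L.Nodup ∧ (∀ r ∈ L, r ∈ Finset.Icc 1 N) ∧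
    ∀ v ∈ Finset.Icc 1 N, mark v = if v ∈ L then 1 else 0

theorem RootList.length_le {N : ℕ} {roots mark : ℕ → ℕ} {k : ℕ} {L : List ℕ}
    (h : RootList N roots mark k L) : L.length ≤ N := by
  rw [← List.toFinset_card_of_nodup h.2.2.1]
  calc _ ≤ (Finset.Icc 1 N).card :=
        Finset.card_le_card fun x hx => h.2.2.2.1 x (List.mem_toFinset.1 hx)
    _ = N := by simp

/-- The root list after the roots in `L₁` have been replaced, while those in `L₂` remain. -/
def RootUpdateInv (N : ℕ) (ρ : ℕ → ℕ) (L₁ L₂ : List ℕ) (roots mark : ℕ → ℕ) (j k : ℕ) : Prop :=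
  j = L₁.length ∧ Stores roots L₁.length L₂ ∧
  ∃ K : List ℕ, k = K.length ∧ K.length ≤ L₁.length ∧ Stores roots 0 K ∧
    (K ++ L₂).Nodup ∧ (∀ v ∈ Finset.Icc 1 N, mark v = if v ∈ K ++ L₂ then 1 else 0) ∧
    (∀ r ∈ K, ∃ u ∈ L₁, ρ u = r) ∧ ∀ u ∈ L₁, ρ u ∈ K ++ L₂

namespace RootUpdateInv

variable {N : ℕ} {ρ : ℕ → ℕ} {L₁ L₂ : List ℕ} {roots mark : ℕ → ℕ} {j k u : ℕ}

theorem keep (h : RootUpdateInv N ρ L₁ (u :: L₂) roots mark j k) (hu : ρ u = u) :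
    RootUpdateInv N ρ (L₁ ++ [u]) L₂ (Function.update roots k u) mark (j + 1) (k + 1) := by
  obtain ⟨h1, h2, K, h6, h7, h8, h9, h10, h11, h12⟩ := h
  subst h6
  refine ⟨by simp [h1], ?_, K ++ [u], by simp, by simp [h7], h8.push_zero rfl u, by simpa using h9,
    by simpa using h10, ?_, ?_⟩
  -- The list is rewritten in place. As `K.length ≤ L₁.length`, only entries that have already been
  -- read are overwritten.
  · simpa using h2.2.update (i := K.length) (by omega) u
  · intro r hr
    rcases List.mem_append.1 hr with hr | hr
    · obtain ⟨x, hx, hx'⟩ := h11 r hr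
      exact ⟨x, by simp [hx], hx'⟩
    · rw [List.mem_singleton] at hr
      subst hr
      exact ⟨r, by simp, hu⟩
  · intro x hx
    rcases List.mem_append.1 hx with hx | hx
    · simpa using h12 x hx
    · rw [List.mem_singleton] at hx
      subst hx
      rw [hu]; simp

/-- The entry `u` has ceased to be a root and its new root is unmarked, hence neither among the new
entries nor among those still to come. So it can be added without creating a duplicate. -/
theorem move (h : RootUpdateInv N ρ L₁ (u :: L₂) roots mark j k) (hu : ρ u ≠ u)
    (hI : ρ u ∈ Finset.Icc 1 N) (hρ : ∀ x ∈ L₁, ρ (ρ x) = ρ x)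
    (hm : Function.update mark u 0 (ρ u) = 0) :
    RootUpdateInv N ρ (L₁ ++ [u]) L₂ (Function.update roots k (ρ u))
      (Function.update (Function.update mark u 0) (ρ u) 1) (j + 1) (k + 1) := by
  obtain ⟨h1, h2, K, h6, h7, h8, h9, h10, h11, h12⟩ := h
  subst h6
  rw [Function.update_of_ne hu, h10 _ hI] at hm
  have hp : (K ++ u :: L₂).Perm (u :: (K ++ L₂)) := List.perm_middle
  rw [hp.nodup_iff, List.nodup_cons, List.mem_append, not_or] at h9
  simp only [List.mem_append, List.mem_cons, ite_eq_right_iff, one_ne_zero, imp_false, not_or] at hm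
  refine ⟨by simp [h1], ?_, K ++ [ρ u], by simp, by simp [h7], h8.push_zero rfl _, ?_, ?_, ?_, ?_⟩
  · simpa using h2.2.update (i := K.length) (by omega) (ρ u)
  · rw [List.append_assoc]
    have hp' : (K ++ ([ρ u] ++ L₂)).Perm (ρ u :: (K ++ L₂)) := List.perm_middle
    rw [hp'.nodup_iff, List.nodup_cons, List.mem_append, not_or]
    exact ⟨⟨hm.1, hm.2.2⟩, h9.2⟩
  · intro v hv
    simp only [Function.update_apply]
    split
    · subst v; simp
    · split
      · subst v; simp [h9.1, Ne.symm hu]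
      · rw [h10 v hv]; simp [*]
  · intro r hr
    rcases List.mem_append.1 hr with hr | hr
    · obtain ⟨x, hx, hx'⟩ := h11 r hr
      exact ⟨x, by simp [hx], hx'⟩
    · rw [List.mem_singleton] at hr
      exact ⟨u, by simp, hr.symm⟩
  · intro x hx
    rcases List.mem_append.1 hx with hx | hx
    · have h' := h12 x hx
      -- Images under the root map are fixed by it, and `u` is not; so removing `u` from the
      -- remaining entries does not lose the root of an earlier entry.
      have hne : ρ x ≠ u := fun he => hu (by rw [← he, hρ x hx])
      simp only [List.mem_append, List.mem_cons, hne, false_or] at h' ⊢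
      tauto
    · rw [List.mem_singleton] at hx
      subst hx; simp

theorem drop (h : RootUpdateInv N ρ L₁ (u :: L₂) roots mark j k) (hu : ρ u ≠ u)
    (hI : ρ u ∈ Finset.Icc 1 N) (hρ : ∀ x ∈ L₁, ρ (ρ x) = ρ x)
    (hm : Function.update mark u 0 (ρ u) ≠ 0) :
    RootUpdateInv N ρ (L₁ ++ [u]) L₂ roots (Function.update mark u 0) (j + 1) k := by
  obtain ⟨h1, h2, K, h6, h7, h8, h9, h10, h11, h12⟩ := h
  subst h6
  rw [Function.update_of_ne hu, h10 _ hI] at hm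
  have hp : (K ++ u :: L₂).Perm (u :: (K ++ L₂)) := List.perm_middle
  rw [hp.nodup_iff, List.nodup_cons, List.mem_append, not_or] at h9
  simp only [List.mem_append, List.mem_cons, ne_eq, ite_eq_right_iff, one_ne_zero, imp_false,
    not_not, hu, false_or] at hm
  refine ⟨by simp [h1], by simpa using h2.2, K, rfl, by simp; omega, h8, h9.2, ?_, ?_, ?_⟩
  · intro v hv
    rw [Function.update_apply]
    split
    · subst v; simp [h9.1]
    · rw [h10 v hv]; simp [*]
  · intro r hr
    obtain ⟨x, hx, hx'⟩ := h11 r hr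
    exact ⟨x, by simp [hx], hx'⟩
  · intro x hx
    rcases List.mem_append.1 hx with hx | hx
    · have h' := h12 x hx
      have hne : ρ x ≠ u := fun he => hu (by rw [← he, hρ x hx])
      simpa [hne] using h'
    · rw [List.mem_singleton] at hx
      subst hx; simpa using hm

end RootUpdateInv

theorem wp_updateRoots {N W A : ℕ} {p : Phase} {s : Store} {t : Phase → ℕ} {ρ : ℕ → ℕ}
    {L : List ℕ} (hB : s.Bounded W) (hNW : N + 2 ≤ W)
    (hforest : IsForest N (s.tab .parent) (s.tab .size) ρ) (hA : Nat.log 2 N < hierarchy A 1)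
    (hL : RootList N (s.tab .roots) (s.tab .mark) (s.var .lenL) L) :
    Wp W p .updateRoots (fun s' t' => ∃ L' : List ℕ,
      RootList N (s'.tab .roots) (s'.tab .mark) (s'.var .lenL) L' ∧
      (∀ r, r ∈ L' ↔ ∃ u ∈ L, ρ u = r) ∧ L'.length ≤ L.length ∧
      IsForest N (s'.tab .parent) (s.tab .size) ρ ∧
      t' .growth ≤ t .growth + 20 + 60 * L.length ∧
      t' .unionFind + 18 * totalPotential A N (s'.tab .parent) (s.tab .size) ≤
        t .unionFind + 18 * totalPotential A N (s.tab .parent) (s.tab .size) +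
          (18 * A + 29) * L.length) s t := by
  have hLW := hL.length_le
  obtain ⟨hst, hlen, hnd, hLN, hmark⟩ := hL
  simp [Cmd.updateRoots, -Finset.mem_Icc]
  have hB1 : ((s.setVar .k 0).setVar .j 0).Bounded W :=
    (hB.setVar (by omega)).setVar (by omega)
  refine Wp.loopList (l := L) (I := fun L₁ L₂ s₁ t₁ =>
    RootUpdateInv N ρ L₁ L₂ (s₁.tab .roots) (s₁.tab .mark) (s₁.var .j) (s₁.var .k) ∧
    IsForest N (s₁.tab .parent) (s.tab .size) ρ ∧
    t₁ .growth ≤ t .growth + 4 + 60 * L₁.length ∧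
      t₁ .unionFind + 18 * totalPotential A N (s₁.tab .parent) (s.tab .size) ≤
        t .unionFind + 18 * totalPotential A N (s.tab .parent) (s.tab .size) +
          (18 * A + 29) * L₁.length) hB1 ?_ ?_ ?_
  · exact ⟨⟨by simp, by simpa using hst, [], by simp, by simp, trivial, by simpa using hnd,
      fun v hv => by simpa using hmark v hv, by simp, by simp⟩, by simpa using hforest,
      by simp, by simp⟩
  · rintro L₁ u L₂ s₁ t₁ hl hfr ⟨hI, h3, h4, h5⟩
    have hlenL : s₁.var .lenL = L.length := by rw [hfr.var _ rfl]; simpa using hlen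
    have hlt : L₁.length < L.length := by simp [hl]
    have hu : u ∈ Finset.Icc 1 N := hLN u (by simp [hl])
    have hj := hI.1
    have hru := hI.2.1.1
    have huW : u ≤ W := by rw [← hru]; exact hfr.bounded.tab _ _
    have hsize : s₁.tab .size = s.tab .size := hfr.tab _ rfl
    simp [hlenL, hj, hru, hlt, huW, -Finset.mem_Icc]
    have hB2 : (s₁.setVar .u u).Bounded W := hfr.bounded.setVar huW
    refine (wp_find (ρ := ρ) (A := A) hB2 (by decide) (by decide) (by decide)
      (by simpa [hsize] using h3) (by simpa using hu) hA).frame hB2 ?_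
    rintro s₂ t₂ hfr₂ ⟨g1, g2, g3⟩
    have hu₂ : s₂.var .u = u := by rw [hfr₂.var _ rfl]; simp
    have hj₂ : s₂.var .j = s₁.var .j := by rw [hfr₂.var _ rfl]; simp
    have hk₂ : s₂.var .k = s₁.var .k := by rw [hfr₂.var _ rfl]; simp
    have hr₂ : s₂.tab .roots = s₁.tab .roots := hfr₂.tab _ rfl
    have hm₂ : s₂.tab .mark = s₁.tab .mark := hfr₂.tab _ rfl
    have htg₂ : t₂ .growth = t₁ .growth + 6 := by rw [hfr₂.time _ rfl]; simp
    have hrec : ∀ k, (18 * A + 29) * (k + 1) = (18 * A + 29) * k + (18 * A + 29) :=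
      fun k => by ring
    simp [hsize, -Finset.mem_Icc] at g1 g2 g3
    have hρu : ρ u ∈ Finset.Icc 1 N := h3.root_mem u hu
    have hρuW : ρ u ≤ W := by rw [← g1]; exact hfr₂.bounded.var _
    have hρρ : ∀ x ∈ L₁, ρ (ρ x) = ρ x := fun x hx => h3.root_root (hLN x (by simp [hl, hx]))
    have hkW : s₁.var .k < W := by
      obtain ⟨_, _, K, h6, h7, _⟩ := hI
      omega
    simp only [wp_seq, wp_ite, Test.Holds, Expr.eval, g1, hu₂]
    simp [hu₂, hj₂, hk₂, hr₂, hm₂, g1, hrec, hρuW, huW, hkW, -Finset.mem_Icc]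
    refine ⟨fun he => ⟨by omega, hI.keep he, g2, by omega, by omega⟩, fun hne =>
      ⟨fun hm => ⟨by omega, by omega, hI.move hne hρu hρρ hm, g2, by omega, by omega⟩,
        fun hm => ⟨by omega, hI.drop hne hρu hρρ hm, g2, by omega, by omega⟩⟩⟩
  · rintro s₁ t₁ hfr ⟨⟨h1, h2, K, h6, h7, h8, h9, h10, h11, h12⟩, h3, h4, h5⟩
    have hlenL : s₁.var .lenL = L.length := by rw [hfr.var _ rfl]; simpa using hlen
    simp only [List.append_nil] at h9 h10 h12
    simp [h1, hlenL, -Finset.mem_Icc]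
    have hmem : ∀ r, r ∈ K ↔ ∃ u ∈ L, ρ u = r :=
      fun r => ⟨h11 r, fun ⟨u, hu, hr⟩ => hr ▸ h12 u hu⟩
    refine ⟨hfr.bounded.var _, K, ⟨h8, h6, h9, fun r hr => ?_, h10⟩, hmem, h7, h3, by omega, h5⟩
    obtain ⟨u, hu, rfl⟩ := h11 r hr
    exact hforest.root_mem u (hLN u hu)

/-- The root list after the roots in `L₁` have been filtered, while those in `L₂` remain. -/
def RootFilterInv (N : ℕ) (q : ℕ → Bool) (L₁ L₂ : List ℕ) (roots mark : ℕ → ℕ) (j k : ℕ) : Prop :=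
  j = L₁.length ∧ Stores roots L₁.length L₂ ∧ k = (L₁.filter q).length ∧
    Stores roots 0 (L₁.filter q) ∧
    ∀ v ∈ Finset.Icc 1 N, mark v = if v ∈ L₁.filter q ++ L₂ then 1 else 0

theorem RootFilterInv.keep {N : ℕ} {q : ℕ → Bool} {L₁ L₂ : List ℕ} {roots mark : ℕ → ℕ}
    {j k u : ℕ} (h : RootFilterInv N q L₁ (u :: L₂) roots mark j k) (hu : q u = true) :
    RootFilterInv N q (L₁ ++ [u]) L₂ (Function.update roots k u) mark (j + 1) (k + 1) := by
  obtain ⟨h1, h2, h3, h4, h5⟩ := h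
  have hk := List.length_filter_le q L₁
  refine ⟨by simp [h1], by simpa using h2.2.update (i := k) (by omega) u, by simp [hu, h3], ?_, ?_⟩
  · simpa [hu] using h4.push_zero h3 u
  · intro v hv; simpa [hu] using h5 v hv

theorem RootFilterInv.drop {N : ℕ} {q : ℕ → Bool} {L₁ L₂ : List ℕ} {roots mark : ℕ → ℕ}
    {j k u : ℕ} (h : RootFilterInv N q L₁ (u :: L₂) roots mark j k) (hu : q u = false)
    (hu₂ : u ∉ L₂) :
    RootFilterInv N q (L₁ ++ [u]) L₂ roots (Function.update mark u 0) (j + 1) k := by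
  obtain ⟨h1, h2, h3, h4, h5⟩ := h
  refine ⟨by simp [h1], by simpa using h2.2, by simp [hu, h3], by simpa [hu] using h4, ?_⟩
  intro v hv
  rw [Function.update_apply]
  split
  · subst v; simp [hu, hu₂]
  · rw [h5 v hv]; simp [*]

theorem wp_removeEvenRoots {N W : ℕ} {p : Phase} {s : Store} {t : Phase → ℕ} {L : List ℕ}
    (hB : s.Bounded W) (hNW : N + 2 ≤ W)
    (hL : RootList N (s.tab .roots) (s.tab .mark) (s.var .lenL) L) :
    Wp W p .removeEvenRoots (fun s' t' =>
      RootList N (s'.tab .roots) (s'.tab .mark) (s'.var .lenL)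
        (L.filter fun r => s.tab .parity r = 1) ∧
      t' .growth ≤ t .growth + 20 + 60 * L.length) s t := by
  have hLW := hL.length_le
  obtain ⟨hst, hlen, hnd, hLN, hmark⟩ := hL
  set q : ℕ → Bool := fun r => s.tab .parity r = 1 with hq
  simp [Cmd.removeEvenRoots, -Finset.mem_Icc]
  have hB1 : ((s.setVar .k 0).setVar .j 0).Bounded W :=
    (hB.setVar (by omega)).setVar (by omega)
  refine Wp.loopList (l := L) (I := fun L₁ L₂ s₁ t₁ =>
    RootFilterInv N q L₁ L₂ (s₁.tab .roots) (s₁.tab .mark) (s₁.var .j) (s₁.var .k) ∧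
    t₁ .growth ≤ t .growth + 4 + 60 * L₁.length) hB1 ?_ ?_ ?_
  · exact ⟨⟨by simp, by simpa using hst, by simp, trivial, hmark⟩, by simp⟩
  · rintro L₁ u L₂ s₁ t₁ hl hfr ⟨hI, h3⟩
    have hlenL : s₁.var .lenL = L.length := by rw [hfr.var _ rfl]; simpa using hlen
    have hlt : L₁.length < L.length := by simp [hl]
    have hj := hI.1
    have hru := hI.2.1.1
    have huW : u ≤ W := by rw [← hru]; exact hfr.bounded.tab _ _
    have hpar : s₁.tab .parity = s.tab .parity := hfr.tab _ rfl
    have hk := List.length_filter_le q L₁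
    have hk' := hI.2.2.1
    have hu : u ∉ L₂ := by
      rw [hl, List.perm_middle.nodup_iff, List.nodup_cons] at hnd
      simp at hnd; exact hnd.1.2
    simp only [hj, hru, wp_seq, wp_ite, wp_set, Test.Holds, Expr.eval, hlenL]
    simp [hpar, hlt, huW, -Finset.mem_Icc]
    rw [← hj]
    refine ⟨fun hp => ⟨by omega, by omega, by rw [hj]; exact hj ▸ hI.keep (by simp [hq, hp]), by omega⟩,
      fun hp => ⟨by omega, by rw [hj]; exact hj ▸ hI.drop (by simp [hq, hp]) hu, by omega⟩⟩
  · rintro s₁ t₁ hfr ⟨⟨h1, h2, h4, h5, h6⟩, h3⟩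
    have hlenL : s₁.var .lenL = L.length := by rw [hfr.var _ rfl]; simpa using hlen
    simp only [List.append_nil] at h6
    simp [h1, hlenL, -Finset.mem_Icc]
    exact ⟨hfr.bounded.var _, ⟨h5, h4, hnd.filter _, fun r hr => hLN r (List.mem_of_mem_filter hr),
      h6⟩, by omega⟩

theorem wp_testBoundary {G : Lattice} {W : ℕ} {p : Phase} {s : Store} {t : Phase → ℕ}
    (hB : s.Bounded W) (hW : 1 ≤ W) (hG : Incidence G s) (hv : s.var .v ∈ Finset.Icc 1 G.numV) :
    Wp W p .testBoundary (fun s' t' =>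
      s'.var .flag = (if G.IsBoundary (s.tab .support) (s.var .v) then 1 else 0) ∧
      t' p ≤ t p + 20 * G.weight (s.var .v)) s t := by
  simp [Cmd.testBoundary, -Finset.mem_Icc]
  have hB1 : (s.setVar .flag 0).Bounded W := hB.setVar (by omega)
  refine Wp.forEnds (l := G.ends (s.var .v)) (I := fun l₁ l₂ s₁ t₁ =>
    s₁.var .flag = (if ∃ d ∈ l₁, s.tab .support (edgeN d) ≠ 2 then 1 else 0) ∧
    t₁ p ≤ t p + 10 + 20 * l₁.length) hB1 ?_ rfl rfl ?_ ?_ ?_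
  · simpa using hG.chain _ hv
  · simp
  · rintro l₁ d l₂ s₁ t₁ hl hfr hd ⟨h1, h2⟩
    have hdm : d ∈ G.ends (s.var .v) := by simp [hl]
    obtain ⟨hd1, hd2, _⟩ := mem_ends.1 hdm
    have hG₁ : Incidence G s₁ := hG.setVar.frame hfr rfl
    have hsup : s₁.tab .support = s.tab .support := hfr.tab _ rfl
    simp [hd, hG₁.edge d hd1 hd2, hsup, hW]
    refine ⟨fun h => ⟨?_, by omega⟩, fun h => ⟨?_, by omega⟩⟩
    · exact fun _ => h
    · rw [h1]
      congr 1
      simp [h]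
  · rintro s₁ t₁ hfr ⟨h1, h2⟩
    simp [weight]
    exact ⟨h1, by omega⟩

/-- The last entry is meaningful only for a nonempty list, which is why an empty list is
distinguished by its first entry. -/
theorem wp_appendVertex {W : ℕ} {p : Phase} {s : Store} {t : Phase → ℕ} {K : List ℕ}
    (hB : s.Bounded W) (hK : Chain (s.tab .bNext) (s.tab .bFirst (s.var .r)) K)
    (hlast : K = [] ∨ ∃ l, K = l ++ [s.tab .bLast (s.var .r)]) (hnd : K.Nodup)
    (hv : s.var .v ∉ K) (hv0 : s.var .v ≠ 0) :
    Wp W p .appendVertex (fun s' t' =>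
      Chain (s'.tab .bNext) (s'.tab .bFirst (s.var .r)) (K ++ [s.var .v]) ∧
      s'.tab .bLast (s.var .r) = s.var .v ∧
      (∀ r, r ≠ s.var .r →
        s'.tab .bFirst r = s.tab .bFirst r ∧ s'.tab .bLast r = s.tab .bLast r) ∧
      (∀ w, w ≠ s.var .v → w ∉ K → s'.tab .bNext w = s.tab .bNext w) ∧
      t' p ≤ t p + 20) s t := by
  simp [Cmd.appendVertex]
  have hvW := hB.var .v
  refine ⟨fun h => ⟨hvW, ?_, ?_, ?_⟩, fun h => ⟨hvW, ?_, ?_, ?_⟩⟩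
  · rw [hK.eq_zero_iff.1 h]
    exact ⟨rfl, hv0, by simp [Chain]⟩
  · intro r hr; simp [Function.update_of_ne hr]
  · intro w hw _; simp [Function.update_of_ne hw]
  · obtain ⟨l, hl⟩ := hlast.resolve_left fun h' => h (hK.eq_zero_iff.2 h')
    have hvl : s.tab .bLast (s.var .r) ∉ [s.var .v] := fun hm => hv (by
      rw [List.mem_singleton] at hm; rw [hl, ← hm]; simp)
    have := (hK.update hv 0)
    rw [hl] at this hnd
    have := this.append (y := s.var .v) (l' := [s.var .v]) ⟨rfl, hv0, by simp [Chain]⟩ hnd hvl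
    rwa [← hl] at this
  · intro r hr; simp [Function.update_of_ne hr]
  · intro w hw hwK
    obtain ⟨l, hl⟩ := hlast.resolve_left fun h' => h (hK.eq_zero_iff.2 h')
    rw [Function.update_of_ne, Function.update_of_ne hw]
    rintro rfl
    exact hwK (by rw [hl]; simp)

/-- The boundary list of `r` has been rebuilt from some of the vertices in `l`; it consists of `K`
now, and the other boundary lists are unchanged. -/
def CleanInv (l K : List ℕ) (r : ℕ) (fst₀ lst₀ nxt₀ fst lst nxt : ℕ → ℕ) : Prop :=
  Chain nxt (fst r) K ∧ (K = [] ∨ ∃ l, K = l ++ [lst r]) ∧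
    (∀ r', r' ≠ r → fst r' = fst₀ r' ∧ lst r' = lst₀ r') ∧ ∀ v, v ∉ l → nxt v = nxt₀ v

/-- The list of an odd root is rebuilt within its own links: the successor of `v` is saved in `x`
before `v` is appended to the cleaned list. Only lists of odd roots are traversed, so only their
weight enters the time bound. -/
theorem wp_updateBoundaryLists {G : Lattice} {W : ℕ} {p : Phase} {s : Store} {t : Phase → ℕ}
    {ρ : ℕ → ℕ} {L : List ℕ} {B : ℕ → List ℕ} (hB : s.Bounded W) (hW : G.numV + 2 ≤ W)
    (hG : Incidence G s)
    (hlists : BoundaryLists G.numV (s.tab .bFirst) (s.tab .bLast) (s.tab .bNext) ρ B)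
    (hL : RootList G.numV (s.tab .roots) (s.tab .mark) (s.var .lenL) L) (hρ : ∀ r ∈ L, ρ r = r) :
    Wp W p .updateBoundaryLists (fun s' t' =>
      BoundaryLists G.numV (s'.tab .bFirst) (s'.tab .bLast) (s'.tab .bNext) ρ
        (fun r => if r ∈ L ∧ s.tab .parity r = 1
          then (B r).filter fun v => G.IsBoundary (s.tab .support) v else B r) ∧
      t' .boundaryLists ≤ t .boundaryLists + 20 + 40 * L.length +
        100 * (((L.filter fun r => s.tab .parity r = 1).flatMap B).map G.weight).sum) s t := by
  obtain ⟨hst, hlen, hnd, hLN, hmark⟩ := hL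
  have hLW : L.length ≤ G.numV := by
    rw [← List.toFinset_card_of_nodup hnd]
    calc _ ≤ (Finset.Icc 1 G.numV).card :=
          Finset.card_le_card fun x hx => hLN x (List.mem_toFinset.1 hx)
      _ = G.numV := by simp
  set bd : ℕ → Bool := fun v => G.IsBoundary (s.tab .support) v with hbd
  simp [Cmd.updateBoundaryLists, -Finset.mem_Icc]
  have hB1 : (s.setVar .j 0).Bounded W := hB.setVar (by omega)
  refine Wp.loopList (l := L) (I := fun L₁ L₂ s₁ t₁ =>
    s₁.var .j = L₁.length ∧ Stores (s.tab .roots) L₁.length L₂ ∧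
    BoundaryLists G.numV (s₁.tab .bFirst) (s₁.tab .bLast) (s₁.tab .bNext) ρ
        (fun r => if r ∈ L₁ ∧ s.tab .parity r = 1 then (B r).filter bd else B r) ∧
    t₁ .boundaryLists ≤ t .boundaryLists + 4 + 40 * L₁.length +
        100 * (((L₁.filter fun r => s.tab .parity r = 1).flatMap B).map G.weight).sum)
    hB1 ?_ ?_ ?_
  · simp
    exact ⟨hst, hlists⟩
  · rintro L₁ r L₂ s₁ t₁ hl hfr ⟨h1, h2, h3, h4⟩
    have hlenL : s₁.var .lenL = L.length := by rw [hfr.var _ rfl]; simpa using hlen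
    have hlt : L₁.length < L.length := by simp [hl]
    have hroots : s₁.tab .roots = s.tab .roots := hfr.tab _ rfl
    have hpar : s₁.tab .parity = s.tab .parity := hfr.tab _ rfl
    have hsup : s₁.tab .support = s.tab .support := hfr.tab _ rfl
    have hrW : r ≤ W := by rw [← h2.1]; exact hB.tab _ _
    have hrL : r ∈ L := by simp [hl]
    have hrN := hLN r hrL
    have hrr := hρ r hrL
    have hr₁ : r ∉ L₁ := by
      rw [hl, List.perm_middle.nodup_iff, List.nodup_cons] at hnd
      simp at hnd; exact hnd.1.1
    have hG₁ : Incidence G s₁ := hG.setVar.frame hfr rfl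
    simp only [h1, h2.1, wp_seq, wp_ite, wp_set, Test.Holds, Expr.eval, hlenL, hroots]
    simp [hpar, hrW, hlt, -Finset.mem_Icc]
    have hBr := h3 r hrN hrr
    simp only [hr₁, false_and, if_false] at hBr
    obtain ⟨c1, c2, c3, c4⟩ := hBr
    constructor
    · intro hp
      refine ⟨hfr.bounded.tab _ _, ?_⟩
      have hB2 : (((s₁.setVar .r r).setVar .v (s₁.tab .bFirst r)).setTab .bFirst r 0).Bounded W :=
        ((hfr.bounded.setVar hrW).setVar (hfr.bounded.tab _ _)).setTab (by omega)
      refine (Wp.loopList (l := B r) (I := fun b₁ b₂ s₂ t₂ =>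
        Chain (s₂.tab .bNext) (s₂.var .v) b₂ ∧
        CleanInv (B r) (b₁.filter bd) r (s₁.tab .bFirst) (s₁.tab .bLast) (s₁.tab .bNext)
          (s₂.tab .bFirst) (s₂.tab .bLast) (s₂.tab .bNext) ∧
        t₂ .boundaryLists ≤ t₁ .boundaryLists + 22 + 100 * (b₁.map G.weight).sum)
        (Q := fun s₂ t₂ => CleanInv (B r) ((B r).filter bd) r (s₁.tab .bFirst) (s₁.tab .bLast)
          (s₁.tab .bNext) (s₂.tab .bFirst) (s₂.tab .bLast) (s₂.tab .bNext) ∧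
        t₂ .boundaryLists ≤ t₁ .boundaryLists + 26 + 100 * ((B r).map G.weight).sum) hB2
        ?_ ?_ ?_).frame hB2 ?_
      · refine ⟨by simpa using c1, ⟨by simp [Chain], Or.inl rfl, ?_, by simp⟩, by simp⟩
        intro r' hr'
        exact ⟨by simp [Function.update_of_ne hr'], by simp⟩
      · rintro b₁ v b₂ s₂ t₂ hbl hfr₂ ⟨⟨g1, g2, g3⟩, ⟨g4, g5, g6, g7⟩, g8⟩
        have hr₂ : s₂.var .r = r := by rw [hfr₂.var _ rfl]; simp
        have hsup₂ : s₂.tab .support = s.tab .support := (hfr₂.tab _ rfl).trans hsup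
        have hG₂ : Incidence G s₂ := (hG₁.setVar.setVar.setTab).frame hfr₂ rfl
        have hvB : v ∈ B r := by simp [hbl]
        have hvN := (c4 v hvB).1
        refine ⟨by simp [g1, g2], ?_⟩
        rw [wp_seq, wp_set]
        refine ⟨hfr₂.bounded.tab _ _, ?_⟩
        simp only [Expr.eval, g1]
        have hB3 : (s₂.setVar .x (s₂.tab .bNext v)).Bounded W :=
          hfr₂.bounded.setVar (hfr₂.bounded.tab _ _)
        rw [wp_seq]
        refine (wp_testBoundary hB3 (by omega) hG₂.setVar (by simpa [g1] using hvN)).frame hB3 ?_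
        rintro s₃ t₃ hfr₃ ⟨k1, k2⟩
        have hv₃ : s₃.var .v = v := by rw [hfr₃.var _ rfl]; simpa using g1
        have hr₃ : s₃.var .r = r := by rw [hfr₃.var _ rfl]; simpa using hr₂
        have hx₃ : s₃.var .x = s₂.tab .bNext v := by rw [hfr₃.var _ rfl]; simp
        have hF₃ : s₃.tab .bFirst = s₂.tab .bFirst := hfr₃.tab _ rfl
        have hL₃ : s₃.tab .bLast = s₂.tab .bLast := hfr₃.tab _ rfl
        have hN₃ : s₃.tab .bNext = s₂.tab .bNext := hfr₃.tab _ rfl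
        simp [g1, hsup₂] at k1 k2
        have hbd' : bd v = true ↔ s₃.var .flag = 1 := by rw [k1]; simp [hbd]
        rw [wp_seq, wp_ite]
        have hndB := c3
        rw [hbl, List.nodup_append] at hndB
        have hvb₁ : v ∉ b₁.filter bd := fun h =>
          hndB.2.2 v (List.mem_of_mem_filter h) v (by simp) rfl
        constructor
        · intro hfl
          simp only [Test.Holds, Expr.eval] at hfl
          have hbv := hbd'.2 hfl
          refine (wp_appendVertex (K := b₁.filter bd) hfr₃.bounded (by rw [hr₃, hF₃, hN₃]; exact g4)
            (by rw [hr₃, hL₃]; exact g5) ((hndB.1).filter _) (by rw [hv₃]; exact hvb₁)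
            (by rw [hv₃]; exact g2)).frame hfr₃.bounded ?_
          rintro s₄ t₄ hfr₄ ⟨m1, m2, m3, m4, m5⟩
          rw [hr₃, hv₃] at m1
          rw [hr₃, hv₃] at m2
          rw [hr₃, hF₃, hL₃] at m3
          rw [hv₃, hN₃] at m4
          have hx₄ : s₄.var .x = s₂.tab .bNext v := by rw [hfr₄.var _ rfl, hx₃]
          have hfilt : (b₁ ++ [v]).filter bd = b₁.filter bd ++ [v] := by simp [hbv]
          simp only [wp_set, Expr.eval, hx₄, hfilt]
          simp
          -- Appending changes links only at `v` and at vertices kept earlier, so the part of the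
          -- old list that is still to be read stays intact.
          have hm4 : ∀ w ∈ b₂, s₄.tab .bNext w = s₂.tab .bNext w := fun w hw => m4 w
            (fun he => (List.nodup_cons.1 hndB.2.1).1 (he ▸ hw))
            (fun he => hndB.2.2 w (List.mem_of_mem_filter he) w (by simp [hw]) rfl)
          refine ⟨hfr₂.bounded.tab _ _, g3.congr hm4,
            ⟨m1, Or.inr ⟨_, by rw [m2]⟩, fun r' hr' => ?_, fun w hw => ?_⟩, ?_⟩
          · rw [(m3 r' hr').1, (m3 r' hr').2]; exact g6 r' hr'
          · rw [m4 w (fun he => hw (he ▸ hvB)) fun he => hw (by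
              rw [hbl]; simp [List.mem_of_mem_filter he]), g7 w hw]
          · simp at m5
            have : 1 ≤ G.weight v := by simp [weight]
            omega
        · intro hfl
          simp only [Test.Holds, Expr.eval] at hfl
          have hbv : bd v = false := by
            rw [Bool.eq_false_iff]; exact fun h => hfl (hbd'.1 h)
          have hfilt : (b₁ ++ [v]).filter bd = b₁.filter bd := by simp [hbv]
          simp only [wp_skip, wp_set, Expr.eval, hx₃, hfilt]
          simp [hN₃, hF₃, hL₃]
          have : 1 ≤ G.weight v := by simp [weight]
          exact ⟨hfr₂.bounded.tab _ _, g3, ⟨g4, g5, g6, g7⟩, by omega⟩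
      · rintro s₂ t₂ hfr₂ ⟨g1, g2, g3⟩
        simp [Chain] at g1
        simp [g1]
        exact ⟨g2, by omega⟩
      · rintro s₂ t₂ hfr₂ ⟨⟨g4, g5, g6, g7⟩, g3⟩
        have hj₂ : s₂.var .j = L₁.length := by rw [hfr₂.var _ rfl]; simpa using h1
        simp [hj₂]
        refine ⟨by omega, h2.2, ?_, ?_⟩
        · intro r' hr' hrr'
          have hB' := h3 r' hr' hrr'
          by_cases hx : r' = r
          · subst hx
            simp only [hp, and_true, or_true, if_true]
            exact ⟨g4, g5, c3.filter _, fun v hv => c4 v (List.mem_of_mem_filter hv)⟩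
          · obtain ⟨d1, d2, d3, d4⟩ := hB'
            rw [(g6 r' hx).1, (g6 r' hx).2]
            simp only [hx, or_false]
            refine ⟨d1.congr fun v hv => g7 v fun hvB => hx ?_, d2, d3, d4⟩
            rw [← (d4 v hv).2, (c4 v hvB).2]
        · simp [hp]
          omega
    · intro hp
      refine ⟨by omega, by omega, h2.2, ?_, by simp [hp]; omega⟩
      convert h3 using 2 with x
      by_cases hx : x = r
      · subst hx; simp [hp]
      · simp [hx]
  · rintro s₁ t₁ hfr ⟨h1, h2, h3, h4⟩
    have hlenL : s₁.var .lenL = L.length := by rw [hfr.var _ rfl]; simpa using hlen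
    simp [h1, hlenL, -Finset.mem_Icc]
    exact ⟨h3, by omega⟩

/-! ### Exploration of components -/

/-- `u` and `v`, numbered from `1`, are connected by `A`. -/
def Joined {G : Lattice} (A : Finset (Fin G.numE)) (u v : ℕ) : Prop :=
  ∃ a b : Fin G.numV, a.val + 1 = u ∧ b.val + 1 = v ∧ G.Connected A a b

section Joined

variable {G : Lattice} {A B : Finset (Fin G.numE)} {u v w d : ℕ}

theorem exists_fin {n v : ℕ} (hv : v ∈ Finset.Icc 1 n) : ∃ a : Fin n, a.val + 1 = v := by
  rw [Finset.mem_Icc] at hv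
  exact ⟨⟨v - 1, by omega⟩, by simp; omega⟩

theorem Joined.refl (hv : v ∈ Finset.Icc 1 G.numV) : Joined A v v := by
  obtain ⟨a, ha⟩ := exists_fin hv
  exact ⟨a, a, ha, ha, .refl a⟩

theorem Joined.symm (h : Joined A u v) : Joined A v u := by
  obtain ⟨a, b, ha, hb, hc⟩ := h
  exact ⟨b, a, hb, ha, hc.symm⟩

theorem Joined.trans (h : Joined A u v) (h' : Joined A v w) : Joined A u w := by
  obtain ⟨a, b, ha, hb, hc⟩ := h
  obtain ⟨b', c, hb', hc', h''⟩ := h'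
  obtain rfl : b = b' := Fin.ext (by omega)
  exact ⟨a, c, ha, hc', hc.trans h''⟩

theorem Joined.mono (h : Joined A u v) (hAB : A ⊆ B) : Joined B u v := by
  obtain ⟨a, b, ha, hb, hc⟩ := h
  exact ⟨a, b, ha, hb, hc.mono hAB⟩

theorem joined_end (hd : d ∈ G.ends v) (hA : ∀ e : Fin G.numE, e.val = edgeN d → e ∈ A) :
    Joined A v (G.farN d) := by
  obtain ⟨h1, h2, rfl⟩ := mem_ends.1 hd
  have hlt := edgeN_lt h1 h2
  have hc := connected_edge (hA ⟨_, hlt⟩ rfl)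
  unfold endN farN
  split
  · exact ⟨_, _, (srcN_coe ⟨_, hlt⟩).symm, (dstN_coe ⟨_, hlt⟩).symm, hc⟩
  · exact ⟨_, _, (dstN_coe ⟨_, hlt⟩).symm, (srcN_coe ⟨_, hlt⟩).symm, hc.symm⟩

/-- The other end of the same edge. It makes the exploration symmetric: a neighbour of a vertex can
look back at it. -/
theorem exists_reverse_end (hd : d ∈ G.ends v) :
    ∃ d' ∈ G.ends (G.farN d), edgeN d' = edgeN d ∧ G.farN d' = v := by
  obtain ⟨h1, h2, rfl⟩ := mem_ends.1 hd
  have hlt := edgeN_lt h1 h2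
  by_cases ho : d % 2 = 1
  · refine ⟨2 * edgeN d + 2, mem_ends.2 ⟨by omega, by omega, ?_⟩, by simp, ?_⟩
    · rw [endN_even, farN, if_pos ho]
    · rw [farN_even, endN, if_pos ho]
  · refine ⟨2 * edgeN d + 1, mem_ends.2 ⟨by omega, by omega, ?_⟩, by simp, ?_⟩
    · rw [endN_odd, farN, if_neg ho]
    · rw [farN_odd, endN, if_neg ho]

/-- A label is itself a vertex of the component it names, so vertices with equal labels are joined
through it. The converse only needs that labels are constant along edges. -/
theorem labels_of_joined {ρ : ℕ → ℕ} (h : ∀ v ∈ Finset.Icc 1 G.numV, Joined A v (ρ v))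
    (hA : ∀ e ∈ A, ρ (G.src e + 1) = ρ (G.dst e + 1)) : Labels A ρ := by
  intro u v
  refine ⟨fun huv => huv.eq_of_edges (fun x => ρ (x + 1)) hA, fun huv => ?_⟩
  have hmem : ∀ x : Fin G.numV, x.val + 1 ∈ Finset.Icc 1 G.numV := fun x => by
    have := x.isLt; simp
  have h1 := h _ (hmem u)
  rw [huv] at h1
  obtain ⟨a, b, ha, hb, hc⟩ := h1.trans (h _ (hmem v)).symm
  obtain rfl : a = u := Fin.ext (by omega)
  obtain rfl : b = v := Fin.ext (by omega)
  exact hc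

end Joined

/-- The vertices in `P` have been visited, and those in `pend` are pending; they belong to the
component with the label `r`. Only edges with `g` are used. -/
def Explored (G : Lattice) (g : ℕ → Prop) (P : Finset ℕ) (pend : List ℕ) (lab : ℕ → ℕ)
    (r : ℕ) : Prop :=
  (∀ v ∈ pend, v ∉ P) ∧ ∀ v ∈ P, ∀ d ∈ G.ends v, g (edgeN d) →
    (G.farN d ∈ P ∧ lab (G.farN d) = lab v) ∨ (G.farN d ∈ pend ∧ lab v = r)

namespace Explored

variable {G : Lattice} {g : ℕ → Prop} {P : Finset ℕ} {pend new : List ℕ} {lab : ℕ → ℕ} {r v : ℕ}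

theorem restart (h : Explored G g P [] lab r) {r' : ℕ} (hr : r' ∉ P) :
    Explored G g P [r'] lab r' := by
  refine ⟨by simpa using hr, fun v hv d hd hg => Or.inl ?_⟩
  simpa using h.2 v hv d hd hg

/-- The delicate case is a neighbour visited before `v`. Seen from there, `v` was not visited, so
the invariant says that `v` was pending and that this neighbour has the current label `r`. -/
theorem visit (h : Explored G g P (v :: pend) lab r) (hv : v ∉ pend)
    (hnew : ∀ w ∈ new, w ∉ P ∧ w ≠ v)
    (hnbr : ∀ d ∈ G.ends v, g (edgeN d) → G.farN d ∈ P ∨ G.farN d ∈ v :: pend ++ new) :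
    Explored G g (insert v P) (pend ++ new) (Function.update lab v r) r := by
  have hvP : v ∉ P := h.1 v (by simp)
  constructor
  · intro w hw
    rw [Finset.mem_insert, not_or]
    rcases List.mem_append.1 hw with hw | hw
    · exact ⟨fun he => hv (he ▸ hw), h.1 w (by simp [hw])⟩
    · exact (hnew w hw).symm
  · intro w hw d hd hg
    rcases Finset.mem_insert.1 hw with rfl | hw
    · rw [Function.update_self]
      rcases hnbr d hd hg with hf | hf
      · left
        refine ⟨Finset.mem_insert_of_mem hf, ?_⟩
        rw [Function.update_of_ne (ne_of_mem_of_not_mem hf hvP)]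
        obtain ⟨d', hd', he, hfar⟩ := exists_reverse_end hd
        rcases h.2 _ hf d' hd' (he ▸ hg) with h' | h'
        · rw [hfar] at h'; exact absurd h'.1 hvP
        · exact h'.2
      · simp only [List.cons_append, List.mem_cons] at hf
        rcases hf with hf | hf
        · left; rw [hf]; simp
        · exact Or.inr ⟨hf, rfl⟩
    · have hwv : w ≠ v := fun he => hvP (he ▸ hw)
      rw [Function.update_of_ne hwv]
      rcases h.2 w hw d hd hg with h' | h'
      · left
        rw [Function.update_of_ne (ne_of_mem_of_not_mem h'.1 hvP)]
        exact ⟨Finset.mem_insert_of_mem h'.1, h'.2⟩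
      · rcases List.mem_cons.1 h'.1 with hf | hf
        · left; rw [hf]; simp [h'.2]
        · exact Or.inr ⟨by simp [hf], h'.2⟩

theorem edge_eq (h : Explored G g (Finset.Icc 1 G.numV) [] lab r) {e : Fin G.numE} (he : g e) :
    lab (G.src e + 1) = lab (G.dst e + 1) := by
  have hd : 2 * e.val + 1 ∈ G.ends (G.src e + 1) :=
    mem_ends.2 ⟨by omega, by have := e.isLt; omega, by rw [endN_odd, srcN_coe]⟩
  have := h.2 _ (by have := (G.src e).isLt; simp) _ hd (by simpa using he)
  rw [farN_odd, dstN_coe] at this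
  simpa using this.elim (fun h => h.2.symm) (by simp)

end Explored

/-- The number of syndrome vertices among the visited vertices with the label `r`. -/
def visitedCount {G : Lattice} (σ : Finset (Fin G.numV)) (P : Finset ℕ) (ρ : ℕ → ℕ) (r : ℕ) : ℕ :=
  (σ.filter fun w => w.val + 1 ∈ P ∧ ρ (w.val + 1) = r).card

theorem visitedCount_insert {G : Lattice} {σ : Finset (Fin G.numV)} {P : Finset ℕ} {ρ : ℕ → ℕ}
    {a : Fin G.numV} {r : ℕ} (ha : a.val + 1 ∉ P) (x : ℕ) :
    visitedCount σ (insert (a.val + 1) P) (Function.update ρ (a.val + 1) r) x =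
      visitedCount σ P ρ x + if a ∈ σ ∧ x = r then 1 else 0 := by
  unfold visitedCount
  by_cases h : a ∈ σ ∧ x = r
  · obtain ⟨h1, rfl⟩ := h
    rw [if_pos ⟨h1, rfl⟩, ← Finset.card_insert_of_notMem (a := a) (by simp [ha])]
    congr 1
    ext w
    by_cases hw : w = a
    · subst hw; simp [h1]
    · have : w.val + 1 ≠ a.val + 1 := fun he => hw (Fin.ext (by omega))
      simp [hw, Fin.val_inj]
  · rw [if_neg h, add_zero]
    congr 1
    refine Finset.filter_congr fun w hw => ?_
    by_cases hwa : w = a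
    · subst hwa
      simp only [ha, false_and, iff_false, Function.update_self]
      rintro ⟨_, rfl⟩
      exact h ⟨hw, rfl⟩
    · have : w.val + 1 ≠ a.val + 1 := fun he => hwa (Fin.ext (by omega))
      simp [hwa, Fin.val_inj]

/-- The cluster-trees of the visited vertices `P`; the set of their roots is `R`. -/
structure StarForest {G : Lattice} (σ : Finset (Fin G.numV)) (E : Finset (Fin G.numE))
    (P R : Finset ℕ) (par size parity : ℕ → ℕ) : Prop where
  subset : P ⊆ Finset.Icc 1 G.numV
  roots_subset : R ⊆ Finset.Icc 1 G.numV
  par_mem : ∀ v ∈ P, par v ∈ R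
  par_root : ∀ v ∈ P, v ∈ R → par v = v
  joined : ∀ v ∈ P, Joined E v (par v)
  size_root : ∀ r ∈ R, size r = (P.filter fun v => par v = r).card
  size_eq_zero : ∀ v ∈ Finset.Icc 1 G.numV, v ∉ R → size v = 0
  parity_root : ∀ r ∈ R, parity r = visitedCount σ P par r % 2

namespace StarForest

variable {G : Lattice} {σ : Finset (Fin G.numV)} {E : Finset (Fin G.numE)} {P R : Finset ℕ}
  {par size parity : ℕ → ℕ}

theorem visit (h : StarForest σ E P R par size parity) {a : Fin G.numV} {r : ℕ}
    (ha : a.val + 1 ∉ P) (hr : r ∈ R) (har : a.val + 1 ∈ R → a.val + 1 = r)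
    (hj : Joined E (a.val + 1) r) :
    StarForest σ E (insert (a.val + 1) P) R (Function.update par (a.val + 1) r)
      (Function.update size r (size r + 1))
      (if a ∈ σ then Function.update parity r (1 - parity r) else parity) where
  subset := Finset.insert_subset (by have := a.isLt; simp) h.subset
  roots_subset := h.roots_subset
  par_mem v hv := by
    rw [Function.update_apply]; split
    · exact hr
    · exact h.par_mem v ((Finset.mem_insert.1 hv).resolve_left ‹_›)
  par_root v hv hvR := by
    rw [Function.update_apply]; split
    · rename_i hv'; rw [hv'] at hvR ⊢; exact (har hvR).symm
    · exact h.par_root v ((Finset.mem_insert.1 hv).resolve_left ‹_›) hvR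
  joined v hv := by
    rw [Function.update_apply]; split
    · rename_i hv'; rw [hv']; exact hj
    · exact h.joined v ((Finset.mem_insert.1 hv).resolve_left ‹_›)
  size_root x hx := by
    have e1 : P.filter (fun v => Function.update par (a.val + 1) r v = x) =
        P.filter fun v => par v = x := Finset.filter_congr fun v hv => by
      rw [Function.update_of_ne (ne_of_mem_of_not_mem hv ha)]
    rw [Finset.filter_insert, e1, Function.update_self, Function.update_apply]
    by_cases hxr : x = r
    · subst hxr
      rw [if_pos rfl, if_pos rfl, Finset.card_insert_of_notMem (by simp [ha]), h.size_root x hx]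
    · rw [if_neg hxr, if_neg (Ne.symm hxr), h.size_root x hx]
  size_eq_zero v hv hvR := by
    rw [Function.update_of_ne (ne_of_mem_of_not_mem hr hvR).symm]
    exact h.size_eq_zero v hv hvR
  parity_root x hx := by
    rw [visitedCount_insert ha]
    have := h.parity_root x hx
    by_cases haσ : a ∈ σ
    · by_cases hxr : x = r
      · subst hxr; simp [haσ]; omega
      · simp [haσ, hxr, this]
    · simp [haσ, this]

theorem restart (h : StarForest σ E P R par size parity) {r : ℕ} {size' parity' : ℕ → ℕ}
    (hr : r ∈ Finset.Icc 1 G.numV) (hrP : r ∉ P) (hrR : r ∉ R)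
    (hs : size' = Function.update size r 0) (hp : parity' = Function.update parity r 0) :
    StarForest σ E P (insert r R) par size' parity' where
  subset := h.subset
  roots_subset := Finset.insert_subset hr h.roots_subset
  par_mem v hv := Finset.mem_insert_of_mem (h.par_mem v hv)
  par_root v hv hvR :=
    h.par_root v hv ((Finset.mem_insert.1 hvR).resolve_left fun he => hrP (he ▸ hv))
  joined := h.joined
  size_root x hx := by
    rw [hs, Function.update_apply]; split
    · subst x
      rw [eq_comm, Finset.card_eq_zero, Finset.filter_eq_empty_iff]
      exact fun v hv he => hrR (he ▸ h.par_mem v hv)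
    · exact h.size_root x ((Finset.mem_insert.1 hx).resolve_left ‹_›)
  size_eq_zero v hv hvR := by
    rw [Finset.mem_insert, not_or] at hvR
    rw [hs, Function.update_of_ne hvR.1]
    exact h.size_eq_zero v hv hvR.2
  parity_root x hx := by
    rw [hp, Function.update_apply]; split
    · subst x
      rw [visitedCount, Finset.filter_eq_empty_iff.2]
      · rfl
      · exact fun v _ he => hrR (he.2 ▸ h.par_mem _ he.1)
    · exact h.parity_root x ((Finset.mem_insert.1 hx).resolve_left ‹_›)

/-- In trees of depth at most one the parent table is its own root map. Non-roots have stored size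
0, hence rank 0 by the convention for the logarithm of 0, while the root of a tree with at least two
vertices has rank at least 1. -/
theorem isForest (h : StarForest σ E (Finset.Icc 1 G.numV) R par size parity) :
    IsForest G.numV par size par where
  par_mem v hv := h.roots_subset (h.par_mem v hv)
  root_mem v hv := h.roots_subset (h.par_mem v hv)
  root_par v hv := h.par_root _ (h.roots_subset (h.par_mem v hv)) (h.par_mem v hv)
  root_of_fixed _ _ he := he
  par_root v hv := h.par_root _ (h.roots_subset (h.par_mem v hv)) (h.par_mem v hv)
  rank_lt v hv hne := by
    have hvR : v ∉ R := fun hR => hne (h.par_root v hv hR)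
    have hpR := h.par_mem v hv
    have hpN := h.roots_subset hpR
    rw [h.size_eq_zero v hv hvR, h.size_root _ hpR, Nat.log_zero_right]
    refine Nat.log_pos one_lt_two (Finset.one_lt_card.2 ⟨v, ?_, par v, ?_, Ne.symm hne⟩)
    · simpa using Finset.mem_Icc.1 hv
    · have := h.par_root _ hpN hpR
      simp [this, -Finset.mem_Icc, hpN]
  size_root v hv he := h.size_root v (by have := h.par_mem v hv; rwa [he] at this)
  size_le v hv := by
    by_cases hR : v ∈ R
    · rw [h.size_root v hR]
      exact (Finset.card_filter_le _ _).trans (by simp)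
    · rw [h.size_eq_zero v hv hR]; omega

theorem parityInv (h : StarForest σ E (Finset.Icc 1 G.numV) R par size parity) :
    ParityInv σ par parity := by
  intro r hr he
  rw [h.parity_root r (by have := h.par_mem r hr; rwa [he] at this)]
  unfold visitedCount synCount
  congr 2
  ext w
  simp

end StarForest

/-- `B r` is the boundary list of the root `r ∈ R`; it consists of the visited vertices of its
cluster that are boundary vertices. -/
def StarLists (bd : ℕ → Prop) (P R : Finset ℕ) (par fst lst nxt : ℕ → ℕ) (B : ℕ → List ℕ) : Prop :=
  ∀ r ∈ R, Chain nxt (fst r) (B r) ∧ (B r = [] ∨ ∃ l, B r = l ++ [lst r]) ∧ (B r).Nodup ∧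
    ∀ v, v ∈ B r ↔ v ∈ P ∧ par v = r ∧ bd v

namespace StarLists

variable {bd : ℕ → Prop} {P R : Finset ℕ} {par fst lst nxt fst' lst' nxt' : ℕ → ℕ}
  {B : ℕ → List ℕ} {v r : ℕ}

theorem restart (h : StarLists bd P R par fst lst nxt B) (hr : ∀ v ∈ P, par v ≠ r)
    (hf : fst' = Function.update fst r 0) :
    StarLists bd P (insert r R) par fst' lst nxt (Function.update B r []) := by
  intro x hx
  rw [hf, Function.update_apply, Function.update_apply]
  split
  · subst x
    refine ⟨rfl, Or.inl rfl, List.nodup_nil, fun v => ?_⟩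
    simp only [List.not_mem_nil, false_iff]
    exact fun h' => hr v h'.1 h'.2.1
  · exact h x ((Finset.mem_insert.1 hx).resolve_left ‹_›)

theorem visit_interior (h : StarLists bd P R par fst lst nxt B) (hv : v ∉ P) (hb : ¬ bd v) :
    StarLists bd (insert v P) R (Function.update par v r) fst lst nxt B := by
  intro x hx
  obtain ⟨h1, h2, h3, h4⟩ := h x hx
  refine ⟨h1, h2, h3, fun w => (h4 w).trans ?_⟩
  by_cases hw : w = v
  · subst hw; simp [hv, hb]
  · simp [hw]

theorem visit_boundary (h : StarLists bd P R par fst lst nxt B) (hv : v ∉ P) (hb : bd v)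
    (hr : r ∈ R) (h1 : Chain nxt' (fst' r) (B r ++ [v])) (h2 : lst' r = v)
    (h3 : ∀ x, x ≠ r → fst' x = fst x ∧ lst' x = lst x)
    (h4 : ∀ w, w ≠ v → w ∉ B r → nxt' w = nxt w) :
    StarLists bd (insert v P) R (Function.update par v r) fst' lst' nxt'
      (Function.update B r (B r ++ [v])) := by
  have hvB : ∀ x ∈ R, v ∉ B x := fun x hx h' => hv (((h x hx).2.2.2 v).1 h').1
  intro x hx
  rw [Function.update_apply]
  split
  · subst x
    obtain ⟨g1, g2, g3, g4⟩ := h r hr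
    refine ⟨h1, Or.inr ⟨_, by rw [h2]⟩, ?_, fun w => ?_⟩
    · rw [List.nodup_append]
      refine ⟨g3, by simp, ?_⟩
      rintro a ha b hb rfl
      rw [List.mem_singleton] at hb
      exact hvB r hr (hb ▸ ha)
    · rw [List.mem_append, g4 w, List.mem_singleton]
      by_cases hw : w = v
      · subst hw; simp [hb]
      · simp [hw]
  · rename_i hxr
    obtain ⟨g1, g2, g3, g4⟩ := h x hx
    refine ⟨?_, ?_, g3, fun w => (g4 w).trans ?_⟩
    · rw [(h3 x hxr).1]
      refine g1.congr fun w hw => h4 w (fun he => hvB x hx (he ▸ hw)) fun hw' => hxr ?_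
      exact ((g4 w).1 hw).2.1.symm.trans (((h r hr).2.2.2 w).1 hw').2.1
    · rw [(h3 x hxr).2]; exact g2
    · by_cases hw : w = v
      · subst hw; simp [hv, Ne.symm hxr]
      · simp [hw]

end StarLists

/-- Adds the unseen neighbours of `v` to the queue. -/
def Cmd.exploreEnds : Cmd :=
  .forEnds .v
    (.ite (.eq (.get .support (.get .edge (.var .d))) (.lit 2))
      (.set .w (.get .target (.var .d)) ;;
       .ite (.eq (.get .seen (.var .w)) (.lit 0))
         (.put .seen (.var .w) (.lit 1) ;;
          .put .queue (.var .back) (.var .w) ;;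
          .incr .back) .skip) .skip)

theorem length_le_of_nodup {N : ℕ} {l : List ℕ} (h : l.Nodup) (hN : ∀ v ∈ l, v ∈ Finset.Icc 1 N) :
    l.length ≤ N := by
  rw [← List.toFinset_card_of_nodup h]
  calc _ ≤ (Finset.Icc 1 N).card := Finset.card_le_card fun x hx => hN x (List.mem_toFinset.1 hx)
    _ = N := by simp

/-- The queue `Q` has been extended by the vertices `N`, which are far vertices of edge ends in
`l` with `g`. -/
def QueueInv (G : Lattice) (g : ℕ → Prop) (Q N l : List ℕ) (seen₀ seen queue : ℕ → ℕ)
    (back : ℕ) : Prop :=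
  Stores queue 0 (Q ++ N) ∧ back = (Q ++ N).length ∧ (Q ++ N).Nodup ∧
    (∀ w ∈ Q ++ N, w ∈ Finset.Icc 1 G.numV) ∧
    (∀ w, seen w = if w ∈ N then 1 else seen₀ w) ∧ (∀ w ∈ N, seen₀ w = 0) ∧
    (∀ w ∈ N, ∃ d ∈ l, g (edgeN d) ∧ G.farN d = w) ∧ ∀ d ∈ l, g (edgeN d) → seen (G.farN d) ≠ 0

namespace QueueInv

variable {G : Lattice} {g : ℕ → Prop} {Q N l : List ℕ} {seen₀ seen queue : ℕ → ℕ} {back d : ℕ}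

theorem skip (h : QueueInv G g Q N l seen₀ seen queue back)
    (hd : g (edgeN d) → seen (G.farN d) ≠ 0) :
    QueueInv G g Q N (l ++ [d]) seen₀ seen queue back := by
  obtain ⟨h1, h2, h3, h4, h5, h6, h7, h8⟩ := h
  refine ⟨h1, h2, h3, h4, h5, h6, fun w hw => ?_, fun x hx => ?_⟩
  · obtain ⟨x, hx, hx'⟩ := h7 w hw
    exact ⟨x, by simp [hx], hx'⟩
  · rcases List.mem_append.1 hx with hx | hx
    · exact h8 x hx
    · rw [List.mem_singleton] at hx; subst hx; exact hd

theorem push (h : QueueInv G g Q N l seen₀ seen queue back) (hg : g (edgeN d))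
    (hs : seen (G.farN d) = 0) (hQ : ∀ w ∈ Q, seen₀ w ≠ 0) (hd : G.farN d ∈ Finset.Icc 1 G.numV) :
    QueueInv G g Q (N ++ [G.farN d]) (l ++ [d]) seen₀ (Function.update seen (G.farN d) 1)
      (Function.update queue back (G.farN d)) (back + 1) := by
  obtain ⟨h1, h2, h3, h4, h5, h6, h7, h8⟩ := h
  have hN : G.farN d ∉ N := fun hm => by rw [h5, if_pos hm] at hs; omega
  have hs₀ : seen₀ (G.farN d) = 0 := by rwa [h5, if_neg hN] at hs
  have hQN : G.farN d ∉ Q ++ N := fun hm =>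
    (List.mem_append.1 hm).elim (fun hm => hQ _ hm hs₀) hN
  rw [QueueInv, ← List.append_assoc]
  refine ⟨h1.push_zero h2 _, by simp [h2]; omega, ?_, ?_, ?_, ?_, ?_, ?_⟩
  · rw [List.nodup_append]
    refine ⟨h3, by simp, ?_⟩
    rintro a ha b hb rfl
    rw [List.mem_singleton] at hb
    exact hQN (hb ▸ ha)
  · intro w hw
    rcases List.mem_append.1 hw with hw | hw
    · exact h4 w hw
    · rw [List.mem_singleton] at hw; rwa [hw]
  · intro w
    rw [Function.update_apply]
    split
    · simp [*]
    · rw [h5 w]; simp [*]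
  · intro w hw
    rcases List.mem_append.1 hw with hw | hw
    · exact h6 w hw
    · rw [List.mem_singleton] at hw; rwa [hw]
  · intro w hw
    rcases List.mem_append.1 hw with hw | hw
    · obtain ⟨x, hx, hx'⟩ := h7 w hw
      exact ⟨x, by simp [hx], hx'⟩
    · rw [List.mem_singleton] at hw
      exact ⟨d, by simp, hg, hw.symm⟩
  · intro x hx hgx
    rw [Function.update_apply]
    split
    · omega
    · rcases List.mem_append.1 hx with hx | hx
      · exact h8 x hx hgx
      · rw [List.mem_singleton] at hx; subst hx; simp at *

end QueueInv

theorem wp_exploreEnds {G : Lattice} {W : ℕ} {p : Phase} {s : Store} {t : Phase → ℕ}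
    {Q : List ℕ} (hB : s.Bounded W) (hW : G.numV + 1 ≤ W) (hG : Incidence G s)
    (hv : s.var .v ∈ Finset.Icc 1 G.numV) (hQ : Stores (s.tab .queue) 0 Q)
    (hlen : s.var .back = Q.length) (hnd : Q.Nodup) (hQN : ∀ w ∈ Q, w ∈ Finset.Icc 1 G.numV)
    (hseen : ∀ w ∈ Q, s.tab .seen w ≠ 0) :
    Wp W p .exploreEnds (fun s' t' => (∃ N, QueueInv G (fun e => s.tab .support e = 2) Q N
        (G.ends (s.var .v)) (s.tab .seen) (s'.tab .seen) (s'.tab .queue) (s'.var .back)) ∧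
      t' p ≤ t p + 40 * G.weight (s.var .v)) s t := by
  refine Wp.forEnds (l := G.ends (s.var .v)) (I := fun l₁ l₂ s₁ t₁ =>
    (∃ N, QueueInv G (fun e => s.tab .support e = 2) Q N l₁ (s.tab .seen) (s₁.tab .seen)
      (s₁.tab .queue) (s₁.var .back)) ∧ t₁ p ≤ t p + 10 + 40 * l₁.length) hB (hG.chain _ hv)
    rfl rfl ?_ ?_ ?_
  · refine ⟨⟨[], ?_⟩, by simp⟩
    refine ⟨by simpa using hQ, by simpa using hlen, by simpa using hnd, by simpa using hQN,
      by simp, by simp, by simp, by simp⟩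
  · rintro l₁ d l₂ s₁ t₁ hl hfr hd ⟨⟨N, hN⟩, h2⟩
    have hdm : d ∈ G.ends (s.var .v) := by simp [hl]
    obtain ⟨hd1, hd2, _⟩ := mem_ends.1 hdm
    have hG₁ : Incidence G s₁ := hG.frame hfr rfl
    have hsup : s₁.tab .support = s.tab .support := hfr.tab _ rfl
    have hfar := farN_mem hd1 hd2
    have hfarW : G.farN d ≤ W := by rw [← hG₁.target d hd1 hd2]; exact hfr.bounded.tab _ _
    have hlenN := length_le_of_nodup hN.2.2.1 hN.2.2.2.1
    have hback := hN.2.1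
    have hll : (l₁ ++ [d]).length = l₁.length + 1 := by simp
    simp [hd, hG₁.edge d hd1 hd2, hG₁.target d hd1 hd2, hsup, -Finset.mem_Icc,
      -List.length_append]
    refine ⟨fun hg => ⟨hfarW, fun hs => ⟨by omega, by omega, by omega, ?_, by omega⟩,
      fun hs => ⟨⟨N, hN.skip fun _ => hs⟩, by omega⟩⟩,
      fun hg => ⟨⟨N, hN.skip fun h => absurd h hg⟩, by omega⟩⟩
    exact ⟨_, hN.push hg hs hseen hfar⟩
  · rintro s₁ t₁ hfr ⟨h1, h2⟩
    refine ⟨h1, ?_⟩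
    simp [weight]
    omega

/-! ### Initialization of the clusters -/

/-- Visits the next vertex of the queue. -/
def Cmd.visitVertex : Cmd :=
  .set .v (.get .queue (.var .front)) ;;
  .incr .front ;;
  .put .parent (.var .v) (.var .r) ;;
  .put .size (.var .r) (.add (.get .size (.var .r)) (.lit 1)) ;;
  .ite (.eq (.get .syn (.var .v)) (.lit 1)) (.flip .parity (.var .r)) .skip ;;
  .exploreEnds ;;
  .testBoundary ;;
  .ite (.eq (.var .flag) (.lit 1)) .appendVertex .skip

theorem wp_flipParity {W : ℕ} {p : Phase} {s : Store} {t : Phase → ℕ} (hW : 1 ≤ W) :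
    Wp W p (.ite (.eq (.get .syn (.var .v)) (.lit 1)) (.flip .parity (.var .r)) .skip)
      (fun s' t' => s'.tab .parity = (if s.tab .syn (s.var .v) = 1 then
        Function.update (s.tab .parity) (s.var .r) (1 - s.tab .parity (s.var .r))
        else s.tab .parity) ∧ t' p ≤ t p + 20) s t := by
  simp
  exact ⟨fun h => ⟨by omega, by simp [h]⟩, fun h => by simp [h]⟩

theorem wp_appendBoundary {W : ℕ} {p : Phase} {s : Store} {t : Phase → ℕ} {bd : ℕ → Prop}
    {P R : Finset ℕ} {par : ℕ → ℕ} {B : ℕ → List ℕ} (hB : s.Bounded W)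
    (hlists : StarLists bd P R par (s.tab .bFirst) (s.tab .bLast) (s.tab .bNext) B)
    (hr : s.var .r ∈ R) (hv : s.var .v ∉ P) (hv0 : s.var .v ≠ 0)
    (hflag : s.var .flag = 1 ↔ bd (s.var .v)) :
    Wp W p (.ite (.eq (.var .flag) (.lit 1)) .appendVertex .skip)
      (fun s' t' => (∃ B', StarLists bd (insert (s.var .v) P) R
        (Function.update par (s.var .v) (s.var .r)) (s'.tab .bFirst) (s'.tab .bLast)
        (s'.tab .bNext) B') ∧ t' p ≤ t p + 30) s t := by
  rw [wp_ite]
  simp only [Test.Holds, Expr.eval, hflag]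
  constructor
  · intro hb
    obtain ⟨h1, h2, h3, h4⟩ := hlists _ hr
    refine (wp_appendVertex hB h1 h2 h3 (fun h => hv ((h4 _).1 h).1) hv0).mono ?_
    rintro s' t' ⟨g1, g2, g3, g4, g5⟩
    refine ⟨⟨_, hlists.visit_boundary hv hb hr g1 g2 g3 g4⟩, ?_⟩
    simp at g5
    omega
  · intro hb
    rw [wp_skip]
    exact ⟨⟨B, hlists.visit_interior hv hb⟩, by simp⟩

theorem wp_visitVertex {G : Lattice} {W : ℕ} {p : Phase} {s : Store} {t : Phase → ℕ}
    {P R : Finset ℕ} {B : ℕ → List ℕ} {Q : List ℕ} {v : ℕ} (hB : s.Bounded W)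
    (hW : G.numV + 1 ≤ W) (hG : Incidence G s) (hqv : s.tab .queue (s.var .front) = v)
    (hv : v ∈ Finset.Icc 1 G.numV) (hfront : s.var .front + 1 ≤ W)
    (hsize : s.tab .size (s.var .r) + 1 ≤ W) (hQ : Stores (s.tab .queue) 0 Q)
    (hlen : s.var .back = Q.length) (hnd : Q.Nodup) (hQN : ∀ w ∈ Q, w ∈ Finset.Icc 1 G.numV)
    (hseen : ∀ w ∈ Q, s.tab .seen w ≠ 0)
    (hlists : StarLists (G.IsBoundary (s.tab .support)) P R (s.tab .parent) (s.tab .bFirst)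
      (s.tab .bLast) (s.tab .bNext) B) (hr : s.var .r ∈ R) (hvP : v ∉ P) :
    Wp W p .visitVertex (fun s' t' =>
      (∃ N, QueueInv G (fun e => s.tab .support e = 2) Q N (G.ends v) (s.tab .seen)
        (s'.tab .seen) (s'.tab .queue) (s'.var .back)) ∧
      s'.var .front = s.var .front + 1 ∧
      s'.tab .parent = Function.update (s.tab .parent) v (s.var .r) ∧
      s'.tab .size = Function.update (s.tab .size) (s.var .r) (s.tab .size (s.var .r) + 1) ∧
      s'.tab .parity = (if s.tab .syn v = 1 then
        Function.update (s.tab .parity) (s.var .r) (1 - s.tab .parity (s.var .r))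
        else s.tab .parity) ∧
      (∃ B', StarLists (G.IsBoundary (s.tab .support)) (insert v P) R
        (Function.update (s.tab .parent) v (s.var .r)) (s'.tab .bFirst) (s'.tab .bLast)
        (s'.tab .bNext) B') ∧
      t' p ≤ t p + 150 * G.weight v) s t := by
  have hv' := Finset.mem_Icc.1 hv
  have hvW : v ≤ W := by omega
  have hrW := hB.var .r
  have hw : 1 ≤ G.weight v := by simp [weight]
  simp only [Cmd.visitVertex, Cmd.incr, wp_seq (c := .set _ _), wp_seq (c := .put _ _ _), wp_set,
    wp_put, Expr.eval, Expr.cost, hqv, tick_tick]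
  refine ⟨hvW, by simpa using hfront, by simpa using hrW, by simpa using hsize, ?_⟩
  set s₂ : Store := (((s.setVar .v v).setVar .front ((s.setVar .v v).var .front + 1)).setTab
    .parent _ _).setTab .size _ _ with hs₂
  have hB₂ : s₂.Bounded W := by
    refine (((hB.setVar hvW).setVar ?_).setTab ?_).setTab ?_
    · simpa using hfront
    · simpa using hrW
    · simpa using hsize
  have hG₂ : Incidence G s₂ := hG.setVar.setVar.setTab.setTab
  have e1 : s₂.var .v = v := by simp [hs₂]
  have e2 : s₂.var .r = s.var .r := by simp [hs₂]
  have e3 : s₂.var .front = s.var .front + 1 := by simp [hs₂]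
  have e4 : s₂.tab .parent = Function.update (s.tab .parent) v (s.var .r) := by simp [hs₂]
  have e5 : s₂.tab .size =
    Function.update (s.tab .size) (s.var .r) (s.tab .size (s.var .r) + 1) := by simp [hs₂]
  have e6 : s₂.var .back = s.var .back := by simp [hs₂]
  have e7 : s₂.tab .queue = s.tab .queue := by simp [hs₂]
  have e8 : s₂.tab .seen = s.tab .seen := by simp [hs₂]
  have e9 : s₂.tab .support = s.tab .support := by simp [hs₂]
  have e10 : s₂.tab .syn = s.tab .syn := by simp [hs₂]
  have e11 : s₂.tab .parity = s.tab .parity := by simp [hs₂]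
  have e12 : s₂.tab .bFirst = s.tab .bFirst := by simp [hs₂]
  have e13 : s₂.tab .bLast = s.tab .bLast := by simp [hs₂]
  have e14 : s₂.tab .bNext = s.tab .bNext := by simp [hs₂]
  clear_value s₂
  rw [wp_seq]
  refine (wp_flipParity (by omega)).frame hB₂ ?_
  rintro s₃ t₃ hf₃ ⟨h3, ht₃⟩
  have hG₃ : Incidence G s₃ := hG₂.frame hf₃ rfl
  have v₃ : s₃.var .v = v := by rw [hf₃.var _ rfl, e1]
  have sup₃ : s₃.tab .support = s.tab .support := by rw [hf₃.tab _ rfl, e9]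
  have seen₃ : s₃.tab .seen = s.tab .seen := by rw [hf₃.tab _ rfl, e8]
  rw [wp_seq]
  refine (wp_exploreEnds hf₃.bounded hW hG₃ (by rwa [v₃])
    (Q := Q) (by rw [hf₃.tab _ rfl, e7]; exact hQ) (by rw [hf₃.var _ rfl, e6]; exact hlen) hnd hQN
    (by rw [seen₃]; exact hseen)).frame hf₃.bounded ?_
  rintro s₄ t₄ hf₄ ⟨h4, ht₄⟩
  rw [sup₃, v₃, seen₃] at h4
  have hG₄ : Incidence G s₄ := hG₃.frame hf₄ rfl
  have v₄ : s₄.var .v = v := by rw [hf₄.var _ rfl, v₃]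
  have sup₄ : s₄.tab .support = s.tab .support := by rw [hf₄.tab _ rfl, sup₃]
  rw [wp_seq]
  refine (wp_testBoundary hf₄.bounded (by omega) hG₄ (by rwa [v₄])).frame hf₄.bounded ?_
  rintro s₅ t₅ hf₅ ⟨h5, ht₅⟩
  rw [sup₄, v₄] at h5
  have v₅ : s₅.var .v = v := by rw [hf₅.var _ rfl, v₄]
  have r₅ : s₅.var .r = s.var .r := by rw [hf₅.var _ rfl, hf₄.var _ rfl, hf₃.var _ rfl, e2]
  have f₅ : s₅.tab .bFirst = s.tab .bFirst := by
    rw [hf₅.tab _ rfl, hf₄.tab _ rfl, hf₃.tab _ rfl, e12]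
  have l₅ : s₅.tab .bLast = s.tab .bLast := by
    rw [hf₅.tab _ rfl, hf₄.tab _ rfl, hf₃.tab _ rfl, e13]
  have n₅ : s₅.tab .bNext = s.tab .bNext := by
    rw [hf₅.tab _ rfl, hf₄.tab _ rfl, hf₃.tab _ rfl, e14]
  refine (wp_appendBoundary (bd := G.IsBoundary (s.tab .support)) (P := P) (R := R)
    (par := s.tab .parent) (B := B) hf₅.bounded (by rw [f₅, l₅, n₅]; exact hlists) (by rwa [r₅])
    (by rwa [v₅]) (by rw [v₅]; omega) (by rw [h5, v₅]; simp)).frame hf₅.bounded ?_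
  rintro s₆ t₆ hf₆ ⟨h6, ht₆⟩
  rw [v₅, r₅] at h6
  refine ⟨?_, ?_, ?_, ?_, ?_, h6, ?_⟩
  · rw [hf₆.tab _ rfl, hf₅.tab _ rfl, hf₆.tab _ rfl, hf₅.tab _ rfl, hf₆.var _ rfl, hf₅.var _ rfl]
    exact h4
  · rw [hf₆.var _ rfl, hf₅.var _ rfl, hf₄.var _ rfl, hf₃.var _ rfl, e3]
  · rw [hf₆.tab _ rfl, hf₅.tab _ rfl, hf₄.tab _ rfl, hf₃.tab _ rfl, e4]
  · rw [hf₆.tab _ rfl, hf₅.tab _ rfl, hf₄.tab _ rfl, hf₃.tab _ rfl, e5]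
  · rw [hf₆.tab _ rfl, hf₅.tab _ rfl, hf₄.tab _ rfl, h3, e1, e2, e10, e11]
  · simp at ht₃
    rw [v₃] at ht₄
    rw [v₄] at ht₅
    omega

/-- The state of the exploration of the cluster with the root `r`, before which the vertices in
`P₀` had been visited. -/
structure ClusterInv (G : Lattice) (σ : Finset (Fin G.numV)) (E : Finset (Fin G.numE))
    (P₀ R : Finset ℕ) (r : ℕ) (P : Finset ℕ) (fin pend : List ℕ) (B : ℕ → List ℕ) (s : Store) :
    Prop where
  subset : P₀ ⊆ P
  root : r ∈ P ∨ r ∈ pend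
  queue : Stores (s.tab .queue) 0 (fin ++ pend)
  front : s.var .front = fin.length
  back : s.var .back = (fin ++ pend).length
  nodup : (fin ++ pend).Nodup
  mem : ∀ w ∈ fin ++ pend, w ∈ Finset.Icc 1 G.numV
  visited : ∀ w ∈ fin, w ∈ P
  seen : ∀ w ∈ Finset.Icc 1 G.numV, s.tab .seen w = if w ∈ P ∨ w ∈ pend then 1 else 0
  joined : ∀ w ∈ pend, Joined E w r
  explored : Explored G (fun e => s.tab .support e = 2) P pend (s.tab .parent) r
  forest : StarForest σ E P R (s.tab .parent) (s.tab .size) (s.tab .parity)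
  lists : StarLists (G.IsBoundary (s.tab .support)) P R (s.tab .parent) (s.tab .bFirst)
    (s.tab .bLast) (s.tab .bNext) B

theorem sum_insert_weight {G : Lattice} {P : Finset ℕ} {v : ℕ} (hv : v ∉ P) :
    ∑ w ∈ insert v P, G.weight w = G.weight v + ∑ w ∈ P, G.weight w := Finset.sum_insert hv

/-- The time is charged to the weights of the newly visited vertices; both sums appear on opposite
sides in order to avoid a subtraction. That parities of other roots stay the same is needed for the
odd roots already listed. -/
theorem wp_exploreCluster {G : Lattice} {σ : Finset (Fin G.numV)} {W : ℕ} {p : Phase} {s : Store}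
    {t : Phase → ℕ} {P₀ R : Finset ℕ} {B : ℕ → List ℕ} {r : ℕ} (hB : s.Bounded W)
    (hW : G.numV + 2 ≤ W) (hG : Incidence G s)
    (hsyn : ∀ v : Fin G.numV, s.tab .syn (v + 1) = 1 ↔ v ∈ σ) (hr : s.var .r = r) (hrR : r ∈ R)
    (hR : ∀ v ∈ R, v ∈ P₀ ∨ v = r)
    (h : ClusterInv G σ (Finset.univ.filter fun e => s.tab .support e = 2) P₀ R r P₀ [] [r] B s) :
    Wp W p (.loop (.lt (.var .front) (.var .back)) .visitVertex) (fun s' t' => ∃ P fin B',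
      ClusterInv G σ (Finset.univ.filter fun e => s.tab .support e = 2) P₀ R r P fin [] B' s' ∧
      (∀ x, x ≠ r → s'.tab .parity x = s.tab .parity x) ∧
      t' p + 160 * ∑ w ∈ P₀, G.weight w ≤ t p + 10 + 160 * ∑ w ∈ P, G.weight w) s t := by
  set E := Finset.univ.filter fun e : Fin G.numE => s.tab .support e = 2 with hE
  refine Wp.loop (I := fun s₁ t₁ => ∃ P fin pend B', ClusterInv G σ E P₀ R r P fin pend B' s₁ ∧
      (∀ x, x ≠ r → s₁.tab .parity x = s.tab .parity x) ∧
      t₁ p + 160 * ∑ w ∈ P₀, G.weight w ≤ t p + 160 * ∑ w ∈ P, G.weight w)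
    (fun s₁ => G.numV - s₁.var .front) hB ⟨P₀, [], [r], B, h, by simp, le_rfl⟩ ?_ ?_
  · rintro s₁ t₁ hfr ⟨P, fin, pend, B₁, hI, hpar, ht⟩ hb
    simp only [Test.Holds, Expr.eval, hI.front, hI.back, List.length_append] at hb
    obtain ⟨v, rest, rfl⟩ : ∃ v rest, pend = v :: rest := by
      cases pend with
      | nil => simp at hb
      | cons v rest => exact ⟨v, rest, rfl⟩
    have hlen := length_le_of_nodup hI.nodup hI.mem
    rw [List.length_append, List.length_cons] at hlen
    have hsup : s₁.tab .support = s.tab .support := hfr.tab _ rfl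
    have hG₁ : Incidence G s₁ := hG.frame hfr rfl
    have hr₁ : s₁.var .r = r := by rw [hfr.var _ rfl, hr]
    have hv := hI.mem v (by simp)
    have hvP : v ∉ P := hI.explored.1 v (by simp)
    have hqv : s₁.tab .queue (s₁.var .front) = v := by
      have := (Stores.append_iff.1 hI.queue).2.1
      rwa [Nat.zero_add, ← hI.front] at this
    have hrN := hI.forest.roots_subset hrR
    have hsize : s₁.tab .size r ≤ G.numV := by
      rw [hI.forest.size_root r hrR]
      refine (Finset.card_le_card ((Finset.filter_subset _ _).trans hI.forest.subset)).trans ?_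
      simp
    have hsyn₁ : s₁.tab .syn = s.tab .syn := hfr.tab _ rfl
    refine (wp_visitVertex (P := P) (R := R) (B := B₁) (Q := fin ++ v :: rest) hfr.bounded
      (by omega) hG₁ hqv hv (by rw [hI.front]; omega) (by rw [hr₁]; omega) hI.queue hI.back hI.nodup
      hI.mem ?_ hI.lists (by rwa [hr₁]) hvP).frame hfr.bounded ?_
    · intro w hw
      rw [hI.seen w (hI.mem w hw), if_pos]
      · omega
      · exact (List.mem_append.1 hw).imp (hI.visited w) id
    rintro s₂ t₂ hf₂ ⟨⟨N, q1, q2, q3, q4, q5, q6, q7, q8⟩, h2, h3, h4, h5, ⟨B', h6⟩, h7⟩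
    rw [hr₁] at h3 h4 h5 h6
    have hsup₂ : s₂.tab .support = s₁.tab .support := hf₂.tab _ rfl
    obtain ⟨a, rfl⟩ := exists_fin hv
    have hvr : a.val + 1 ∈ R → a.val + 1 = r := fun hvR =>
      (hR _ hvR).resolve_left fun h => hvP (hI.subset h)
    have hjv := hI.joined _ (List.mem_cons_self ..)
    have hndq := hI.nodup
    rw [List.nodup_append, List.nodup_cons] at hndq
    have hNN : ∀ w ∈ N, w ∈ Finset.Icc 1 G.numV := fun w hw => q4 w (by simp [hw])
    have hNseen : ∀ w ∈ N, w ∉ P ∧ w ≠ a.val + 1 ∧ w ∉ rest := fun w hw => by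
      have := q6 w hw
      rw [hI.seen w (hNN w hw)] at this
      simpa using this
    refine ⟨⟨insert (a.val + 1) P, fin ++ [a.val + 1], rest ++ N, B', ⟨hI.subset.trans
      (Finset.subset_insert _ _), ?_, ?_, ?_, ?_, ?_, ?_, ?_, ?_, ?_, ?_, ?_, ?_⟩, ?_, ?_⟩, ?_⟩
    · rcases hI.root with h | h
      · exact Or.inl (Finset.mem_insert_of_mem h)
      · rcases List.mem_cons.1 h with h | h
        · left; rw [h]; simp
        · right; simp [h]
    · simpa using q1
    · simp [h2, hI.front]
    · simp [q2]
    · simpa using q3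
    · simpa using q4
    · intro w hw
      rcases List.mem_append.1 hw with hw | hw
      · exact Finset.mem_insert_of_mem (hI.visited w hw)
      · rw [List.mem_singleton] at hw; rw [hw]; simp
    · intro w hw
      rw [q5, hI.seen w hw]
      by_cases hwN : w ∈ N
      · simp [hwN]
      · simp only [hwN, if_false, Finset.mem_insert, List.mem_cons, List.mem_append, or_false]
        congr 1
        rw [eq_iff_iff]; tauto
    · intro w hw
      rcases List.mem_append.1 hw with hw | hw
      · exact hI.joined w (by simp [hw])
      · obtain ⟨d, hd, hg, rfl⟩ := q7 w hw
        refine (joined_end hd fun e he => ?_).symm.trans hjv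
        rw [hE, Finset.mem_filter, he, ← hsup]
        exact ⟨Finset.mem_univ _, hg⟩
    · rw [hsup₂, h3]
      refine hI.explored.visit hndq.2.1.1 (fun w hw => ⟨(hNseen w hw).1, (hNseen w hw).2.1⟩) ?_
      intro d hd hg
      have hfar := farN_mem (mem_ends.1 hd).1 (mem_ends.1 hd).2.1
      have := q8 d hd hg
      rw [q5] at this
      by_cases hdN : G.farN d ∈ N
      · right; simp [hdN]
      · rw [if_neg hdN, hI.seen _ hfar] at this
        simp only [ne_eq, ite_eq_right_iff, one_ne_zero, imp_false, not_not] at this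
        refine this.imp id fun h => ?_
        rw [List.mem_append]; exact Or.inl h
    · rw [h3, h4, h5, hsyn₁]
      have := hI.forest.visit hvP hrR hvr hjv
      convert this using 2
      exact hsyn a
    · rw [hsup₂, h3]; exact h6
    · intro x hx
      rw [h5, ← hpar x hx]
      split
      · rw [Function.update_of_ne hx]
      · rfl
    · rw [sum_insert_weight hvP]
      simp at h7
      have : 1 ≤ G.weight (a.val + 1) := by simp [weight]
      omega
    · rw [h2, hI.front]; omega
  · rintro s₁ t₁ hfr ⟨P, fin, pend, B₁, hI, hpar, ht⟩ hb
    simp only [Test.Holds, Expr.eval, hI.front, hI.back, List.length_append] at hb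
    obtain rfl : pend = [] := List.length_eq_zero_iff.1 (by omega)
    refine ⟨P, fin, B₁, hI, hpar, ?_⟩
    simp; omega

theorem RootList.push {N : ℕ} {roots mark : ℕ → ℕ} {k r : ℕ} {L : List ℕ}
    (h : RootList N roots mark k L) (hr : r ∈ Finset.Icc 1 N) (hrL : r ∉ L) :
    RootList N (Function.update roots k r) (Function.update mark r 1) (k + 1) (L ++ [r]) := by
  obtain ⟨h1, h2, h3, h4, h5⟩ := h
  refine ⟨h1.push_zero h2 r, by simp [h2], ?_, ?_, ?_⟩
  · rw [List.nodup_append]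
    refine ⟨h3, by simp, ?_⟩
    rintro a ha b hb rfl
    rw [List.mem_singleton] at hb
    exact hrL (hb ▸ ha)
  · intro x hx
    rcases List.mem_append.1 hx with hx | hx
    · exact h4 x hx
    · rw [List.mem_singleton] at hx; rwa [hx]
  · intro v hv
    rw [Function.update_apply]
    split
    · simp [*]
    · rw [h5 v hv]; simp [*]

/-- The state of the initialization when the vertices in `P` have been visited. -/
structure InitInv (G : Lattice) (σ : Finset (Fin G.numV)) (E : Finset (Fin G.numE))
    (P R : Finset ℕ) (B : ℕ → List ℕ) (L : List ℕ) (s : Store) : Prop where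
  le : s.var .r ≤ G.numV + 1
  pos : 1 ≤ s.var .r
  mem : ∀ v ∈ Finset.Icc 1 G.numV, v < s.var .r → v ∈ P
  subset : R ⊆ P
  seen : ∀ w ∈ Finset.Icc 1 G.numV, s.tab .seen w = if w ∈ P then 1 else 0
  explored : ∃ q, Explored G (fun e => s.tab .support e = 2) P [] (s.tab .parent) q
  forest : StarForest σ E P R (s.tab .parent) (s.tab .size) (s.tab .parity)
  lists : StarLists (G.IsBoundary (s.tab .support)) P R (s.tab .parent) (s.tab .bFirst)
    (s.tab .bLast) (s.tab .bNext) B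
  rootList : RootList G.numV (s.tab .roots) (s.tab .mark) (s.var .lenL) L
  mem_rootList : ∀ x, x ∈ L ↔ x ∈ R ∧ s.tab .parity x = 1

theorem wp_initClusters {G : Lattice} {σ : Finset (Fin G.numV)} {W : ℕ} {p : Phase} {s : Store}
    {t : Phase → ℕ} (hB : s.Bounded W) (hW : G.numV + 2 ≤ W) (hG : Incidence G s)
    (hsyn : ∀ v : Fin G.numV, s.tab .syn (v + 1) = 1 ↔ v ∈ σ)
    (h0 : ∀ v ∈ Finset.Icc 1 G.numV, s.tab .seen v = 0 ∧ s.tab .mark v = 0)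
    (hsize : ∀ v ∈ Finset.Icc 1 G.numV, s.tab .size v = 0) :
    Wp W p .initClusters (fun s' t' => ∃ R B L,
      InitInv G σ (Finset.univ.filter fun e => s.tab .support e = 2) (Finset.Icc 1 G.numV) R B L s' ∧
      t' p ≤ t p + 320 * G.numE + 260 * G.numV + 20) s t := by
  set E := Finset.univ.filter fun e : Fin G.numE => s.tab .support e = 2 with hE
  rw [Cmd.initClusters, wp_seq, wp_set, wp_seq, wp_set]
  refine ⟨by simp, by simp; omega, ?_⟩
  have hB1 : ((s.setVar .lenL (Expr.eval s (.lit 0))).setVar .r 1).Bounded W :=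
    (hB.setVar (by simp)).setVar (by omega)
  refine Wp.loop (I := fun s₁ t₁ => ∃ P R B L, InitInv G σ E P R B L s₁ ∧
      t₁ p ≤ t p + 4 + 160 * ∑ w ∈ P, G.weight w + 90 * (s₁.var .r - 1))
    (fun s₁ => G.numV + 1 - s₁.var .r) hB1 ?_ ?_ ?_
  · refine ⟨∅, ∅, fun _ => [], [], ⟨by simp, by simp, ?_, by simp, ?_, ⟨0, by simp [Explored]⟩,
      ⟨by simp, by simp, by simp, by simp, by simp, by simp, ?_, by simp⟩, by simp [StarLists],
      ⟨by simp [Stores], by simp, by simp, by simp, ?_⟩, by simp⟩, by simp⟩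
    · intro v hv hlt
      simp at hv hlt
      omega
    · intro w hw; simpa using (h0 w hw).1
    · intro v hv _; simpa using hsize v hv
    · intro v hv; simpa using (h0 v hv).2
  · rintro s₁ t₁ hfr ⟨P, R, B, L, hI, ht⟩ hb
    have hG₁ : Incidence G s₁ := hG.setVar.setVar.frame hfr rfl
    have hsup : s₁.tab .support = s.tab .support := by rw [hfr.tab _ rfl]; simp
    have hsyn₁ : s₁.tab .syn = s.tab .syn := by rw [hfr.tab _ rfl]; simp
    obtain ⟨r, hr⟩ : ∃ r, s₁.var .r = r := ⟨_, rfl⟩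
    simp only [Test.Holds, Expr.eval, hG₁.numV, hr] at hb
    have hrN : r ∈ Finset.Icc 1 G.numV := by
      have := hI.pos
      rw [hr] at this
      rw [Finset.mem_Icc]; omega
    have hnext : ∀ P : Finset ℕ, (∀ v ∈ Finset.Icc 1 G.numV, v < r → v ∈ P) → r ∈ P →
        ∀ v ∈ Finset.Icc 1 G.numV, v < r + 1 → v ∈ P := by
      intro P hP hrP v hv hlt
      rcases Nat.lt_succ_iff_lt_or_eq.1 hlt with h | h
      · exact hP v hv h
      · rwa [h]
    have hmem := hI.mem
    rw [hr] at hmem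
    rw [wp_seq, wp_ite]
    simp only [Test.Holds, Expr.eval, hr]
    rw [hI.seen r hrN]
    constructor
    · intro hrP
      have hrP : r ∉ P := by simpa using hrP
      have hrR : r ∉ R := fun h => hrP (hI.subset h)
      have hrL : r ∉ L := fun h => hrR ((hI.mem_rootList r).1 h).1
      have hrW : r ≤ W := by rw [← hr]; exact hfr.bounded.var _
      simp only [wp_seq (c := .put _ _ _), wp_seq (c := .set _ _), wp_put, wp_set, Expr.eval,
        Expr.cost, tick_tick, Test.cost]
      refine ⟨by omega, by omega, by omega, by omega, by simpa [hr] using hrW, by omega, by omega,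
        ?_⟩
      set s₂ : Store := Store.setVar _ .back 1 with hs₂
      have hB₂ : s₂.Bounded W := by
        refine ((((((hfr.bounded.setTab ?_).setTab ?_).setTab ?_).setTab ?_).setTab ?_).setVar
          ?_).setVar ?_
        all_goals try omega
        simpa [hr] using hrW
      have hG₂ : Incidence G s₂ := hG₁.setTab.setTab.setTab.setTab.setTab.setVar.setVar
      have e1 : s₂.var .r = r := by simp [hs₂, hr]
      have e2 : s₂.var .front = 0 := by simp [hs₂]
      have e3 : s₂.var .back = 1 := by simp [hs₂]
      have e4 : s₂.tab .seen = Function.update (s₁.tab .seen) r 1 := by simp [hs₂, hr]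
      have e5 : s₂.tab .size = Function.update (s₁.tab .size) r 0 := by simp [hs₂, hr]
      have e6 : s₂.tab .parity = Function.update (s₁.tab .parity) r 0 := by simp [hs₂, hr]
      have e7 : s₂.tab .bFirst = Function.update (s₁.tab .bFirst) r 0 := by simp [hs₂, hr]
      have e8 : s₂.tab .queue 0 = r := by simp [hs₂, hr]
      have e9 : s₂.tab .support = s₁.tab .support := by simp [hs₂]
      have e10 : s₂.tab .syn = s₁.tab .syn := by simp [hs₂]
      have e11 : s₂.tab .parent = s₁.tab .parent := by simp [hs₂]
      have e12 : s₂.tab .bLast = s₁.tab .bLast := by simp [hs₂]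
      have e13 : s₂.tab .bNext = s₁.tab .bNext := by simp [hs₂]
      have e14 : s₂.tab .roots = s₁.tab .roots := by simp [hs₂]
      have e15 : s₂.tab .mark = s₁.tab .mark := by simp [hs₂]
      have e16 : s₂.var .lenL = s₁.var .lenL := by simp [hs₂]
      clear_value s₂
      rw [wp_seq]
      obtain ⟨q, hq⟩ := hI.explored
      refine (wp_exploreCluster (σ := σ) (P₀ := P) (R := insert r R) (B := Function.update B r [])
        (r := r) hB₂ hW hG₂ (by rw [e10, hsyn₁]; exact hsyn) e1 (by simp) ?_ ?_).frame hB₂ ?_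
      · intro v hv
        rw [Finset.mem_insert] at hv
        exact hv.symm.imp (fun h => hI.subset h) id
      · rw [e9, hsup]
        refine ⟨subset_rfl, by simp, by simp [Stores, e8], by simp [e2], by simp [e3], by simp,
          by simpa using hrN, by simp, ?_, ?_, ?_, ?_, ?_⟩
        · intro w hw
          rw [e4, Function.update_apply]
          split
          · simp [*]
          · rw [hI.seen w hw]; simp [*]
        · intro w hw
          rw [List.mem_singleton] at hw
          rw [hw]; exact Joined.refl hrN
        · rw [e9, e11]; exact hq.restart hrP
        · rw [e11]
          exact hI.forest.restart hrN hrP hrR e5 e6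
        · rw [e9, e11, e12, e13]
          exact hI.lists.restart (fun v hv he => hrR (he ▸ hI.forest.par_mem v hv)) e7
      · rintro s₃ t₃ hf₃ ⟨P', fin, B', hC, hpar, ht₃⟩
        rw [e9, hsup, ← hE] at hC
        have hrP' : r ∈ P' := hC.root.resolve_right (by simp)
        have hr₃ : s₃.var .r = r := by rw [hf₃.var _ rfl, e1]
        have hlen₃ : s₃.var .lenL = s₁.var .lenL := by rw [hf₃.var _ rfl, e16]
        have hrl : RootList G.numV (s₃.tab .roots) (s₃.tab .mark) (s₃.var .lenL) L := by
          rw [hf₃.tab _ rfl, hf₃.tab _ rfl, hlen₃, e14, e15]; exact hI.rootList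
        have hLN := hI.rootList.length_le
        have hlenL := hI.rootList.2.1
        have hmemL : ∀ x, x ≠ r → (x ∈ L ↔ x ∈ insert r R ∧ s₃.tab .parity x = 1) := by
          intro x hx
          rw [hI.mem_rootList x, hpar x hx, e6, Function.update_of_ne hx]
          simp [hx]
        have hsub : insert r R ⊆ P' := Finset.insert_subset hrP' (hI.subset.trans hC.subset)
        have hseen : ∀ w ∈ Finset.Icc 1 G.numV, s₃.tab .seen w = if w ∈ P' then 1 else 0 :=
          fun w hw => by simpa using hC.seen w hw
        have hm := hnext P' (fun v hv hlt => hC.subset (hmem v hv hlt)) hrP'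
        have hrN' := Finset.mem_Icc.1 hrN
        have hle : r + 1 ≤ G.numV + 1 := by omega
        have hs := hC.explored
        have hex : ∃ q, Explored G (fun e => s₃.tab .support e = 2) P' [] (s₃.tab .parent) q :=
          ⟨r, hs⟩
        simp at ht₃
        rw [wp_ite]
        simp only [Test.Holds, Expr.eval, hr₃]
        constructor
        · intro hp
          simp only [Cmd.incr, wp_seq (c := .put _ _ _), wp_put, wp_set, Expr.eval, Expr.cost,
            tick_tick, Test.cost]
          refine ⟨by omega, by omega, ?_, ?_, ?_⟩
          · simp [hlen₃]; omega
          · simp [hr₃]; omega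
          · refine ⟨⟨P', insert r R, B', L ++ [r], ⟨by simpa [hr₃] using hle, by simp,
              by simpa [hr₃] using hm, hsub, by simpa using hseen, by simpa using hex,
              by simpa using hC.forest, by simpa using hC.lists, ?_, ?_⟩, ?_⟩, ?_⟩
            · simpa [hr₃] using hrl.push hrN hrL
            · intro x
              by_cases hx : x = r
              · subst hx; simp [hp]
              · simpa [hx] using hmemL x hx
            · simp [hr₃]; omega
            · simp [hr₃]; omega
        · intro hp
          simp only [Cmd.incr, wp_skip, wp_set, Expr.eval, Expr.cost, tick_tick, Test.cost]
          refine ⟨?_, ?_⟩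
          · simp [hr₃]; omega
          · refine ⟨⟨P', insert r R, B', L, ⟨by simpa [hr₃] using hle, by simp,
              by simpa [hr₃] using hm, hsub, by simpa using hseen, by simpa using hex,
              by simpa using hC.forest, by simpa using hC.lists, by simpa using hrl, ?_⟩, ?_⟩, ?_⟩
            · intro x
              by_cases hx : x = r
              · subst hx; simp [hp, hrL]
              · simpa using hmemL x hx
            · simp [hr₃]; omega
            · simp [hr₃]; omega
    · intro hrP
      have hrP : r ∈ P := by simpa using hrP
      have hrN' := Finset.mem_Icc.1 hrN
      have hle : r + 1 ≤ G.numV + 1 := by omega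
      have hm := hnext P hmem hrP
      simp only [Cmd.incr, wp_skip, wp_set, Expr.eval, Expr.cost, tick_tick, Test.cost]
      refine ⟨by omega, ⟨P, R, B, L, ⟨by simpa [hr] using hle, by simp,
        by simpa [hr] using hm, hI.subset, by simpa using hI.seen, by simpa using hI.explored,
        by simpa using hI.forest, by simpa using hI.lists, by simpa using hI.rootList,
        by simpa using hI.mem_rootList⟩, ?_⟩, ?_⟩
      · simp [hr]; omega
      · simp [hr]; omega
  · rintro s₁ t₁ hfr ⟨P, R, B, L, hI, ht⟩ hb
    have hG₁ : Incidence G s₁ := hG.setVar.setVar.frame hfr rfl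
    simp only [Test.Holds, Expr.eval, hG₁.numV] at hb
    have hle := hI.le
    -- The counter has passed all vertices, and every vertex below it has been visited, either as
    -- the start of an exploration or within an earlier one.
    obtain rfl : P = Finset.Icc 1 G.numV := hI.forest.subset.antisymm fun v hv =>
      hI.mem v hv (by rw [Finset.mem_Icc] at hv; omega)
    refine ⟨R, B, L, hI, ?_⟩
    have := sum_weight_le (G := G)
    simp
    omega

/-! ### One round of growth -/

namespace BoundaryLists

variable {N : ℕ} {fst lst nxt ρ : ℕ → ℕ} {B : ℕ → List ℕ} {L : List ℕ} {v : ℕ}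

theorem mem_flatMap_iff (h : BoundaryLists N fst lst nxt ρ B)
    (hL : ∀ r ∈ L, r ∈ Finset.Icc 1 N ∧ ρ r = r) :
    v ∈ L.flatMap B ↔ v ∈ Finset.Icc 1 N ∧ ρ v ∈ L ∧ v ∈ B (ρ v) := by
  rw [List.mem_flatMap]
  constructor
  · rintro ⟨r, hr, hv⟩
    obtain ⟨h1, h2⟩ := (h r (hL r hr).1 (hL r hr).2).2.2.2 v hv
    subst h2
    exact ⟨h1, hr, hv⟩
  · rintro ⟨_, hr, hv⟩
    exact ⟨_, hr, hv⟩

theorem nodup_flatMap (h : BoundaryLists N fst lst nxt ρ B)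
    (hL : ∀ r ∈ L, r ∈ Finset.Icc 1 N ∧ ρ r = r) (hnd : L.Nodup) : (L.flatMap B).Nodup := by
  rw [List.nodup_flatMap]
  refine ⟨fun r hr => (h r (hL r hr).1 (hL r hr).2).2.2.1, ?_⟩
  refine List.Pairwise.imp_of_mem ?_ hnd
  intro a b ha hb hab v hva hvb
  exact hab (((h a (hL a ha).1 (hL a ha).2).2.2.2 v hva).2.symm.trans
    ((h b (hL b hb).1 (hL b hb).2).2.2.2 v hvb).2)

/-- Since the lists are disjoint, the total weight of the lists of `L` is a sum over vertices. In
this form the costs of different root maps can be compared vertex by vertex. -/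
theorem sum_flatMap (h : BoundaryLists N fst lst nxt ρ B)
    (hL : ∀ r ∈ L, r ∈ Finset.Icc 1 N ∧ ρ r = r) (hnd : L.Nodup) (w : ℕ → ℕ) :
    ((L.flatMap B).map w).sum =
      ∑ v ∈ Finset.Icc 1 N, if ρ v ∈ L ∧ v ∈ B (ρ v) then w v else 0 := by
  rw [← List.sum_toFinset _ (h.nodup_flatMap hL hnd), ← Finset.sum_filter]
  congr 1
  ext v
  rw [List.mem_toFinset, h.mem_flatMap_iff hL, Finset.mem_filter]

end BoundaryLists

theorem nodup_flatMap_ends {G : Lattice} {l : List ℕ} (hl : l.Nodup) :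
    (l.flatMap G.ends).Nodup := by
  rw [List.nodup_flatMap]
  refine ⟨fun v _ => nodup_ends v, hl.imp ?_⟩
  intro a b hab d hda hdb
  exact hab ((mem_ends.1 hda).2.2.symm.trans (mem_ends.1 hdb).2.2)

theorem mem_flatMap_ends_iff {G : Lattice} {L : List ℕ} {B : ℕ → List ℕ} {d : ℕ} :
    d ∈ (L.flatMap B).flatMap G.ends ↔ 1 ≤ d ∧ d ≤ 2 * G.numE ∧ G.endN d ∈ L.flatMap B := by
  rw [List.mem_flatMap]
  constructor
  · rintro ⟨v, hv, hd⟩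
    obtain ⟨h1, h2, rfl⟩ := mem_ends.1 hd
    exact ⟨h1, h2, hv⟩
  · rintro ⟨h1, h2, h3⟩
    exact ⟨_, h3, mem_ends.2 ⟨h1, h2, rfl⟩⟩

theorem length_flatMap_ends_le {G : Lattice} (l : List ℕ) :
    (l.flatMap G.ends).length ≤ (l.map G.weight).sum := by
  induction l with
  | nil => simp
  | cons v l ih =>
    have : G.weight v = (G.ends v).length + 1 := rfl
    rw [List.flatMap_cons, List.length_append, List.map_cons, List.sum_cons]
    omega

theorem length_le_sum_weight {G : Lattice} {L : List ℕ} {B : ℕ → List ℕ}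
    (h : ∀ r ∈ L, B r ≠ []) : L.length ≤ ((L.flatMap B).map G.weight).sum := by
  induction L with
  | nil => simp
  | cons r L ih =>
    have ih := ih fun x hx => h x (by simp [hx])
    obtain ⟨v, l, hv⟩ := List.exists_cons_of_ne_nil (h r (by simp))
    simp [hv, weight] at ih ⊢
    omega

/-- A class of the coarser labelling is a disjoint union of classes of the finer one, and a sum of
even numbers is even. So odd clusters arise only from odd clusters. -/
theorem exists_odd_of_odd_synCount {G : Lattice} {σ : Finset (Fin G.numV)} {ρ ρ' : ℕ → ℕ} {r : ℕ}
    (h : Odd (synCount σ ρ' r)) (hρ : ∀ u v, ρ u = ρ v → ρ' u = ρ' v) :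
    ∃ w : Fin G.numV, ρ' (w.val + 1) = r ∧ Odd (synCount σ ρ (ρ (w.val + 1))) := by
  by_contra hc
  push Not at hc
  rw [← Nat.not_even_iff_odd] at h
  refine h ?_
  unfold synCount
  rw [Finset.card_eq_sum_card_image fun w : Fin G.numV => ρ (w.val + 1)]
  refine Finset.even_sum _ fun x hx => ?_
  obtain ⟨w, hw, rfl⟩ := Finset.mem_image.1 hx
  have hw' := (Finset.mem_filter.1 hw).2
  have := hc w hw'
  rw [Nat.not_odd_iff_even, synCount] at this
  rw [Finset.filter_filter]
  rwa [Finset.filter_congr (q := fun u : Fin G.numV => ρ (u.val + 1) = ρ (w.val + 1)) fun u _ => ?_]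
  exact ⟨fun h => h.2, fun h => ⟨(hρ _ _ h).trans hw', h⟩⟩

/-- The weight of all listed vertices. -/
def listedWeight (G : Lattice) (ρ : ℕ → ℕ) (B : ℕ → List ℕ) : ℕ :=
  ∑ v ∈ Finset.Icc 1 G.numV, if v ∈ B (ρ v) then G.weight v else 0

/-- The store represents the growth state `S` with the clusters `ρ`, the boundary lists `B` and the
list `L` of the roots of the odd clusters. -/
structure Represents (G : Lattice) (σ : Finset (Fin G.numV)) (S : Fin G.numE → ℕ) (ρ : ℕ → ℕ)
    (B : ℕ → List ℕ) (L : List ℕ) (s : Store) : Prop where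
  incidence : Incidence G s
  support : ∀ e : Fin G.numE, s.tab .support e = S e
  le_two : ∀ e, S e ≤ 2
  forest : IsForest G.numV (s.tab .parent) (s.tab .size) ρ
  parity : ParityInv σ ρ (s.tab .parity)
  labels : Labels (G.grown S) ρ
  lists : BoundaryLists G.numV (s.tab .bFirst) (s.tab .bLast) (s.tab .bNext) ρ B
  complete : ∀ v ∈ Finset.Icc 1 G.numV, G.IsBoundary (s.tab .support) v → v ∈ B (ρ v)
  clean : ∀ r ∈ L, ∀ v ∈ B r, G.IsBoundary (s.tab .support) v
  rootList : RootList G.numV (s.tab .roots) (s.tab .mark) (s.var .lenL) L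
  mem_rootList : ∀ r, r ∈ L ↔ r ∈ Finset.Icc 1 G.numV ∧ ρ r = r ∧ Odd (synCount σ ρ r)

theorem coe_mem_Icc {n : ℕ} (a : Fin n) : a.val + 1 ∈ Finset.Icc 1 n := by
  have := a.isLt
  simp

namespace Represents

variable {G : Lattice} {σ : Finset (Fin G.numV)} {S : Fin G.numE → ℕ} {ρ : ℕ → ℕ}
  {B : ℕ → List ℕ} {L : List ℕ} {s : Store}

theorem root (h : Represents G σ S ρ B L s) {r : ℕ} (hr : r ∈ L) :
    r ∈ Finset.Icc 1 G.numV ∧ ρ r = r :=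
  ⟨((h.mem_rootList r).1 hr).1, ((h.mem_rootList r).1 hr).2.1⟩

theorem inOddCluster_iff (h : Represents G σ S ρ B L s) (a : Fin G.numV) :
    G.InOddCluster σ S a ↔ ρ (a + 1) ∈ L := by
  have ha := coe_mem_Icc a
  rw [h.labels.inOddCluster_iff, h.mem_rootList]
  exact ⟨fun ho => ⟨h.forest.root_mem _ ha, h.forest.root_root ha, ho⟩, fun ho => ho.2.2⟩

theorem le_support (h : Represents G σ S ρ B L s) {e : ℕ} (he : e < G.numE) :
    s.tab .support e ≤ 2 := by
  rw [h.support ⟨e, he⟩]; exact h.le_two _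

theorem isBoundary (h : Represents G σ S ρ B L s) {e : Fin G.numE} (he : S e ≠ 2) :
    G.IsBoundary (s.tab .support) (G.src e + 1) ∧ G.IsBoundary (s.tab .support) (G.dst e + 1) := by
  have := e.isLt
  rw [← h.support e] at he
  exact ⟨⟨2 * e + 1, mem_ends.2 ⟨by omega, by omega, by rw [endN_odd, srcN_coe]⟩, by simpa using he⟩,
    ⟨2 * e + 2, mem_ends.2 ⟨by omega, by omega, by rw [endN_even, dstN_coe]⟩, by simpa using he⟩⟩

/-- If the list is empty, completeness leaves no boundary vertex in the cluster, so every edge with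
one end in it is grown and has both ends in it. The handshake lemma then makes its part of the
syndrome even. This is the only place in the growth where the syndrome must come from an actual
error. -/
theorem list_ne_nil {E : Finset (Fin G.numE)} (h : Represents G (G.syndrome E) S ρ B L s) {r : ℕ}
    (hr : r ∈ L) : B r ≠ [] := by
  intro hnil
  obtain ⟨_, _, hodd⟩ := (h.mem_rootList r).1 hr
  have hb : ∀ a : Fin G.numV, ρ (a + 1) = r → ¬ G.IsBoundary (s.tab .support) (a + 1) := by
    intro a ha hb
    have := h.complete _ (coe_mem_Icc a) hb
    rw [ha, hnil] at this
    simp at this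
  rw [← Nat.not_even_iff_odd] at hodd
  refine hodd (even_card_syndrome_filter E (fun w => ρ (w.val + 1) = r) fun e _ => ?_)
  by_cases he : S e = 2
  · have := (h.labels _ _).1 (connected_edge (A := G.grown S) (by simpa [grown] using he))
    rw [this]
  · exact ⟨fun hs => absurd (h.isBoundary he).1 (hb _ hs),
      fun hd => absurd (h.isBoundary he).2 (hb _ hd)⟩

/-- A grown edge is capped on both sides. If the edge is not grown, its endpoints are boundary
vertices, hence they are on the lists of their clusters, and an end is counted exactly if that
cluster is odd. -/
theorem growRound_eq (h : Represents G σ S ρ B L s) (e : Fin G.numE) :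
    G.growRound σ S e = min 2 (S e + endCount e ((L.flatMap B).flatMap G.ends)) := by
  have hlt := e.isLt
  have hle := h.le_two e
  by_cases he : S e = 2
  · simp [growRound, he, add_assoc]
  have hnd := nodup_flatMap_ends (G := G)
    (h.lists.nodup_flatMap (fun r hr => h.root hr) h.rootList.2.2.1)
  rw [endCount_of_nodup hnd fun d hd => (mem_flatMap_ends_iff.1 hd).1]
  obtain ⟨hs, hd⟩ := h.isBoundary he
  have key : ∀ a : Fin G.numV, G.IsBoundary (s.tab .support) (a + 1) →
      (G.InOddCluster σ S a ↔ a.val + 1 ∈ L.flatMap B) := by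
    intro a ha
    rw [h.inOddCluster_iff, h.lists.mem_flatMap_iff fun r hr => h.root hr]
    exact ⟨fun hL => ⟨coe_mem_Icc a, hL, h.complete _ (coe_mem_Icc a) ha⟩, fun hL => hL.2.1⟩
  have k1 : 2 * e.val + 1 ∈ (L.flatMap B).flatMap G.ends ↔ G.InOddCluster σ S (G.src e) := by
    rw [key _ hs, mem_flatMap_ends_iff, endN_odd, srcN_coe]
    exact ⟨fun hh => hh.2.2, fun hh => ⟨by omega, by omega, hh⟩⟩
  have k2 : 2 * e.val + 2 ∈ (L.flatMap B).flatMap G.ends ↔ G.InOddCluster σ S (G.dst e) := by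
    rw [key _ hd, mem_flatMap_ends_iff, endN_even, dstN_coe]
    exact ⟨fun hh => hh.2.2, fun hh => ⟨by omega, by omega, hh⟩⟩
  rw [growRound, add_assoc]
  by_cases c1 : G.InOddCluster σ S (G.src e) <;> by_cases c2 : G.InOddCluster σ S (G.dst e) <;>
    simp [k1, k2, c1, c2]

end Represents

/-- The cost of a round: the weight of the vertices that grow. -/
def roundWeight (G : Lattice) (B : ℕ → List ℕ) (L : List ℕ) : ℕ :=
  ((L.flatMap B).map G.weight).sum

/-- All costs are expressed by the weight T of the vertices that grow, because 1, the number of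
roots and the number of fusion edges are all at most T. Adding the constants of the blocks gives 310
for the growth, (54A + 108) + (18A + 29) for Find and Union, and 130 for the list operations apart
from the inspected vertices. -/
theorem wp_growthRound {G : Lattice} {E : Finset (Fin G.numE)} {W A : ℕ} {p : Phase} {s : Store}
    {t : Phase → ℕ} {S : Fin G.numE → ℕ} {ρ : ℕ → ℕ} {B : ℕ → List ℕ} {L : List ℕ}
    (hB : s.Bounded W) (hW : G.numV + 2 ≤ W) (hW' : G.numE + 2 ≤ W)
    (hA : Nat.log 2 G.numV < hierarchy A 1)
    (h : Represents G (G.syndrome E) S ρ B L s) (hL : L ≠ []) :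
    Wp W p .growthRound (fun s' t' => ∃ ρ' B' L',
      Represents G (G.syndrome E) (G.growRound (G.syndrome E) S) ρ' B' L' s' ∧
      1 ≤ roundWeight G B L ∧
      G.growthPotential (s'.tab .support) + roundWeight G B L ≤
        G.growthPotential (s.tab .support) ∧
      t' .growth ≤ t .growth + 310 * roundWeight G B L ∧
      t' .unionFind + 18 * totalPotential A G.numV (s'.tab .parent) (s'.tab .size) ≤
        t .unionFind + 18 * totalPotential A G.numV (s.tab .parent) (s.tab .size) +
          (72 * A + 137) * roundWeight G B L ∧
      t' .boundaryLists + 100 * listedWeight G ρ' B' ≤ t .boundaryLists +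
        100 * listedWeight G ρ B + 130 * roundWeight G B L + 100 * roundWeight G B' L') s t := by
  set σ := G.syndrome E with hσ
  have hroot := fun r hr => h.root (r := r) hr
  have hndL := h.rootList.2.2.1
  have hnd := h.lists.nodup_flatMap hroot hndL
  have hLT : L.length ≤ roundWeight G B L := length_le_sum_weight fun r hr => h.list_ne_nil hr
  have hT : 1 ≤ roundWeight G B L := le_trans (List.length_pos_iff.2 hL) hLT
  obtain ⟨T, hTdef⟩ : ∃ T, roundWeight G B L = T := ⟨_, rfl⟩
  rw [Cmd.growthRound, wp_seq]
  refine (wp_growClusters (L := L) (B := B) hB hW' h.incidence (fun e he => h.le_support he)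
    h.rootList.1 h.rootList.2.1 (fun r hr => (h.lists r (hroot r hr).1 (hroot r hr).2).1)
    (fun r hr v hv => ((h.lists r (hroot r hr).1 (hroot r hr).2).2.2.2 v hv).1)).frame hB ?_
  rintro s₁ t₁ hf₁ ⟨⟨g1, F, g2, g3, g4, g5⟩, gt₁⟩
  change t₁ .growth ≤ t .growth + 10 + 20 * L.length + 40 * roundWeight G B L at gt₁
  have hG₁ : Incidence G s₁ := h.incidence.frame hf₁ rfl
  -- A fusion edge became grown in this round, so one of its ends was among those that grew;
  -- distinct edges have distinct ends.
  have hFT : F.length ≤ T := by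
    have hsub : F ⊆ ((L.flatMap B).flatMap G.ends).map edgeN := by
      intro e he
      obtain ⟨h1, h2, h3⟩ := (g5 e).1 he
      have hpos : 0 < endCount e ((L.flatMap B).flatMap G.ends) := by omega
      obtain ⟨d, hd, hde⟩ := List.countP_pos_iff.1 hpos
      exact List.mem_map.2 ⟨d, hd, by simpa using hde⟩
    have := (List.subperm_of_subset g4 hsub).length_le
    rw [List.length_map] at this
    exact hTdef ▸ this.trans (length_flatMap_ends_le _)
  have hsup : ∀ e : Fin G.numE, s₁.tab .support e = G.growRound σ S e := fun e => by
    rw [g1 e e.isLt, h.growRound_eq, h.support]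
  rw [wp_seq]
  refine (wp_fuseClusters (σ := σ) (A := A) (ρ := ρ) (F := F) (E := G.grown S) hf₁.bounded hW hG₁
    (by rw [hf₁.tab _ rfl, hf₁.tab _ rfl]; exact h.forest)
    (by rw [hf₁.tab _ rfl]; exact h.parity) h.labels hA g2 g3
    (fun e he => ((g5 e).1 he).1)).frame hf₁.bounded ?_
  rintro s₂ t₂ hf₂ ⟨l, k1, k2, k3, k4, k5, k6, k7, k8, kt₂, ku₂⟩
  rw [hf₁.tab .parent rfl, hf₁.tab .size rfl, hf₁.time .unionFind rfl] at ku₂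
  have hG₂ : Incidence G s₂ := hG₁.frame hf₂ rfl
  have hgrown : G.grown S ∪ Finset.univ.filter (fun e => e.val ∈ F) =
      G.grown (G.growRound σ S) := by
    ext e
    have := h.le_two e
    simp only [grown, Finset.mem_union, Finset.mem_filter, Finset.mem_univ, true_and, g5 e.val,
      h.support, h.growRound_eq e]
    have := e.isLt
    omega
  rw [hgrown] at k5
  have hlists₂ : BoundaryLists G.numV (s₂.tab .bFirst) (s₂.tab .bLast) (s₂.tab .bNext) ρ B := by
    rw [hf₂.tab _ rfl, hf₂.tab _ rfl, hf₂.tab _ rfl, hf₁.tab _ rfl, hf₁.tab _ rfl, hf₁.tab _ rfl]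
    exact h.lists
  have hlW : l.length + 1 ≤ W := by
    have h1 : F.length ≤ G.numE := by
      have : F.toFinset ⊆ Finset.range G.numE := fun e he => by
        simpa using ((g5 e).1 (List.mem_toFinset.1 he)).1
      have := Finset.card_le_card this
      rwa [List.toFinset_card_of_nodup g4, Finset.card_range] at this
    omega
  rw [wp_seq]
  refine (wp_fuseBoundaryLists (ρ := ρ) (l := l) (B := B) hf₂.bounded hlW hlists₂ k1 k6 k7 k8).frame
    hf₂.bounded ?_
  rintro s₃ t₃ hf₃ ⟨B₁, m1, m2, mt₃⟩
  rw [hf₂.time .boundaryLists rfl, hf₁.time .boundaryLists rfl] at mt₃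
  have hG₃ : Incidence G s₃ := hG₂.frame hf₃ rfl
  set ρ' := mergeAll ρ l with hρ'
  have hforest₃ : IsForest G.numV (s₃.tab .parent) (s₃.tab .size) ρ' := by
    rw [hf₃.tab _ rfl, hf₃.tab _ rfl]; exact k3
  rw [wp_seq]
  refine (wp_updateRoots (N := G.numV) (A := A) (ρ := ρ') (L := L) hf₃.bounded hW hforest₃ hA
    ?_).frame hf₃.bounded ?_
  · rw [hf₃.tab _ rfl, hf₃.tab _ rfl, hf₃.var _ rfl, hf₂.tab _ rfl, hf₂.tab _ rfl, hf₂.var _ rfl,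
      hf₁.tab _ rfl, hf₁.tab _ rfl, hf₁.var _ rfl]
    exact h.rootList
  rintro s₄ t₄ hf₄ ⟨L₁, n1, n2, n3, n4, nt₄, nu₄⟩
  rw [hf₃.time .growth rfl] at nt₄
  rw [hf₃.time .unionFind rfl, hf₃.tab .parent rfl, hf₃.tab .size rfl] at nu₄
  have hG₄ : Incidence G s₄ := hG₃.frame hf₄ rfl
  have hL₁ : ∀ r ∈ L₁, r ∈ Finset.Icc 1 G.numV ∧ ρ' r = r := by
    intro r hr
    obtain ⟨u, hu, rfl⟩ := (n2 r).1 hr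
    exact ⟨k3.root_mem u (hroot u hu).1, k3.root_root (hroot u hu).1⟩
  have hpar₄ : s₄.tab .parity = s₂.tab .parity := by rw [hf₄.tab _ rfl, hf₃.tab _ rfl]
  have hsup₄ : s₄.tab .support = s₁.tab .support := by
    rw [hf₄.tab _ rfl, hf₃.tab _ rfl, hf₂.tab _ rfl]
  rw [wp_seq]
  refine (wp_updateBoundaryLists (ρ := ρ') (L := L₁) (B := B₁) hf₄.bounded hW hG₄
    (by rw [hf₄.tab _ rfl, hf₄.tab _ rfl, hf₄.tab _ rfl]; exact m1) n1
    (fun r hr => (hL₁ r hr).2)).frame hf₄.bounded ?_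
  rintro s₅ t₅ hf₅ ⟨q1, qt₅⟩
  rw [hpar₄, hsup₄] at q1
  rw [hpar₄, hf₄.time .boundaryLists rfl] at qt₅
  have hG₅ : Incidence G s₅ := hG₄.frame hf₅ rfl
  refine (wp_removeEvenRoots (N := G.numV) (L := L₁) hf₅.bounded hW
    (by rw [hf₅.tab _ rfl, hf₅.tab _ rfl, hf₅.var _ rfl]; exact n1)).frame hf₅.bounded ?_
  rintro s₆ t₆ hf₆ ⟨x1, xt₆⟩
  rw [hf₅.tab .parity rfl, hpar₄] at x1
  rw [hf₅.time .growth rfl] at xt₆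
  have hG₆ : Incidence G s₆ := hG₅.frame hf₆ rfl
  set bd : ℕ → Prop := G.IsBoundary (s₁.tab .support) with hbd
  set B₂ : ℕ → List ℕ := fun r => if r ∈ L₁ ∧ s₂.tab .parity r = 1
          then (B₁ r).filter fun v => G.IsBoundary (s₁.tab .support) v else B₁ r with hB₂
  set L₂ := L₁.filter fun r => s₂.tab .parity r = 1 with hL₂
  have hmono : ∀ e < G.numE, s.tab .support e ≤ s₁.tab .support e := fun e he => by
    rw [g1 e he]
    have := h.le_support he
    omega
  -- Grown edges stay grown, so a boundary vertex was one before. No vertex ever has to be added to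
  -- a list, and outdated lists of even clusters remain complete.
  have hbd_mono : ∀ v ∈ Finset.Icc 1 G.numV, bd v → G.IsBoundary (s.tab .support) v := by
    rintro v _ ⟨d, hd, hne⟩
    refine ⟨d, hd, fun he => hne ?_⟩
    obtain ⟨h1, h2, _⟩ := mem_ends.1 hd
    rw [g1 _ (edgeN_lt h1 h2), he]
    omega
  have hsup₆ : s₆.tab .support = s₁.tab .support := by
    rw [hf₆.tab _ rfl, hf₅.tab _ rfl, hsup₄]
  have hmemL₂ : ∀ r, r ∈ L₂ ↔ r ∈ L₁ ∧ s₂.tab .parity r = 1 := fun r => by simp [hL₂]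
  have hL₂' : ∀ r ∈ L₂, r ∈ Finset.Icc 1 G.numV ∧ ρ' r = r :=
    fun r hr => hL₁ r ((hmemL₂ r).1 hr).1
  have hforest₆ : IsForest G.numV (s₆.tab .parent) (s₆.tab .size) ρ' := by
    rw [hf₆.tab _ rfl, hf₆.tab _ rfl, hf₅.tab _ rfl, hf₅.tab _ rfl, hf₄.tab .size rfl]
    exact n4
  have hlists₆ : BoundaryLists G.numV (s₆.tab .bFirst) (s₆.tab .bLast) (s₆.tab .bNext) ρ' B₂ := by
    rw [hf₆.tab _ rfl, hf₆.tab _ rfl, hf₆.tab _ rfl]; exact q1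
  have hpar6 : s₆.tab .parity = s₂.tab .parity := by rw [hf₆.tab _ rfl, hf₅.tab _ rfl, hpar₄]
  have hodd : ∀ r ∈ Finset.Icc 1 G.numV, ρ' r = r →
      (s₂.tab .parity r = 1 ↔ Odd (synCount σ ρ' r)) := fun r hr hrr => by
    rw [k4 r hr hrr, Nat.odd_iff]
  have hB₂mem : ∀ v r, v ∈ B₂ r ↔ v ∈ B₁ r ∧ (r ∈ L₂ → bd v) := by
    intro v r
    rw [hB₂, hmemL₂]
    dsimp only
    split
    · rw [List.mem_filter, decide_eq_true_iff]
      exact ⟨fun x => ⟨x.1, fun _ => x.2⟩, fun x => ⟨x.1, x.2 ‹_›⟩⟩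
    · exact ⟨fun x => ⟨x, fun y => absurd y ‹_›⟩, And.left⟩
  refine ⟨ρ', B₂, L₂, ⟨hG₆, ?_, fun e => min_le_left _ _, hforest₆, by rw [hpar6]; exact k4, k5,
    hlists₆, ?_, ?_, x1, ?_⟩, hT, ?_, ?_, ?_, ?_⟩
  · intro e; rw [hsup₆, hsup]
  · intro v hv hb
    rw [hsup₆] at hb
    rw [hB₂mem, m2]
    exact ⟨h.complete v hv (hbd_mono v hv hb), fun _ => hb⟩
  · intro r hr v hv
    rw [hsup₆]
    exact ((hB₂mem v r).1 hv).2 hr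
  · intro r
    constructor
    · intro hr
      have h1 := hL₂' r hr
      exact ⟨h1.1, h1.2, (hodd r h1.1 h1.2).1 ((hmemL₂ r).1 hr).2⟩
    · rintro ⟨h1, h2, h3⟩
      refine (hmemL₂ r).2 ⟨(n2 r).2 ?_, (hodd r h1 h2).2 h3⟩
      -- An odd root now comes from a cluster that was odd before the round, whose root was in `L`;
      -- its image under the new root map is the given root.
      obtain ⟨w, hw, hw'⟩ := exists_odd_of_odd_synCount h3 fun u v huv => mergeAll_congr huv l
      have hwN := coe_mem_Icc w
      refine ⟨ρ (w + 1), (h.mem_rootList _).2 ⟨h.forest.root_mem _ hwN,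
        h.forest.root_root hwN, hw'⟩, ?_⟩
      rw [← hw]
      exact mergeAll_congr (h.forest.root_root hwN) l
  · rw [hsup₆]
    refine growthPotential_grow hnd ?_ ?_ (fun e he => h.le_support he) hmono ?_
    · exact fun v hv => ((h.lists.mem_flatMap_iff hroot).1 hv).1
    · intro v hv
      obtain ⟨r, hr, hv⟩ := List.mem_flatMap.1 hv
      exact h.clean r hr v hv
    · intro v hv d hd
      obtain ⟨h1, h2, _⟩ := mem_ends.1 hd
      rw [g1 _ (edgeN_lt h1 h2)]
      have : 0 < endCount (edgeN d) ((L.flatMap B).flatMap G.ends) :=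
        List.countP_pos_iff.2 ⟨d, List.mem_flatMap.2 ⟨v, hv, hd⟩, by simp⟩
      omega
  · omega
  · rw [hf₆.time .unionFind rfl, hf₅.time .unionFind rfl, hf₆.tab .parent rfl, hf₆.tab .size rfl,
      hf₅.tab .parent rfl, hf₅.tab .size rfl, hf₄.tab .size rfl, hf₃.tab .size rfl]
    have e1 : (54 * A + 108) * F.length ≤ (54 * A + 108) * T := Nat.mul_le_mul_left _ hFT
    have e2 : (18 * A + 29) * L.length ≤ (18 * A + 29) * T :=
      Nat.mul_le_mul_left _ (hTdef ▸ hLT)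
    have e3 : (72 * A + 137) * T = (54 * A + 108) * T + (18 * A + 29) * T := by ring
    rw [hTdef, e3]
    omega
  · rw [hf₆.time .boundaryLists rfl]
    -- Vertex by vertex: a vertex inspected on the list of an odd root either is dropped and leaves
    -- the listed weight, or is kept and belongs to the vertices that grow in the next round.
    have key : ((L₂.flatMap B₁).map G.weight).sum + listedWeight G ρ' B₂ ≤
        listedWeight G ρ B + roundWeight G B₂ L₂ := by
      rw [roundWeight, m1.sum_flatMap hL₂' (n1.2.2.1.filter _),
        hlists₆.sum_flatMap hL₂' (n1.2.2.1.filter _), listedWeight, listedWeight,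
        ← Finset.sum_add_distrib, ← Finset.sum_add_distrib]
      refine Finset.sum_le_sum fun v _ => ?_
      simp only [hB₂mem, m2]
      by_cases c1 : v ∈ B (ρ v) <;> by_cases c2 : ρ' v ∈ L₂ <;> by_cases c3 : bd v <;>
        simp [c1, c2, c3]
    omega

/-! ### Syndrome validation -/

theorem InitInv.represents {G : Lattice} {σ : Finset (Fin G.numV)} {S : Fin G.numE → ℕ}
    {R : Finset ℕ} {B : ℕ → List ℕ} {L : List ℕ} {s : Store}
    (h : InitInv G σ (G.grown S) (Finset.Icc 1 G.numV) R B L s) (hG : Incidence G s)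
    (hS : ∀ e : Fin G.numE, s.tab .support e = S e) (hS2 : ∀ e, S e ≤ 2) :
    Represents G σ S (s.tab .parent) B L s where
  incidence := hG
  support := hS
  le_two := hS2
  forest := h.forest.isForest
  parity := h.forest.parityInv
  labels := by
    obtain ⟨q, hq⟩ := h.explored
    exact labels_of_joined h.forest.joined fun e he =>
      hq.edge_eq (by rw [hS]; simpa [grown] using he)
  lists r hr hrr := by
    obtain ⟨h1, h2, h3, h4⟩ := h.lists r (hrr ▸ h.forest.par_mem r hr)
    exact ⟨h1, h2, h3, fun v hv => ⟨((h4 v).1 hv).1, ((h4 v).1 hv).2.1⟩⟩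
  complete v hv hb := ((h.lists _ (h.forest.par_mem v hv)).2.2.2 v).2 ⟨hv, rfl, hb⟩
  clean r hr v hv := (((h.lists r ((h.mem_rootList r).1 hr).1).2.2.2 v).1 hv).2.2
  rootList := h.rootList
  mem_rootList r := by
    rw [h.mem_rootList]
    constructor
    · rintro ⟨hr, hp⟩
      have hrN := h.forest.roots_subset hr
      have hrr := h.forest.par_root r hrN hr
      refine ⟨hrN, hrr, ?_⟩
      rw [Nat.odd_iff, ← h.forest.parityInv r hrN hrr, hp]
    · rintro ⟨hr, hrr, ho⟩
      refine ⟨hrr ▸ h.forest.par_mem r hr, ?_⟩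
      rw [h.forest.parityInv r hr hrr, ← Nat.odd_iff]
      exact ho

/-- The potential of a vertex is at most A times its rank, and the rank is at most the stored size.
The sizes add up to at most |V|, because each vertex is counted in one tree and non-roots have size
0. -/
theorem StarForest.totalPotential_le {G : Lattice} {σ : Finset (Fin G.numV)}
    {E : Finset (Fin G.numE)} {R : Finset ℕ} {par size parity : ℕ → ℕ}
    (h : StarForest σ E (Finset.Icc 1 G.numV) R par size parity) (A : ℕ) :
    totalPotential A G.numV par size ≤ A * G.numV := by
  have h1 : ∀ v ∈ Finset.Icc 1 G.numV,
      size v ≤ ((Finset.Icc 1 G.numV).filter fun w => par w = v).card := by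
    intro v hv
    by_cases hR : v ∈ R
    · rw [h.size_root v hR]
    · rw [h.size_eq_zero v hv hR]; omega
  have h2 : ∑ v ∈ Finset.Icc 1 G.numV, size v ≤ G.numV := by
    refine (Finset.sum_le_sum h1).trans ?_
    rw [← Finset.card_eq_sum_card_fiberwise fun v hv => h.roots_subset (h.par_mem v hv)]
    simp
  calc _ ≤ ∑ v ∈ Finset.Icc 1 G.numV, A * size v := Finset.sum_le_sum fun v _ =>
        (potential_le _ _ _).trans (Nat.mul_le_mul_left _ (Nat.log_le_self _ _))
    _ ≤ _ := by rw [← Finset.mul_sum]; exact Nat.mul_le_mul_left _ h2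

theorem listedWeight_le {G : Lattice} (ρ : ℕ → ℕ) (B : ℕ → List ℕ) :
    listedWeight G ρ B ≤ 2 * G.numE + G.numV :=
  (Finset.sum_le_sum fun v _ => by split <;> simp).trans sum_weight_le

/-- The bounds of the rounds telescope against `growthPotential`, which also decreases strictly and
so proves termination. The invariant for the boundary lists carries a debt of 100 times the weight
of the vertices about to grow: they were kept in the last cleaning and are paid for when they grow,
whence 230 = 130 + 100. At the exit `roots` is empty and the debt is zero. In 313 = 310 + 3 the 3 is
the loop test. -/
theorem wp_growthLoop {G : Lattice} {E : Finset (Fin G.numE)} {W A : ℕ} {s : Store}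
    {t : Phase → ℕ} {S : Fin G.numE → ℕ} {ρ : ℕ → ℕ} {B : ℕ → List ℕ} {L : List ℕ}
    (hB : s.Bounded W) (hW : G.numV + 2 ≤ W) (hW' : G.numE + 2 ≤ W)
    (hA : Nat.log 2 G.numV < hierarchy A 1) (h : Represents G (G.syndrome E) S ρ B L s) :
    Wp W .growth (.loop (.ne (.var .lenL) (.lit 0)) .growthRound) (fun s' t' => ∃ k ρ' B',
      Represents G (G.syndrome E) ((G.growRound (G.syndrome E))^[k] S) ρ' B' [] s' ∧
      t' .growth ≤ t .growth + 313 * G.growthPotential (s.tab .support) + 3 ∧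
      t' .unionFind ≤ t .unionFind +
        18 * totalPotential A G.numV (s.tab .parent) (s.tab .size) +
          (72 * A + 137) * G.growthPotential (s.tab .support) ∧
      t' .boundaryLists ≤ t .boundaryLists + 100 * listedWeight G ρ B +
        230 * G.growthPotential (s.tab .support)) s t := by
  refine Wp.loop (I := fun s₁ t₁ => ∃ k ρ' B' L',
      Represents G (G.syndrome E) ((G.growRound (G.syndrome E))^[k] S) ρ' B' L' s₁ ∧
      t₁ .growth + 313 * G.growthPotential (s₁.tab .support) ≤
        t .growth + 313 * G.growthPotential (s.tab .support) ∧
      t₁ .unionFind + 18 * totalPotential A G.numV (s₁.tab .parent) (s₁.tab .size) +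
          (72 * A + 137) * G.growthPotential (s₁.tab .support) ≤ t .unionFind +
        18 * totalPotential A G.numV (s.tab .parent) (s.tab .size) +
          (72 * A + 137) * G.growthPotential (s.tab .support) ∧
      t₁ .boundaryLists + 100 * listedWeight G ρ' B' +
          230 * G.growthPotential (s₁.tab .support) ≤
        t .boundaryLists + 100 * listedWeight G ρ B +
          230 * G.growthPotential (s.tab .support) + 100 * roundWeight G B' L')
    (fun s₁ => G.growthPotential (s₁.tab .support)) hB ?_ ?_ ?_
  · exact ⟨0, ρ, B, L, h, le_rfl, le_rfl, by omega⟩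
  · rintro s₁ t₁ hfr ⟨k, ρ₁, B₁, L₁, h₁, h2, h3, h4⟩ hb
    have hL₁ : L₁ ≠ [] := by
      rintro rfl
      have := h₁.rootList.2.1
      simp [this] at hb
    refine (wp_growthRound hfr.bounded hW hW' hA h₁ hL₁).mono ?_
    rintro s₂ t₂ ⟨ρ₂, B₂, L₂, g1, g2, g3, g4, g5, g6⟩
    simp at g4 g5 g6
    refine ⟨⟨k + 1, ρ₂, B₂, L₂, ?_, by omega, ?_, by omega⟩, by omega⟩
    · rw [Function.iterate_succ_apply']; exact g1
    · have := Nat.mul_le_mul_left (72 * A + 137) g3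
      rw [Nat.mul_add] at this
      omega
  · rintro s₁ t₁ hfr ⟨k, ρ₁, B₁, L₁, h₁, h2, h3, h4⟩ hb
    obtain rfl : L₁ = [] := by
      have := h₁.rootList.2.1
      simp [this] at hb
      exact hb
    refine ⟨k, ρ₁, B₁, h₁, ?_, ?_, ?_⟩
    · simp; omega
    · simp; omega
    · simp [roundWeight] at h4 ⊢; omega

/-! ### The spanning forest -/

/-- `l` lists the vertices of a rooted forest, children before their parents. The tables `tp` and
`te` contain the parents (`0` for a root) and the edges to the parents, and the labels `lab` are
the roots. Only edges with `g` occur. -/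
def TreeOrder (G : Lattice) (g : ℕ → Prop) (tp te lab : ℕ → ℕ) : List ℕ → Prop
  | [] => True
  | v :: l => TreeOrder G g tp te lab l ∧ v ∉ l ∧ v ∈ Finset.Icc 1 G.numV ∧
      ((tp v = 0 ∧ lab v = v) ∨ (tp v ∈ l ∧ lab v = lab (tp v) ∧
        ∃ d ∈ G.ends (tp v), g (edgeN d) ∧ G.farN d = v ∧ te v = edgeN d))

/-- The edges of the forest. -/
def treeEdges (G : Lattice) (tp te : ℕ → ℕ) (l : List ℕ) : Finset (Fin G.numE) :=
  Finset.univ.filter fun e => ∃ v ∈ l, tp v ≠ 0 ∧ te v = e.val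

theorem mem_treeEdges {G : Lattice} {tp te : ℕ → ℕ} {l : List ℕ} {e : Fin G.numE} :
    e ∈ treeEdges G tp te l ↔ ∃ v ∈ l, tp v ≠ 0 ∧ te v = e.val := by
  simp [treeEdges]

theorem ends_edge {G : Lattice} {d v : ℕ} (hd : d ∈ G.ends v) :
    ∃ e : Fin G.numE, e.val = edgeN d ∧
      ((G.src e + 1 = v ∧ G.dst e + 1 = G.farN d) ∨ (G.dst e + 1 = v ∧ G.src e + 1 = G.farN d)) := by
  obtain ⟨h1, h2, rfl⟩ := mem_ends.1 hd
  refine ⟨⟨edgeN d, edgeN_lt h1 h2⟩, rfl, ?_⟩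
  rw [← srcN_coe, ← dstN_coe]
  unfold endN farN
  split <;> simp

namespace TreeOrder

variable {G : Lattice} {g : ℕ → Prop} {tp te lab tp' te' lab' : ℕ → ℕ} {l : List ℕ} {v : ℕ}

theorem congr (h : TreeOrder G g tp te lab l)
    (hl : ∀ v ∈ l, tp' v = tp v ∧ te' v = te v ∧ lab' v = lab v) :
    TreeOrder G g tp' te' lab' l := by
  induction l with
  | nil => trivial
  | cons v l ih =>
    obtain ⟨h1, h2, h3, h4⟩ := h
    obtain ⟨e1, e2, e3⟩ := hl v (by simp)
    refine ⟨ih h1 fun w hw => hl w (by simp [hw]), h2, h3, ?_⟩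
    rw [e1, e2, e3]
    refine h4.imp id fun h => ⟨h.1, ?_, h.2.2⟩
    rw [(hl _ (List.mem_cons_of_mem _ h.1)).2.2]
    exact h.2.1

theorem append {new : List ℕ} (h : TreeOrder G g tp te lab l) (hv : v ∈ l)
    (hnd : (new ++ l).Nodup) (hN : ∀ w ∈ new, w ∈ Finset.Icc 1 G.numV ∧ tp w = v ∧ lab w = lab v ∧
      ∃ d ∈ G.ends v, g (edgeN d) ∧ G.farN d = w ∧ te w = edgeN d) :
    TreeOrder G g tp te lab (new ++ l) := by
  induction new with
  | nil => exact h
  | cons w new ih =>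
    rw [List.cons_append, List.nodup_cons] at hnd
    obtain ⟨h1, h2, h3, h4⟩ := hN w (by simp)
    refine ⟨ih hnd.2 fun x hx => hN x (by simp [hx]), hnd.1, h1, Or.inr ?_⟩
    rw [h2]
    exact ⟨by simp [hv], h3, h4⟩

theorem nodup (h : TreeOrder G g tp te lab l) : l.Nodup := by
  induction l with
  | nil => simp
  | cons v l ih => exact List.nodup_cons.2 ⟨h.2.1, ih h.1⟩

theorem suffix {l' : List ℕ} (h : TreeOrder G g tp te lab (l' ++ l)) :
    TreeOrder G g tp te lab l := by
  induction l' with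
  | nil => exact h
  | cons v l' ih => exact ih h.1

theorem mem_Icc (h : TreeOrder G g tp te lab l) (hv : v ∈ l) : v ∈ Finset.Icc 1 G.numV := by
  induction l with
  | nil => simp at hv
  | cons w l ih =>
    rcases List.mem_cons.1 hv with rfl | hv
    exacts [h.2.2.1, ih h.1 hv]

theorem parent (h : TreeOrder G g tp te lab l) (hv : v ∈ l) (h0 : tp v ≠ 0) :
    tp v ∈ l ∧ lab v = lab (tp v) ∧
      ∃ d ∈ G.ends (tp v), g (edgeN d) ∧ G.farN d = v ∧ te v = edgeN d := by
  induction l with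
  | nil => simp at hv
  | cons w l ih =>
    rcases List.mem_cons.1 hv with rfl | hv
    · obtain ⟨h1, h2⟩ := h.2.2.2.resolve_left fun h => h0 h.1
      exact ⟨by simp [h1], h2⟩
    · obtain ⟨h1, h2⟩ := ih h.1 hv
      exact ⟨by simp [h1], h2⟩

theorem lab_root (h : TreeOrder G g tp te lab l) (hv : v ∈ l) (h0 : tp v = 0) : lab v = v := by
  induction l with
  | nil => simp at hv
  | cons w l ih =>
    rcases List.mem_cons.1 hv with rfl | hv
    · rcases h.2.2.2 with h' | h'
      · exact h'.2
      -- Vertices are numbered from 1, so the value 0, which marks roots, is never a parent in the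
      -- list.
      · rw [h0] at h'
        have := h.1.mem_Icc h'.1
        simp at this
    · exact ih h.1 hv

theorem edge (h : TreeOrder G g tp te lab l) (hv : v ∈ l) (h0 : tp v ≠ 0) :
    ∃ e : Fin G.numE, e.val = te v ∧ g e ∧
      ((G.src e + 1 = tp v ∧ G.dst e + 1 = v) ∨ (G.dst e + 1 = tp v ∧ G.src e + 1 = v)) := by
  obtain ⟨_, _, d, hd, hg, hf, he⟩ := h.parent hv h0
  obtain ⟨e, he', hends⟩ := ends_edge hd
  rw [hf] at hends
  exact ⟨e, by rw [he', he], he' ▸ hg, hends⟩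

theorem treeEdges_ends (h : TreeOrder G g tp te lab l) {e : Fin G.numE}
    (he : e ∈ treeEdges G tp te l) : (G.src e).val + 1 ∈ l ∧ (G.dst e).val + 1 ∈ l ∧ g e ∧
      lab (G.src e + 1) = lab (G.dst e + 1) := by
  obtain ⟨v, hv, h0, hte⟩ := mem_treeEdges.1 he
  obtain ⟨hp, hl, _⟩ := h.parent hv h0
  obtain ⟨e', he', hg, hends⟩ := h.edge hv h0
  obtain rfl : e' = e := Fin.ext (he'.trans hte)
  rcases hends with ⟨h1, h2⟩ | ⟨h1, h2⟩ <;> rw [h1, h2]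
  exacts [⟨hp, hv, hg, hl.symm⟩, ⟨hv, hp, hg, hl⟩]

theorem treeEdges_root (h0 : tp v = 0) : treeEdges G tp te (v :: l) = treeEdges G tp te l := by
  ext e; simp [mem_treeEdges, h0]

theorem treeEdges_cons (h0 : tp v ≠ 0) {e : Fin G.numE} (he : e.val = te v) :
    treeEdges G tp te (v :: l) = insert e (treeEdges G tp te l) := by
  ext f
  simp [mem_treeEdges, h0, ← he, Fin.ext_iff, eq_comm]

/-- The head of the list is a leaf: all edges of the remaining forest have both ends in the tail. So
each vertex with a parent adds an edge by `acyclic_insert`. -/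
theorem acyclic (h : TreeOrder G g tp te lab l) : ∀ e ∈ treeEdges G tp te l,
    ¬ G.Connected ((treeEdges G tp te l).erase e) (G.src e) (G.dst e) := by
  induction l with
  | nil => simp [treeEdges]
  | cons v l ih =>
    by_cases h0 : tp v = 0
    · rw [treeEdges_root h0]; exact ih h.1
    · obtain ⟨e, he, _, hends⟩ := h.edge (List.mem_cons_self ..) h0
      rw [treeEdges_cons h0 he]
      have hpl := (h.2.2.2.resolve_left fun h => h0 h.1).1
      obtain ⟨w, hw⟩ := exists_fin h.2.2.1
      obtain ⟨u, hu⟩ := exists_fin (h.1.mem_Icc hpl)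
      refine acyclic_insert (v := u) (w := w) (ih h.1) ?_ ?_ ?_
      · intro f hf
        have := h.1.treeEdges_ends hf
        constructor
        · rintro h'; rw [h', hw] at this; exact h.2.1 this.1
        · rintro h'; rw [h', hw] at this; exact h.2.1 this.2.1
      · rintro rfl
        rw [hw] at hu
        exact h.2.1 (hu ▸ hpl)
      · rcases hends with ⟨h1, h2⟩ | ⟨h1, h2⟩
        · left; constructor <;> (apply Fin.ext; omega)
        · right; constructor <;> (apply Fin.ext; omega)

theorem joined (h : TreeOrder G g tp te lab l) (hv : v ∈ l) :
    Joined (treeEdges G tp te l) v (lab v) := by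
  induction l generalizing v with
  | nil => simp at hv
  | cons w l ih =>
    have hsub : treeEdges G tp te l ⊆ treeEdges G tp te (w :: l) := fun e he => by
      obtain ⟨x, hx, hx'⟩ := mem_treeEdges.1 he
      exact mem_treeEdges.2 ⟨x, by simp [hx], hx'⟩
    rcases List.mem_cons.1 hv with rfl | hv
    · rcases h.2.2.2 with ⟨_, h2⟩ | ⟨h1, h2, d, hd, hg, hf, he⟩
      · rw [h2]; exact Joined.refl h.2.2.1
      · rw [h2]
        have h3 := (ih h.1 h1).mono hsub
        have h0 : tp v ≠ 0 := fun h0 => by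
          have := h.1.mem_Icc h1
          rw [h0] at this; simp at this
        have h4 := joined_end (A := treeEdges G tp te (v :: l)) hd fun e he' =>
          mem_treeEdges.2 ⟨v, by simp, h0, by rw [he, he']⟩
        rw [hf] at h4
        exact h4.symm.trans h3
    · exact (ih h.1 hv).mono hsub

end TreeOrder

theorem Explored.congr {G : Lattice} {g : ℕ → Prop} {P : Finset ℕ} {pend : List ℕ}
    {lab lab' : ℕ → ℕ} {r : ℕ} (h : Explored G g P pend lab r) (hl : ∀ v ∈ P, lab' v = lab v) :
    Explored G g P pend lab' r := by
  refine ⟨h.1, fun v hv d hd hg => ?_⟩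
  rw [hl v hv]
  exact (h.2 v hv d hd hg).imp (fun h' => ⟨h'.1, by rw [hl _ h'.1]; exact h'.2⟩) id

/-- The vertices in `N` have become children of `v`, along edge ends in `l`. -/
def TreeMarks (G : Lattice) (g : ℕ → Prop) (v : ℕ) (N l : List ℕ) (tp₀ te₀ tp te : ℕ → ℕ) : Prop :=
  (∀ w ∈ N, tp w = v ∧ ∃ d ∈ l, g (edgeN d) ∧ G.farN d = w ∧ te w = edgeN d) ∧
    ∀ w, w ∉ N → tp w = tp₀ w ∧ te w = te₀ w

namespace TreeMarks

variable {G : Lattice} {g : ℕ → Prop} {v d : ℕ} {N l : List ℕ} {tp₀ te₀ tp te : ℕ → ℕ}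

theorem skip (h : TreeMarks G g v N l tp₀ te₀ tp te) :
    TreeMarks G g v N (l ++ [d]) tp₀ te₀ tp te := by
  refine ⟨fun w hw => ⟨(h.1 w hw).1, ?_⟩, h.2⟩
  obtain ⟨x, hx, hx'⟩ := (h.1 w hw).2
  exact ⟨x, by simp [hx], hx'⟩

theorem push (h : TreeMarks G g v N l tp₀ te₀ tp te) (hg : g (edgeN d)) :
    TreeMarks G g v (N ++ [G.farN d]) (l ++ [d]) tp₀ te₀ (Function.update tp (G.farN d) v)
      (Function.update te (G.farN d) (edgeN d)) := by
  constructor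
  · intro w hw
    by_cases he : w = G.farN d
    · subst he
      simp [hg]
    · rw [Function.update_of_ne he, Function.update_of_ne he]
      exact h.skip.1 w ((List.mem_append.1 hw).resolve_right (by simpa using he))
  · intro w hw
    simp only [List.mem_append, List.mem_singleton, not_or] at hw
    rw [Function.update_of_ne hw.2, Function.update_of_ne hw.2]
    exact h.2 w hw.1

end TreeMarks

/-- Makes the unseen neighbours of `v` in the erasure children of `v`. -/
def Cmd.exploreTreeEnds : Cmd :=
  .forEnds .v
    (.set .w (.get .target (.var .d)) ;;
     .ite (.eq (.get .modErased (.get .edge (.var .d))) (.lit 1))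
       (.ite (.eq (.get .seen (.var .w)) (.lit 0))
         (.put .seen (.var .w) (.lit 1) ;;
          .put .treeParent (.var .w) (.var .v) ;;
          .put .treeEdge (.var .w) (.get .edge (.var .d)) ;;
          .put .queue (.var .back) (.var .w) ;;
          .incr .back) .skip) .skip)

theorem wp_exploreTreeEnds {G : Lattice} {W : ℕ} {p : Phase} {s : Store} {t : Phase → ℕ}
    {Q : List ℕ} (hB : s.Bounded W) (hW : G.numV + 1 ≤ W) (hG : Incidence G s)
    (hv : s.var .v ∈ Finset.Icc 1 G.numV) (hQ : Stores (s.tab .queue) 0 Q)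
    (hlen : s.var .back = Q.length) (hnd : Q.Nodup) (hQN : ∀ w ∈ Q, w ∈ Finset.Icc 1 G.numV)
    (hseen : ∀ w ∈ Q, s.tab .seen w ≠ 0) :
    Wp W p .exploreTreeEnds (fun s' t' => (∃ N, QueueInv G (fun e => s.tab .modErased e = 1) Q N
        (G.ends (s.var .v)) (s.tab .seen) (s'.tab .seen) (s'.tab .queue) (s'.var .back) ∧
        TreeMarks G (fun e => s.tab .modErased e = 1) (s.var .v) N (G.ends (s.var .v))
          (s.tab .treeParent) (s.tab .treeEdge) (s'.tab .treeParent) (s'.tab .treeEdge)) ∧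
      t' p ≤ t p + 60 * G.weight (s.var .v)) s t := by
  refine Wp.forEnds (l := G.ends (s.var .v)) (I := fun l₁ l₂ s₁ t₁ =>
    (∃ N, QueueInv G (fun e => s.tab .modErased e = 1) Q N l₁ (s.tab .seen) (s₁.tab .seen)
      (s₁.tab .queue) (s₁.var .back) ∧
      TreeMarks G (fun e => s.tab .modErased e = 1) (s.var .v) N l₁
          (s.tab .treeParent) (s.tab .treeEdge) (s₁.tab .treeParent) (s₁.tab .treeEdge)) ∧
    t₁ p ≤ t p + 10 + 60 * l₁.length) hB (hG.chain _ hv) rfl rfl ?_ ?_ ?_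
  · refine ⟨⟨[], ⟨by simpa using hQ, by simpa using hlen, by simpa using hnd, by simpa using hQN,
      by simp, by simp, by simp, by simp⟩, by simp, by simp⟩, by simp⟩
  · rintro l₁ d l₂ s₁ t₁ hl hfr hd ⟨⟨N, hN, hM⟩, h2⟩
    have hdm : d ∈ G.ends (s.var .v) := by simp [hl]
    obtain ⟨hd1, hd2, _⟩ := mem_ends.1 hdm
    have hG₁ : Incidence G s₁ := hG.frame hfr rfl
    have hmod : s₁.tab .modErased = s.tab .modErased := hfr.tab _ rfl
    have hv₁ : s₁.var .v = s.var .v := hfr.var _ rfl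
    have hvW := hB.var .v
    have hfar := farN_mem hd1 hd2
    have hfarW : G.farN d ≤ W := by rw [← hG₁.target d hd1 hd2]; exact hfr.bounded.tab _ _
    have hedW : edgeN d ≤ W := by rw [← hG₁.edge d hd1 hd2]; exact hfr.bounded.tab _ _
    have hlenN := length_le_of_nodup hN.2.2.1 hN.2.2.2.1
    have hback := hN.2.1
    have hll : (l₁ ++ [d]).length = l₁.length + 1 := by simp
    simp [hd, hG₁.edge d hd1 hd2, hG₁.target d hd1 hd2, hmod, hv₁, -Finset.mem_Icc,
      -List.length_append]
    refine ⟨hfarW, fun hg => ⟨fun hs => ⟨by omega, hvW, hedW, by omega, by omega, ?_, by omega⟩,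
      fun hs => ⟨⟨N, hN.skip fun _ => hs, hM.skip⟩, by omega⟩⟩,
      fun hg => ⟨⟨N, hN.skip fun h => absurd h hg, hM.skip⟩, by omega⟩⟩
    exact ⟨_, hN.push hg hs hseen hfar, hM.push hg⟩
  · rintro s₁ t₁ hfr ⟨h1, h2⟩
    refine ⟨h1, ?_⟩
    simp [weight]
    omega

/-- Visits the next vertex of the queue. -/
def Cmd.visitTreeVertex : Cmd :=
  .set .v (.get .queue (.var .front)) ;;
  .incr .front ;;
  .exploreTreeEnds

/-- The state of the exploration: the vertices in `fin` have been visited, those in `pend` are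
pending; they belong to the tree with the root `r`. -/
structure TreeInv (G : Lattice) (g : ℕ → Prop) (r : ℕ) (fin pend : List ℕ) (lab : ℕ → ℕ)
    (s : Store) : Prop where
  queue : Stores (s.tab .queue) 0 (fin ++ pend)
  front : s.var .front = fin.length
  back : s.var .back = (fin ++ pend).length
  seen : ∀ w ∈ Finset.Icc 1 G.numV, s.tab .seen w = if w ∈ fin ++ pend then 1 else 0
  explored : Explored G g fin.toFinset pend lab r
  lab_pend : ∀ w ∈ pend, lab w = r
  tree : TreeOrder G g (s.tab .treeParent) (s.tab .treeEdge) lab (fin ++ pend).reverse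

theorem TreeInv.mem {G : Lattice} {g : ℕ → Prop} {r : ℕ} {fin pend : List ℕ} {lab : ℕ → ℕ}
    {s : Store} (h : TreeInv G g r fin pend lab s) : ∀ w ∈ fin ++ pend, w ∈ Finset.Icc 1 G.numV :=
  fun _ hw => h.tree.mem_Icc (List.mem_reverse.2 hw)

theorem TreeInv.nodup {G : Lattice} {g : ℕ → Prop} {r : ℕ} {fin pend : List ℕ} {lab : ℕ → ℕ}
    {s : Store} (h : TreeInv G g r fin pend lab s) : (fin ++ pend).Nodup :=
  List.nodup_reverse.1 h.tree.nodup

/-- The labels are not stored by the program; they exist in the proof only, and a vertex is labelled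
as soon as it enters the queue. -/
theorem wp_exploreTree {G : Lattice} {W : ℕ} {p : Phase} {s : Store}
    {t : Phase → ℕ} {fin₀ pend₀ : List ℕ} {lab₀ : ℕ → ℕ} {r : ℕ} (hB : s.Bounded W)
    (hW : G.numV + 2 ≤ W) (hG : Incidence G s)
    (h : TreeInv G (fun e => s.tab .modErased e = 1) r fin₀ pend₀ lab₀ s) :
    Wp W p (.loop (.lt (.var .front) (.var .back)) .visitTreeVertex) (fun s' t' => ∃ fin lab,
      TreeInv G (fun e => s.tab .modErased e = 1) r fin [] lab s' ∧
      (∀ w ∈ fin₀ ++ pend₀, w ∈ fin) ∧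
      t' p + 80 * (fin₀.map G.weight).sum ≤ t p + 10 + 80 * (fin.map G.weight).sum) s t := by
  refine Wp.loop (I := fun s₁ t₁ => ∃ fin pend lab,
      TreeInv G (fun e => s.tab .modErased e = 1) r fin pend lab s₁ ∧
      (∀ w ∈ fin₀ ++ pend₀, w ∈ fin ++ pend) ∧
      t₁ p + 80 * (fin₀.map G.weight).sum ≤ t p + 80 * (fin.map G.weight).sum)
    (fun s₁ => G.numV - s₁.var .front) hB ⟨fin₀, pend₀, lab₀, h, fun _ => id, le_rfl⟩ ?_ ?_
  · rintro s₁ t₁ hfr ⟨fin, pend, lab, hI, hsub, ht⟩ hb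
    simp only [Test.Holds, Expr.eval, hI.front, hI.back, List.length_append] at hb
    obtain ⟨v, rest, rfl⟩ : ∃ v rest, pend = v :: rest := by
      cases pend with
      | nil => simp at hb
      | cons v rest => exact ⟨v, rest, rfl⟩
    have hlen := length_le_of_nodup hI.nodup hI.mem
    rw [List.length_append, List.length_cons] at hlen
    have hmod : s₁.tab .modErased = s.tab .modErased := hfr.tab _ rfl
    have hG₁ : Incidence G s₁ := hG.frame hfr rfl
    have hv := hI.mem v (by simp)
    have hvP : v ∉ fin.toFinset := hI.explored.1 v (by simp)
    have hqv : s₁.tab .queue (s₁.var .front) = v := by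
      have := (Stores.append_iff.1 hI.queue).2.1
      rwa [Nat.zero_add, ← hI.front] at this
    have hv' := Finset.mem_Icc.1 hv
    have hvW : v ≤ W := by omega
    rw [Cmd.visitTreeVertex, Cmd.incr, wp_seq, wp_set, wp_seq, wp_set]
    simp only [Expr.eval, hqv, Expr.cost, tick_tick]
    have hfW : (s₁.setVar .v v).var .front + 1 ≤ W := by simp [hI.front]; omega
    refine ⟨hvW, hfW, ?_⟩
    have hB2 : ((s₁.setVar .v v).setVar .front ((s₁.setVar .v v).var .front + 1)).Bounded W :=
      (hfr.bounded.setVar hvW).setVar hfW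
    refine (wp_exploreTreeEnds (Q := fin ++ v :: rest) hB2 (by omega) hG₁.setVar.setVar
      (by simpa using hv) (by simpa using hI.queue) (by simpa using hI.back) hI.nodup hI.mem
      ?_).frame hB2 ?_
    · intro w hw
      simp only [Store.setVar_tab]
      rw [hI.seen w (hI.mem w hw), if_pos hw]
      omega
    rintro s₂ t₂ hf₂ ⟨⟨N, ⟨q1, q2, q3, q4, q5, q6, q7, q8⟩, m1, m2⟩, h7⟩
    simp [hmod, -Finset.mem_Icc] at q1 q2 q3 q4 q5 q6 q7 q8 m1 m2 h7
    have hfront₂ : s₂.var .front = fin.length + 1 := by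
      rw [hf₂.var _ rfl]; simp [hI.front]
    have hNN : ∀ w ∈ N, w ∈ Finset.Icc 1 G.numV := fun w hw => q4 w (Or.inr (Or.inr (Or.inr hw)))
    have hNseen : ∀ w ∈ N, w ∉ fin ++ v :: rest := fun w hw hw' => by
      have := q6 w hw
      rw [hI.seen w (hNN w hw), if_pos hw'] at this
      omega
    have hvr := hI.lab_pend v (by simp)
    have hndq := hI.nodup
    rw [List.nodup_append, List.nodup_cons] at hndq
    set lab' : ℕ → ℕ := fun w => if w ∈ N then r else lab w with hlab'
    have hlabQ : ∀ w ∈ fin ++ v :: rest, lab' w = lab w := fun w hw =>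
      if_neg fun hw' => hNseen w hw' hw
    have hassoc : fin ++ [v] ++ (rest ++ N) = fin ++ v :: rest ++ N := by simp
    refine ⟨⟨fin ++ [v], rest ++ N, lab', ⟨?_, ?_, ?_, ?_, ?_, ?_, ?_⟩, ?_, ?_⟩, ?_⟩
    · simpa using q1
    · simp [hfront₂]
    · simp [q2]
    · intro w hw
      rw [q5, hI.seen w hw, hassoc]
      by_cases hwN : w ∈ N
      · simp [hwN]
      · simp [hwN]
    · have hE := (hI.explored.congr (lab' := lab') fun w hw =>
        hlabQ w (by simp [List.mem_toFinset.1 hw])).visit (new := N) hndq.2.1.1 ?_ ?_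
      -- The visit would label `v` with `r`, but as a pending vertex it already has this label.
      · have hup : Function.update lab' v r = lab' := by
          rw [Function.update_eq_self_iff, hlabQ v (by simp), hvr]
        rw [hup] at hE
        convert hE using 1
        ext w; simp
      · intro w hw
        have := hNseen w hw
        simp only [List.mem_append, List.mem_cons, not_or] at this
        exact ⟨by simp [this.1], this.2.1⟩
      · intro d hd hg
        have hfar := farN_mem (mem_ends.1 hd).1 (mem_ends.1 hd).2.1
        have := q8 d hd hg
        rw [q5] at this
        by_cases hdN : G.farN d ∈ N
        · right; simp [hdN]
        · rw [if_neg hdN, hI.seen _ hfar] at this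
          simp only [ite_eq_right_iff, one_ne_zero, imp_false, not_not] at this
          refine (List.mem_append.1 this).imp (fun h => by simpa using h) fun h => ?_
          rw [List.mem_append]; exact Or.inl h
    · intro w hw
      by_cases hwN : w ∈ N
      · simp [hlab', hwN]
      · have hwr : w ∈ rest := (List.mem_append.1 hw).resolve_right hwN
        rw [hlabQ w (by simp [hwr])]
        exact hI.lab_pend w (by simp [hwr])
    · rw [hassoc, List.reverse_append]
      refine TreeOrder.append (v := v) (hI.tree.congr fun w hw => ?_) (by simp) ?_ ?_
      · have hw := List.mem_reverse.1 hw
        have := m2 w fun hw' => hNseen w hw' hw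
        exact ⟨this.1, this.2, hlabQ w hw⟩
      · rw [← List.reverse_append, List.nodup_reverse]
        simpa using q3
      · intro w hw
        have hw := List.mem_reverse.1 hw
        obtain ⟨k1, k2⟩ := m1 w hw
        refine ⟨hNN w hw, k1, ?_, k2⟩
        rw [hlabQ v (by simp), hvr]
        simp [hlab', hw]
    · intro w hw
      have := hsub w hw
      rw [hassoc]
      exact List.mem_append_left _ this
    · have : 1 ≤ G.weight v := by simp [weight]
      simp
      omega
    · rw [hfront₂, hI.front]; omega
  · rintro s₁ t₁ hfr ⟨fin, pend, lab, hI, hsub, ht⟩ hb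
    simp only [Test.Holds, Expr.eval, hI.front, hI.back, List.length_append] at hb
    obtain rfl : pend = [] := List.length_eq_zero_iff.1 (by omega)
    refine ⟨fin, lab, hI, fun w hw => by simpa using hsub w hw, ?_⟩
    simp; omega

/-! ### The peeling decoder -/

/-- Explores all trees. -/
def Cmd.buildForest : Cmd :=
  .set .r (.lit 1) ;;
  .loop (.lt (.var .r) (.add (.var .numV) (.lit 1)))
    (.ite (.eq (.get .seen (.var .r)) (.lit 0))
      (.put .seen (.var .r) (.lit 1) ;;
       .put .treeParent (.var .r) (.lit 0) ;;
       .put .queue (.var .back) (.var .r) ;;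
       .incr .back ;;
       .loop (.lt (.var .front) (.var .back)) .visitTreeVertex) .skip ;;
     .incr .r)

/-- Unlike in the initialization, the queue is not reset between trees. At the end it holds every
vertex once, parents before children, which is the order that peeling reads backwards. -/
theorem wp_buildForest {G : Lattice} {W : ℕ} {p : Phase} {s : Store} {t : Phase → ℕ}
    (hB : s.Bounded W) (hW : G.numV + 2 ≤ W) (hG : Incidence G s)
    (hseen : ∀ v ∈ Finset.Icc 1 G.numV, s.tab .seen v = 0) (hfront : s.var .front = 0)
    (hback : s.var .back = 0) :
    Wp W p .buildForest (fun s' t' => ∃ q fin lab,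
      TreeInv G (fun e => s.tab .modErased e = 1) q fin [] lab s' ∧
      (∀ v ∈ Finset.Icc 1 G.numV, v ∈ fin) ∧
      t' p ≤ t p + 10 + 160 * G.numE + 140 * G.numV) s t := by
  rw [Cmd.buildForest, wp_seq, wp_set]
  refine ⟨by simp; omega, ?_⟩
  have hB1 : (s.setVar .r (Expr.eval s (.lit 1))).Bounded W := hB.setVar (by simp; omega)
  refine Wp.loop (I := fun s₁ t₁ => 1 ≤ s₁.var .r ∧ s₁.var .r ≤ G.numV + 1 ∧ ∃ q fin lab,
      TreeInv G (fun e => s.tab .modErased e = 1) q fin [] lab s₁ ∧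
      (∀ v ∈ Finset.Icc 1 G.numV, v < s₁.var .r → v ∈ fin) ∧
      t₁ p ≤ t p + 2 + 80 * (fin.map G.weight).sum + 50 * (s₁.var .r - 1))
    (fun s₁ => G.numV + 1 - s₁.var .r) hB1 ?_ ?_ ?_
  · refine ⟨by simp, by simp, 0, [], id, ⟨by simp [Stores], by simpa using hfront,
      by simpa using hback, ?_, by simp [Explored], by simp, by simp [TreeOrder]⟩, ?_, by simp⟩
    · intro w hw; simpa using hseen w hw
    · intro v hv hlt
      simp at hv hlt
      omega
  · rintro s₁ t₁ hfr ⟨hpos, hle, q, fin, lab, hI, hmem, ht⟩ hb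
    have hG₁ : Incidence G s₁ := hG.setVar.frame hfr rfl
    have hmod : s₁.tab .modErased = s.tab .modErased := by rw [hfr.tab _ rfl]; simp
    obtain ⟨r, hr⟩ : ∃ r, s₁.var .r = r := ⟨_, rfl⟩
    rw [hr] at hpos hle hmem ht
    simp only [Test.Holds, Expr.eval, hG₁.numV, hr] at hb
    have hrN : r ∈ Finset.Icc 1 G.numV := by rw [Finset.mem_Icc]; omega
    have hnext : ∀ fin : List ℕ, (∀ v ∈ Finset.Icc 1 G.numV, v < r → v ∈ fin) → r ∈ fin →
        ∀ v ∈ Finset.Icc 1 G.numV, v < r + 1 → v ∈ fin := by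
      intro fin hP hrP v hv hlt
      rcases Nat.lt_succ_iff_lt_or_eq.1 hlt with h | h
      · exact hP v hv h
      · rwa [h]
    have hrW : r ≤ W := by rw [← hr]; exact hfr.bounded.var _
    have hlen := length_le_of_nodup hI.nodup hI.mem
    have hback₁ := hI.back
    rw [wp_seq, wp_ite]
    simp only [Test.Holds, Expr.eval, hr]
    rw [hI.seen r hrN]
    simp only [List.append_nil] at hlen hback₁ ⊢
    constructor
    · intro hrf
      have hrf : r ∉ fin := by simpa using hrf
      simp only [Cmd.incr, wp_seq (c := .put _ _ _), wp_seq (c := .set _ _), wp_put, wp_set,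
        Expr.eval, Expr.cost, tick_tick, Test.cost]
      refine ⟨by omega, by omega, by simpa [hr] using hrW, by simp [hback₁]; omega, ?_⟩
      set s₂ : Store := Store.setVar _ .back _ with hs₂
      have hB₂ : s₂.Bounded W := by
        refine (((hfr.bounded.setTab ?_).setTab ?_).setTab ?_).setVar ?_
        · omega
        · omega
        · simpa [hr] using hrW
        · simp [hback₁]; omega
      have hG₂ : Incidence G s₂ := hG₁.setTab.setTab.setTab.setVar
      have e1 : s₂.var .r = r := by simp [hs₂, hr]
      have e2 : s₂.var .front = fin.length := by simp [hs₂, hI.front]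
      have e3 : s₂.var .back = fin.length + 1 := by simp [hs₂, hback₁]
      have e4 : s₂.tab .seen = Function.update (s₁.tab .seen) r 1 := by simp [hs₂, hr]
      have e5 : s₂.tab .treeParent = Function.update (s₁.tab .treeParent) r 0 := by simp [hs₂, hr]
      have e6 : s₂.tab .treeEdge = s₁.tab .treeEdge := by simp [hs₂]
      have e7 : s₂.tab .queue = Function.update (s₁.tab .queue) fin.length r := by
        simp [hs₂, hr, hback₁]
      have e8 : s₂.tab .modErased = s.tab .modErased := by simp [hs₂, hmod]
      clear_value s₂
      have hI₂ : TreeInv G (fun e => s₂.tab .modErased e = 1) r fin [r] (Function.update lab r r)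
          s₂ := by
        rw [e8]
        have hlab : ∀ w ∈ fin, Function.update lab r r w = lab w := fun w hw =>
          Function.update_of_ne (ne_of_mem_of_not_mem hw hrf) _ _
        refine ⟨?_, e2, by simp [e3], ?_, ?_, ?_, ?_⟩
        · rw [e7]
          have := hI.queue
          rw [List.append_nil] at this
          exact this.push_zero rfl r
        · intro w hw
          have hs := hI.seen w hw
          rw [List.append_nil] at hs
          rw [e4, Function.update_apply]
          split
          · simp [*]
          · rw [hs]; simp [*]
        · exact (hI.explored.congr fun w hw => hlab w (List.mem_toFinset.1 hw)).restart
            (by simpa using hrf)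
        · intro w hw
          rw [List.mem_singleton] at hw
          rw [hw, Function.update_self]
        · have htree := hI.tree
          rw [List.append_nil] at htree
          rw [List.reverse_append, e5, e6]
          refine ⟨htree.congr fun w hw => ?_, by simpa using hrf, hrN, Or.inl (by simp)⟩
          have hw := List.mem_reverse.1 hw
          exact ⟨Function.update_of_ne (ne_of_mem_of_not_mem hw hrf) _ _, rfl, hlab w hw⟩
      refine (wp_exploreTree hB₂ hW hG₂ hI₂).frame hB₂ ?_
      rintro s₃ t₃ hf₃ ⟨fin', lab', hI₃, hsub, ht₃⟩
      rw [e8] at hI₃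
      have hr₃ : s₃.var .r = r := by rw [hf₃.var _ rfl, e1]
      have hm := hnext fin' (fun v hv hlt => hsub v (by simp [hmem v hv hlt])) (hsub r (by simp))
      simp at ht₃
      simp only [wp_set, Expr.eval, Expr.cost, hr₃]
      refine ⟨by omega, ⟨by simp, by simpa using hb, r, fin', lab', ⟨by simpa using hI₃.queue,
        by simpa using hI₃.front, by simpa using hI₃.back, by simpa using hI₃.seen, hI₃.explored,
        hI₃.lab_pend, by simpa using hI₃.tree⟩, by simpa using hm, ?_⟩, ?_⟩
      · simp; omega
      · simp; omega
    · intro hrf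
      have hrf : r ∈ fin := by simpa using hrf
      have hm := hnext fin hmem hrf
      simp only [Cmd.incr, wp_skip, wp_set, Expr.eval, Expr.cost, tick_tick, Test.cost, hr]
      refine ⟨by omega, ⟨by simp, by simpa using hb, q, fin, lab, ⟨by simpa using hI.queue,
        by simpa using hI.front, by simpa using hI.back, by simpa using hI.seen, hI.explored,
        hI.lab_pend, by simpa using hI.tree⟩, by simpa using hm, ?_⟩, ?_⟩
      · simp; omega
      · simp; omega
  · rintro s₁ t₁ hfr ⟨hpos, hle, q, fin, lab, hI, hmem, ht⟩ hb
    have hG₁ : Incidence G s₁ := hG.setVar.frame hfr rfl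
    simp only [Test.Holds, Expr.eval, hG₁.numV] at hb
    refine ⟨q, fin, lab, hI, fun v hv => hmem v hv (by rw [Finset.mem_Icc] at hv; omega), ?_⟩
    have hw : (fin.map G.weight).sum ≤ 2 * G.numE + G.numV := by
      have hnd := hI.nodup
      rw [List.append_nil] at hnd
      rw [← List.sum_toFinset _ hnd]
      refine (Finset.sum_le_sum_of_subset fun w hw => hI.mem w ?_).trans sum_weight_le
      simpa using hw
    simp
    omega

theorem treeEdges_subset_append {G : Lattice} {tp te : ℕ → ℕ} (l l' : List ℕ) :
    treeEdges G tp te l ⊆ treeEdges G tp te (l ++ l') := fun _ he => by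
  obtain ⟨x, hx, hx'⟩ := mem_treeEdges.1 he
  exact mem_treeEdges.2 ⟨x, by simp [hx], hx'⟩

/-- The state of the peeling: the vertices in `l` have been peeled, with the correction `C`. -/
structure PeelInv {G : Lattice} (σ : Finset (Fin G.numV)) (tp te : ℕ → ℕ) (l : List ℕ)
    (C : Finset (Fin G.numE)) (corr rest : ℕ → ℕ) : Prop where
  correction : ∀ e : Fin G.numE, corr e = if e ∈ C then 1 else 0
  subset : C ⊆ treeEdges G tp te l
  remaining : ∀ a : Fin G.numV, rest (a + 1) = if (a ∈ σ ↔ a ∈ G.syndrome C) then 0 else 1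
  peeled : ∀ v ∈ l, tp v ≠ 0 → rest v = 0

namespace PeelInv

variable {G : Lattice} {σ : Finset (Fin G.numV)} {g : ℕ → Prop} {tp te lab corr rest : ℕ → ℕ}
  {l l₂ : List ℕ} {C : Finset (Fin G.numE)} {v : ℕ}

theorem keep (h : PeelInv σ tp te l C corr rest) (hv : tp v ≠ 0 → rest v = 0) :
    PeelInv σ tp te (l ++ [v]) C corr rest where
  correction := h.correction
  subset := h.subset.trans (treeEdges_subset_append _ _)
  remaining := h.remaining
  peeled w hw := by
    rcases List.mem_append.1 hw with hw | hw
    · exact h.peeled w hw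
    · rw [List.mem_singleton] at hw; rwa [hw]

/-- Adding the edge of `v` to its parent toggles the syndrome of the correction at these two
vertices, which matches the changes of the remaining bits. -/
theorem peel (h : PeelInv σ tp te l C corr rest)
    (htree : TreeOrder G g tp te lab (l ++ v :: l₂)) (h0 : tp v ≠ 0) (hv : rest v = 1) :
    ∃ C', PeelInv σ tp te (l ++ [v]) C' (Function.update corr (te v) 1)
      (Function.update (Function.update rest v 0) (tp v) (1 - Function.update rest v 0 (tp v))) := by
  have hsuf : TreeOrder G g tp te lab (v :: l₂) := htree.suffix
  have hpl : tp v ∈ l₂ := (hsuf.2.2.2.resolve_left fun h => h0 h.1).1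
  have hne : tp v ≠ v := fun he => hsuf.2.1 (he ▸ hpl)
  have hnd := htree.nodup
  rw [List.nodup_append] at hnd
  obtain ⟨e, he, _, hends⟩ := hsuf.edge (List.mem_cons_self ..) h0
  obtain ⟨a, ha⟩ := exists_fin hsuf.2.2.1
  obtain ⟨b, hb⟩ := exists_fin (hsuf.1.mem_Icc hpl)
  have hab : a ≠ b := fun h => hne (by rw [← hb, ← h, ha])
  -- An edge of `C` is the parent edge of a vertex peeled earlier. If it were `e`, that vertex would
  -- be `v` or its parent, and both come later in the order.
  have heC : e ∉ C := by
    intro heC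
    obtain ⟨u, hu, hu0, hue⟩ := mem_treeEdges.1 (h.subset heC)
    obtain ⟨e', he', _, hends'⟩ := htree.edge (List.mem_append_left _ hu) hu0
    obtain rfl : e' = e := Fin.ext (he'.trans hue)
    have h1 := hnd.2.2 u hu v (by simp)
    have h2 := hnd.2.2 u hu (tp v) (by simp [hpl])
    omega
  have hend : ∀ x : Fin G.numV, (x = G.src e ∨ x = G.dst e) ↔ (x = a ∨ x = b) := by
    intro x
    simp only [Fin.ext_iff]
    omega
  have hloop : G.src e ≠ G.dst e := by
    intro hh
    rw [Fin.ext_iff] at hh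
    omega
  have hsyn : ∀ x, x ∈ G.syndrome (insert e C) ↔ ((x = a ∨ x = b) ↔ x ∉ G.syndrome C) :=
    fun x => by rw [mem_syndrome_insert heC hloop, hend]
  rw [Function.update_of_ne hne]
  refine ⟨insert e C, ⟨?_, ?_, ?_, ?_⟩⟩
  · intro f
    rw [Function.update_apply, h.correction, ← he]
    by_cases hf : f = e
    · simp [hf]
    · simp [hf, Fin.val_inj]
  · rw [Finset.insert_subset_iff]
    exact ⟨mem_treeEdges.2 ⟨v, by simp, h0, he.symm⟩, h.subset.trans (treeEdges_subset_append _ _)⟩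
  · intro x
    simp only [hsyn]
    have hx := h.remaining x
    by_cases hxb : x = b
    · subst hxb
      rw [hb, Function.update_self]
      rw [hb] at hx
      rw [hx]
      by_cases c1 : x ∈ σ <;> by_cases c2 : x ∈ G.syndrome C <;> simp [c1, c2]
    · have hxb' : x.val + 1 ≠ tp v := fun h' => hxb (Fin.ext (by omega))
      rw [Function.update_of_ne hxb']
      by_cases hxa : x = a
      · subst hxa
        rw [ha, Function.update_self]
        rw [ha, hv] at hx
        by_cases c1 : x ∈ σ <;> by_cases c2 : x ∈ G.syndrome C <;> simp [c1, c2] at hx ⊢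
      · have hxa' : x.val + 1 ≠ v := fun h' => hxa (Fin.ext (by omega))
        rw [Function.update_of_ne hxa', hx]
        simp [hxa, hxb]
  · intro w hw hw0
    -- The parent has not been peeled yet, so flipping its bit cannot disturb a settled vertex.
    have hwp : w ≠ tp v := by
      rintro rfl
      rcases List.mem_append.1 hw with hw | hw
      · exact hnd.2.2 _ hw (tp v) (by simp [hpl]) rfl
      · rw [List.mem_singleton] at hw; exact hne hw
    rw [Function.update_of_ne hwp, Function.update_apply]
    split
    · rfl
    · exact h.peeled w ((List.mem_append.1 hw).resolve_right (by simpa)) hw0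

/-- All vertices with a parent agree with the target. Within a tree this leaves only the root, and
two sets that both have an even intersection with the tree cannot differ in exactly one of its
vertices. -/
theorem syndrome_eq (h : PeelInv σ tp te l C corr rest) (htree : TreeOrder G g tp te lab l)
    (hl : ∀ v ∈ Finset.Icc 1 G.numV, v ∈ l) (heven : ∀ r, Even (synCount σ lab r)) :
    G.syndrome C = σ := by
  have hagree : ∀ w : Fin G.numV, tp (w + 1) ≠ 0 → (w ∈ σ ↔ w ∈ G.syndrome C) := by
    intro w hw
    have h1 := h.peeled _ (hl _ (coe_mem_Icc w)) hw
    rw [h.remaining] at h1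
    by_contra hc
    simp [hc] at h1
  have hcard : ∀ (τ υ : Finset (Fin G.numV)) (X : Fin G.numV → Prop) [DecidablePred X]
      (a : Fin G.numV), X a → (∀ w, X w → w ≠ a → (w ∈ τ ↔ w ∈ υ)) → Even (τ.filter X).card →
      Even (υ.filter X).card → a ∈ τ → a ∈ υ := by
    intro τ υ X _ a hXa hw h1 h2 haτ
    by_contra haυ
    have : τ.filter X = insert a (υ.filter X) := by
      ext w
      by_cases hwa : w = a
      · subst hwa; simp [haτ, hXa]
      · simp only [Finset.mem_filter, Finset.mem_insert, hwa, false_or]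
        exact ⟨fun h => ⟨(hw w h.2 hwa).1 h.1, h.2⟩, fun h => ⟨(hw w h.2 hwa).2 h.1, h.2⟩⟩
    rw [this, Finset.card_insert_of_notMem (by simp [haυ]), Nat.even_add_one] at h1
    exact h1 h2
  ext a
  by_cases h0 : tp (a + 1) = 0
  · have hroot := htree.lab_root (hl _ (coe_mem_Icc a)) h0
    have hX : ∀ w : Fin G.numV, lab (w + 1) = a + 1 → w ≠ a → (w ∈ σ ↔ w ∈ G.syndrome C) := by
      intro w hw hwa
      refine hagree w fun hw0 => hwa (Fin.ext ?_)
      rw [htree.lab_root (hl _ (coe_mem_Icc w)) hw0] at hw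
      omega
    have hevenC := even_card_syndrome_filter C (fun w => lab (w.val + 1) = a.val + 1) fun e he => by
      rw [(htree.treeEdges_ends (h.subset he)).2.2.2]
    have hevenσ := heven (a.val + 1)
    exact ⟨hcard _ _ _ a hroot (fun w hw hwa => (hX w hw hwa).symm) hevenC hevenσ,
      hcard _ _ _ a hroot hX hevenσ hevenC⟩
  · exact (hagree a h0).symm

end PeelInv

/-- Peels the forest, leaves first. -/
def Cmd.peelForest : Cmd :=
  .loop (.lt (.lit 0) (.var .back))
    (.set .back (.sub (.var .back) (.lit 1)) ;;
     .set .v (.get .queue (.var .back)) ;;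
     .ite (.ne (.get .treeParent (.var .v)) (.lit 0))
       (.ite (.eq (.get .rest (.var .v)) (.lit 1))
         (.put .correction (.get .treeEdge (.var .v)) (.lit 1) ;;
          .put .rest (.var .v) (.lit 0) ;;
          .flip .rest (.get .treeParent (.var .v))) .skip) .skip)

theorem wp_peelForest {G : Lattice} {σ : Finset (Fin G.numV)} {g : ℕ → Prop} {W : ℕ} {p : Phase}
    {s : Store} {t : Phase → ℕ} {lab : ℕ → ℕ} {Q : List ℕ} (hB : s.Bounded W) (hW : 1 ≤ W)
    (hQ : Stores (s.tab .queue) 0 Q) (hback : s.var .back = Q.length)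
    (htree : TreeOrder G g (s.tab .treeParent) (s.tab .treeEdge) lab Q.reverse)
    (hrest : ∀ a : Fin G.numV, s.tab .rest (a + 1) = if a ∈ σ then 1 else 0)
    (hcorr : ∀ e : Fin G.numE, s.tab .correction e = 0) :
    Wp W p .peelForest (fun s' t' => (∃ C, PeelInv σ (s.tab .treeParent) (s.tab .treeEdge)
      Q.reverse C (s'.tab .correction) (s'.tab .rest)) ∧ t' p ≤ t p + 10 + 50 * Q.length) s t := by
  refine Wp.loopList (l := Q.reverse) (I := fun l₁ l₂ s₁ t₁ =>
    s₁.var .back = l₂.length ∧ Stores (s.tab .queue) 0 l₂.reverse ∧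
    (∃ C, PeelInv σ (s.tab .treeParent) (s.tab .treeEdge) l₁ C (s₁.tab .correction)
      (s₁.tab .rest)) ∧ t₁ p ≤ t p + 50 * l₁.length) hB ?_ ?_ ?_
  · refine ⟨by simpa using hback, by simpa using hQ, ⟨∅, ?_, by simp, ?_, by simp⟩, by simp⟩
    · simpa using hcorr
    · intro a; rw [hrest]
      have : a ∉ G.syndrome ∅ := by simp [syndrome]
      by_cases ha : a ∈ σ <;> simp [ha, this]
  · rintro l₁ v l₂ s₁ t₁ hl hfr ⟨h1, h2, ⟨C, hC⟩, h4⟩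
    have hq : s₁.tab .queue = s.tab .queue := hfr.tab _ rfl
    have hp : s₁.tab .treeParent = s.tab .treeParent := hfr.tab _ rfl
    have he : s₁.tab .treeEdge = s.tab .treeEdge := hfr.tab _ rfl
    rw [List.reverse_cons, Stores.append_iff] at h2
    have hqv : s.tab .queue l₂.length = v := by simpa using h2.2.1
    have hbW := hfr.bounded.var .back
    have hvW : v ≤ W := by rw [← hqv]; exact hB.tab _ _
    rw [List.length_cons] at h1
    rw [hl] at htree
    have hrv : s₁.tab .rest v ≠ 1 → s₁.tab .rest v = 0 := by
      obtain ⟨a, rfl⟩ := exists_fin (htree.mem_Icc (v := v) (by simp))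
      rw [hC.remaining]
      split <;> simp
    simp [h1, hq, hqv, hp, he]
    refine ⟨by omega, hvW, fun h0 => ⟨fun hr => ⟨by omega, by omega, h2.1,
      hC.peel htree h0 hr, by omega⟩, fun hr => ⟨h2.1, ⟨C, hC.keep fun _ => hrv hr⟩, by omega⟩⟩,
      fun h0 => ⟨h2.1, ⟨C, hC.keep fun h => absurd h0 h⟩, by omega⟩⟩
  · rintro s₁ t₁ hfr ⟨h1, h2, h3, h4⟩
    simp [h1]
    rw [List.length_reverse] at h4
    exact ⟨h3, by omega⟩

theorem wp_eraseGrown {G : Lattice} {W : ℕ} {p : Phase} {s : Store} {t : Phase → ℕ}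
    (hB : s.Bounded W) (hW : G.numE + 2 ≤ W) (hG : Incidence G s) :
    Wp W p .eraseGrown (fun s' t' =>
      (∀ e < G.numE, s'.tab .modErased e = if s.tab .support e = 2 then 1 else 0) ∧
      t' p ≤ t p + 10 + 30 * G.numE) s t := by
  rw [Cmd.eraseGrown, wp_seq, wp_set]
  refine ⟨by simp, ?_⟩
  have hB1 : (s.setVar .e (Expr.eval s (.lit 0))).Bounded W := hB.setVar (by simp)
  refine Wp.loop (I := fun s₁ t₁ => s₁.var .e ≤ G.numE ∧
      (∀ e < s₁.var .e, s₁.tab .modErased e = if s.tab .support e = 2 then 1 else 0) ∧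
      t₁ p ≤ t p + 2 + 30 * s₁.var .e) (fun s₁ => G.numE - s₁.var .e) hB1 ?_ ?_ ?_
  · simp
  · rintro s₁ t₁ hfr ⟨h1, h2, h3⟩ hb
    have hsup : s₁.tab .support = s.tab .support := by rw [hfr.tab _ rfl]; simp
    have hE : s₁.var .numE = G.numE := (hG.setVar.frame hfr rfl).numE
    simp [hE] at hb
    have hupd : ∀ k, (s.tab .support (s₁.var .e) = 2 → k = 1) →
        (s.tab .support (s₁.var .e) ≠ 2 → k = 0) → ∀ e ≤ s₁.var .e,
        Function.update (s₁.tab .modErased) (s₁.var .e) k e =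
          if s.tab .support e = 2 then 1 else 0 := by
      intro k hk1 hk0 e he
      rw [Function.update_apply]
      split
      · subst e; split
        exacts [hk1 ‹_›, hk0 ‹_›]
      · exact h2 e (by omega)
    simp [hsup]
    refine ⟨fun h => ⟨by omega, by omega, ⟨by omega, ?_, by omega⟩, by omega⟩,
      fun h => ⟨by omega, ⟨by omega, ?_, by omega⟩, by omega⟩⟩
    · exact hupd 1 (fun _ => rfl) fun h' => absurd h h'
    · exact hupd 0 (fun h' => absurd h' h) fun _ => rfl
  · rintro s₁ t₁ hfr ⟨h1, h2, h3⟩ hb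
    have hE : s₁.var .numE = G.numE := (hG.setVar.frame hfr rfl).numE
    simp [hE] at hb
    refine ⟨fun e he => h2 e (by omega), ?_⟩
    simp; omega

theorem isSpanningForest_treeEdges {G : Lattice} {A : Finset (Fin G.numE)} {g : ℕ → Prop}
    {tp te lab : ℕ → ℕ} {l : List ℕ} {q : ℕ} (hg : ∀ e : Fin G.numE, g e ↔ e ∈ A)
    (htree : TreeOrder G g tp te lab l) (hl : ∀ v ∈ Finset.Icc 1 G.numV, v ∈ l)
    (hex : Explored G g (Finset.Icc 1 G.numV) [] lab q) :
    G.IsSpanningForest A (treeEdges G tp te l) ∧ Labels A lab := by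
  have hsub : treeEdges G tp te l ⊆ A := fun e he => (hg e).1 (htree.treeEdges_ends he).2.2.1
  have hlab : ∀ e ∈ A, lab (G.src e + 1) = lab (G.dst e + 1) := fun e he =>
    hex.edge_eq ((hg e).2 he)
  have hF : Labels (treeEdges G tp te l) lab :=
    labels_of_joined (fun v hv => htree.joined (hl v hv)) fun e he => hlab e (hsub he)
  exact ⟨⟨hsub, htree.acyclic, fun e he => (hF _ _).2 (hlab e he)⟩,
    labels_of_joined (fun v hv => (htree.joined (hl v hv)).mono hsub) hlab⟩

theorem wp_peel {G : Lattice} {σ : Finset (Fin G.numV)} {S : Fin G.numE → ℕ} {W : ℕ} {p : Phase}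
    {s : Store} {t : Phase → ℕ} (hB : s.Bounded W) (hW : G.numV + 2 ≤ W) (hW' : G.numE + 2 ≤ W)
    (hG : Incidence G s)
    (hmod : ∀ e : Fin G.numE, s.tab .modErased e = if S e = 2 then 1 else 0)
    (hsyn : ∀ a : Fin G.numV, s.tab .syn (a + 1) = if a ∈ σ then 1 else 0)
    (hodd : ∀ v, ¬ G.InOddCluster σ S v) :
    Wp W p .peel (fun s' t' =>
      G.IsPeelingCorrection (G.grown S) σ (edgeSet G s' .correction) ∧
      t' p ≤ t p + 60 + 190 * G.numE + 230 * G.numV) s t := by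
  rw [Cmd.peel, wp_seq, wp_set]
  refine ⟨by simp; omega, ?_⟩
  have hB1 : (s.setVar .v (Expr.eval s (.lit 1))).Bounded W := hB.setVar (by simp; omega)
  rw [wp_seq]
  refine (Wp.loop (I := fun s₁ t₁ => 1 ≤ s₁.var .v ∧ s₁.var .v ≤ G.numV + 1 ∧
      (∀ v, 1 ≤ v → v < s₁.var .v → s₁.tab .seen v = 0 ∧ s₁.tab .rest v = s.tab .syn v) ∧
      t₁ p ≤ t p + 2 + 20 * (s₁.var .v - 1))
    (Q := fun s₁ t₁ => (∀ v ∈ Finset.Icc 1 G.numV, s₁.tab .seen v = 0 ∧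
      s₁.tab .rest v = s.tab .syn v) ∧ t₁ p ≤ t p + 10 + 20 * G.numV)
    (fun s₁ => G.numV + 1 - s₁.var .v) hB1 ?_ ?_ ?_).frame hB1 ?_
  · simp; intro v h1 h2; omega
  · rintro s₁ t₁ hfr ⟨h1, h2, h3, h4⟩ hb
    have hsyn₁ : s₁.tab .syn = s.tab .syn := by rw [hfr.tab _ rfl]; simp
    have hV : s₁.var .numV = G.numV := (hG.setVar.frame hfr rfl).numV
    simp [hV] at hb
    have hsW := hB.tab .syn (s₁.var .v)
    simp [hsyn₁]
    refine ⟨hsW, by omega, ⟨by omega, fun v hv hlt => ?_, by omega⟩, by omega⟩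
    simp only [Function.update_apply]
    split
    · simp [*]
    · exact h3 v hv (by omega)
  · rintro s₁ t₁ hfr ⟨h1, h2, h3, h4⟩ hb
    have hV : s₁.var .numV = G.numV := (hG.setVar.frame hfr rfl).numV
    simp [hV] at hb
    refine ⟨fun v hv => ?_, ?_⟩
    · rw [Finset.mem_Icc] at hv
      exact h3 v hv.1 (by omega)
    · simp; omega
  rintro s₂ t₂ hf₂ ⟨h2, ht₂⟩
  have hG₂ : Incidence G s₂ := hG.setVar.frame hf₂ rfl
  rw [wp_seq, wp_set]
  refine ⟨by simp, ?_⟩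
  have hB2 : (s₂.setVar .e (Expr.eval s₂ (.lit 0))).Bounded W := hf₂.bounded.setVar (by simp)
  rw [wp_seq]
  refine (Wp.loop (I := fun s₁ t₁ => s₁.var .e ≤ G.numE ∧
      (∀ e < s₁.var .e, s₁.tab .correction e = 0) ∧ t₁ p ≤ t₂ p + 2 + 20 * s₁.var .e)
    (Q := fun s₁ t₁ => (∀ e < G.numE, s₁.tab .correction e = 0) ∧
      t₁ p ≤ t₂ p + 10 + 20 * G.numE)
    (fun s₁ => G.numE - s₁.var .e) hB2 ?_ ?_ ?_).frame hB2 ?_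
  · simp
  · rintro s₁ t₁ hfr ⟨h1, h3, h4⟩ hb
    have hE : s₁.var .numE = G.numE := (hG₂.setVar.frame hfr rfl).numE
    simp [hE] at hb
    simp
    refine ⟨by omega, ⟨by omega, fun e he => ?_, by omega⟩, by omega⟩
    rw [Function.update_apply]
    split
    · rfl
    · exact h3 e (by omega)
  · rintro s₁ t₁ hfr ⟨h1, h3, h4⟩ hb
    have hE : s₁.var .numE = G.numE := (hG₂.setVar.frame hfr rfl).numE
    simp [hE] at hb
    refine ⟨fun e he => h3 e (by omega), ?_⟩
    simp; omega
  rintro s₃ t₃ hf₃ ⟨h3, ht₃⟩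
  have hG₃ : Incidence G s₃ := hG₂.setVar.frame hf₃ rfl
  rw [wp_seq, wp_set]
  refine ⟨by simp, ?_⟩
  rw [wp_seq, wp_set]
  refine ⟨by simp, ?_⟩
  simp only [Expr.eval, Expr.cost, tick_tick]
  set s₄ : Store := (s₃.setVar .front 0).setVar .back 0 with hs₄
  have hB4 : s₄.Bounded W := (hf₃.bounded.setVar (by omega)).setVar (by omega)
  have hG₄ : Incidence G s₄ := hG₃.setVar.setVar
  have hseen₄ : ∀ v ∈ Finset.Icc 1 G.numV, s₄.tab .seen v = 0 := fun v hv => by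
    rw [hs₄, Store.setVar_tab, Store.setVar_tab, hf₃.tab _ rfl]
    exact (h2 v hv).1
  have hmod₄ : s₄.tab .modErased = s.tab .modErased := by
    rw [hs₄, Store.setVar_tab, Store.setVar_tab, hf₃.tab _ rfl, Store.setVar_tab, hf₂.tab _ rfl,
      Store.setVar_tab]
  have hrest₄ : ∀ a : Fin G.numV, s₄.tab .rest (a + 1) = if a ∈ σ then 1 else 0 := fun a => by
    rw [hs₄, Store.setVar_tab, Store.setVar_tab, hf₃.tab _ rfl, Store.setVar_tab,
      (h2 _ (coe_mem_Icc a)).2, hsyn]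
  have hcorr₄ : ∀ e : Fin G.numE, s₄.tab .correction e = 0 := fun e => by
    rw [hs₄, Store.setVar_tab, Store.setVar_tab, h3 e e.isLt]
  have hfront₄ : s₄.var .front = 0 := by simp [hs₄]
  have hback₄ : s₄.var .back = 0 := by simp [hs₄]
  clear_value s₄
  set t₄ := tick p _ t₃ with ht₄
  suffices H : Wp W p .buildForest (Wp W p .peelForest fun s' t' =>
      G.IsPeelingCorrection (G.grown S) σ (edgeSet G s' .correction) ∧
      t' p ≤ t p + 60 + 190 * G.numE + 230 * G.numV) s₄ t₄ by
    rw [Cmd.buildForest, wp_seq] at H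
    rw [wp_seq]
    refine H.mono fun s' t' h => ?_
    rw [wp_seq]
    exact h
  refine (wp_buildForest hB4 hW hG₄ hseen₄ hfront₄ hback₄).frame hB4 ?_
  rintro s₅ t₅ hf₅ ⟨q, fin, lab, hI, hfin, ht₅⟩
  rw [hmod₄] at hI
  have hQ := hI.queue
  have hback := hI.back
  have htree := hI.tree
  have hnd := hI.nodup
  have hmem := hI.mem
  rw [List.append_nil] at hQ hback htree hnd hmem
  have hlen := length_le_of_nodup hnd hmem
  refine (wp_peelForest hf₅.bounded (by omega) hQ hback htree
    (by rw [hf₅.tab _ rfl]; exact hrest₄) (by rw [hf₅.tab _ rfl]; exact hcorr₄)).mono ?_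
  rintro s₆ t₆ ⟨⟨C, hC⟩, ht₆⟩
  have hg : ∀ e : Fin G.numE, s.tab .modErased e = 1 ↔ e ∈ G.grown S := fun e => by
    rw [hmod]; simp [grown]
  have hl : ∀ v ∈ Finset.Icc 1 G.numV, v ∈ fin.reverse := fun v hv =>
    List.mem_reverse.2 (hfin v hv)
  have hfin' : fin.toFinset = Finset.Icc 1 G.numV := by
    ext v
    rw [List.mem_toFinset]
    exact ⟨hmem v, hfin v⟩
  have hex := hI.explored
  rw [hfin'] at hex
  obtain ⟨hF, hlab⟩ := isSpanningForest_treeEdges hg htree hl hex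
  -- The trees are the components of the grown edges, none of which is odd at the end of the growth.
  -- A label that no syndrome vertex carries has count 0.
  have heven : ∀ r, Even (synCount σ lab r) := by
    intro r
    rw [← Nat.not_odd_iff_even]
    intro ho
    obtain ⟨w, hw⟩ := Finset.card_pos.1 ho.pos
    rw [← (Finset.mem_filter.1 hw).2] at ho
    exact hodd w (hlab.inOddCluster_iff.2 ho)
  have hCeq : edgeSet G s₆ .correction = C := by
    ext e
    simp [edgeSet, hC.correction]
  refine ⟨⟨_, hF, ?_, ?_⟩, ?_⟩
  · rw [hCeq]; exact hC.subset
  · rw [hCeq]; exact hC.syndrome_eq htree hl heven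
  · simp [ht₄] at ht₂ ht₃ ht₅
    omega

/-! ### The decoder -/

section Input

variable {G : Lattice} {ε : Finset (Fin G.numE)} {σ : Finset (Fin G.numV)}

theorem inputStore_bounded {W : ℕ} (hV : G.numV + 1 ≤ W) (hE : G.numE ≤ W) :
    (inputStore G ε σ).Bounded W := by
  constructor
  · intro x
    cases x <;> simp only [inputStore] <;> omega
  · intro a i
    cases a <;> simp only [inputStore] <;> try omega
    · split
      · have := (G.src ⟨i, ‹_›⟩).isLt; omega
      · omega
    · split
      · have := (G.dst ⟨i, ‹_›⟩).isLt; omega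
      · omega
    · split <;> omega
    · split <;> omega

theorem inputStore_syn (a : Fin G.numV) :
    (inputStore G ε σ).tab .syn (a + 1) = if a ∈ σ then 1 else 0 := by
  simp [inputStore, Fin.val_inj]

theorem inputStore_erased (e : Fin G.numE) :
    (inputStore G ε σ).tab .erased e = if e ∈ ε then 1 else 0 := by
  simp [inputStore, Fin.val_inj]

end Input

/-- The number of levels `A` is free here, subject only to h_A(1) exceeding all ranks. In the bound
for the boundary lists, 560 = 100 + 2 · 230 collects the initial listed weight and the growth
potential. -/
theorem wp_unionFindDecoder {G : Lattice} {ε E : Finset (Fin G.numE)} {W A : ℕ}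
    (hW : G.numV + 2 ≤ W) (hW' : 2 * G.numE + 2 ≤ W) (hA : Nat.log 2 G.numV < hierarchy A 1) :
    Wp W .initialization .unionFindDecoder (fun s t =>
      G.IsValidatedErasure ε (G.syndrome E) (edgeSet G s .modErased) ∧
      G.IsPeelingCorrection (edgeSet G s .modErased) (G.syndrome E) (edgeSet G s .correction) ∧
      t .initialization ≤ 50 + 420 * G.numE + 290 * G.numV ∧
      t .growth ≤ 3 + 313 * (2 * (2 * G.numE + G.numV)) ∧
      t .boundaryLists ≤ 560 * (2 * G.numE + G.numV) ∧
      t .peeling ≤ 70 + 220 * G.numE + 230 * G.numV ∧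
      t .unionFind ≤ 18 * (A * G.numV) + (72 * A + 137) * (2 * (2 * G.numE + G.numV)))
      (inputStore G ε (G.syndrome E)) 0 := by
  set σ := G.syndrome E with hσ
  set s := inputStore G ε σ with hs
  have hB : s.Bounded W := inputStore_bounded (by omega) (by omega)
  rw [Cmd.unionFindDecoder, wp_seq, wp_charge, wp_seq]
  refine (wp_initTables hB (by omega) hW' rfl rfl rfl rfl).frame hB ?_
  rintro s₁ t₁ hf₁ ⟨hG₁, h1, hsup₁, ht₁⟩
  have hsyn₁ : s₁.tab .syn = s.tab .syn := hf₁.tab _ rfl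
  refine (wp_initClusters (σ := σ) hf₁.bounded hW hG₁ ?_ h1 ?_).frame hf₁.bounded ?_
  · intro v
    rw [hsyn₁, hs, inputStore_syn]
    simp
  · intro v _
    rw [hf₁.tab _ rfl, hs]
    rfl
  rintro s₂ t₂ hf₂ ⟨R, B, L, hI, ht₂⟩
  have hG₂ : Incidence G s₂ := hG₁.frame hf₂ rfl
  set S := G.initialGrowth ε with hS
  have hS₁ : ∀ e : Fin G.numE, s₁.tab .support e = S e := fun e => by
    rw [hsup₁ e e.isLt, hs, inputStore_erased, hS, initialGrowth]
    by_cases he : e ∈ ε <;> simp [he]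
  have hgrown : (Finset.univ.filter fun e : Fin G.numE => s₁.tab .support e = 2) = G.grown S := by
    simp only [hS₁, grown]
  rw [hgrown] at hI
  have hS₂ : ∀ e : Fin G.numE, s₂.tab .support e = S e := fun e => by rw [hf₂.tab _ rfl, hS₁]
  have hrep := hI.represents hG₂ hS₂ fun e => by rw [hS, initialGrowth]; split <;> omega
  rw [wp_seq, wp_charge]
  refine (wp_growthLoop (A := A) hf₂.bounded hW (by omega) hA hrep).frame hf₂.bounded ?_
  rintro s₃ t₃ hf₃ ⟨k, ρ, B', h3, hg₃, hu₃, hb₃⟩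
  rw [wp_charge, wp_seq]
  refine (wp_eraseGrown hf₃.bounded (by omega) h3.incidence).frame hf₃.bounded ?_
  rintro s₄ t₄ hf₄ ⟨h4, ht₄⟩
  have hG₄ : Incidence G s₄ := h3.incidence.frame hf₄ rfl
  set S' := (G.growRound σ)^[k] S with hS'
  have hmod : ∀ e : Fin G.numE, s₄.tab .modErased e = if S' e = 2 then 1 else 0 := fun e => by
    rw [h4 e e.isLt, h3.support]
  have hodd : ∀ v, ¬ G.InOddCluster σ S' v := fun v hv => by
    simpa using (h3.inOddCluster_iff v).1 hv
  refine (wp_peel (σ := σ) (S := S') hf₄.bounded hW (by omega) hG₄ hmod ?_ hodd).frame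
    hf₄.bounded ?_
  · intro a
    rw [hf₄.tab _ rfl, hf₃.tab _ rfl, hf₂.tab _ rfl, hsyn₁, hs, inputStore_syn]
  rintro s₅ t₅ hf₅ ⟨h5, ht₅⟩
  have hmod₅ : edgeSet G s₅ .modErased = G.grown S' := by
    ext e
    simp [edgeSet, grown, hf₅.tab .modErased rfl, hmod]
  rw [hmod₅]
  have hΨ := growthPotential_le (G := G) (s₂.tab .support)
  have hΦ := hI.forest.totalPotential_le A
  have hlist := listedWeight_le (G := G) (s₂.tab .parent) B
  have hi₅ : t₅ .initialization = t₂ .initialization := by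
    rw [hf₅.time _ rfl, hf₄.time _ rfl, hf₃.time _ rfl]
  have hg₅ : t₅ .growth = t₃ .growth := by rw [hf₅.time _ rfl, hf₄.time _ rfl]
  have hb₅ : t₅ .boundaryLists = t₃ .boundaryLists := by rw [hf₅.time _ rfl, hf₄.time _ rfl]
  have hu₅ : t₅ .unionFind = t₃ .unionFind := by rw [hf₅.time _ rfl, hf₄.time _ rfl]
  have hp₃ : t₃ .peeling = 0 := by rw [hf₃.time _ rfl, hf₂.time _ rfl, hf₁.time _ rfl]; rfl
  have hg₂ : t₂ .growth = 0 := by rw [hf₂.time _ rfl, hf₁.time _ rfl]; rfl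
  have hb₂ : t₂ .boundaryLists = 0 := by rw [hf₂.time _ rfl, hf₁.time _ rfl]; rfl
  have hu₂ : t₂ .unionFind = 0 := by rw [hf₂.time _ rfl, hf₁.time _ rfl]; rfl
  rw [Pi.zero_apply] at ht₁
  refine ⟨⟨k, hodd, rfl⟩, h5, by omega, by omega, by omega, by omega, ?_⟩
  have := Nat.mul_le_mul_left (72 * A + 137) hΨ
  omega

end UFDecoder

/-! ### The main theorem. -/

theorem mainTheorem2 :
    ∃ K n₀ : ℕ, ∀ (G : UFDecoder.Lattice) (ε E_Z : Finset (Fin G.numE)),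
      G.NoIsolatedVertex → 0 < G.numE →
      ∃ (t : UFDecoder.Phase → ℕ) (out : UFDecoder.Store),
        -- the decoder terminates, with words of `log₂ n + O(1)` bits
        UFDecoder.Exec (K * G.numE) .initialization UFDecoder.Cmd.unionFindDecoder
          (UFDecoder.inputStore G ε (G.syndrome E_Z)) t out ∧
        -- its output is the modified erasure and a peeling correction with the given syndrome
        G.IsValidatedErasure ε (G.syndrome E_Z) (UFDecoder.edgeSet G out .modErased) ∧
        G.IsPeelingCorrection (UFDecoder.edgeSet G out .modErased) (G.syndrome E_Z)
          (UFDecoder.edgeSet G out .correction) ∧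
        -- everything except `Find` and `Union` takes linear time in total
        t .initialization ≤ K * G.numE ∧
        t .growth ≤ K * G.numE ∧
        t .boundaryLists ≤ K * G.numE ∧
        t .peeling ≤ K * G.numE ∧
        -- the total running time is `O(n α(n))`
        (n₀ ≤ G.numE → ∑ p, t p ≤ K * (G.numE * inverseAckermann G.numE)) := by
  -- The value of K is generous: it exceeds the sum of all constants below, and Kn also bounds the
  -- numbers |V| + 2 and 2n + 2 required of the word size. The threshold 257 makes α(n) at least 1.
  refine ⟨20000, 257, fun G ε E_Z hiso hn => ?_⟩
  have hV := hiso.numV_le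
  obtain ⟨t, out, hexec, h1, h2, h3, h4, h5, h6, h7⟩ :=
    UFDecoder.wp_unionFindDecoder (ε := ε) (E := E_Z) (W := 20000 * G.numE)
      (A := inverseAckermann G.numE + 3) (by omega) (by omega) (UFDecoder.log_lt_hierarchy hV)
  rw [zero_add] at h3 h4 h5 h6 h7
  refine ⟨t, out, hexec, h1, h2, by omega, by omega, by omega, by omega, fun hn₀ => ?_⟩
  -- With α ≥ 1 the linear terms are absorbed by n α, and α + 3 ≤ 4α. Together with |V| ≤ 2n this
  -- gives the factor 8 in `e1`; in `e2` it comes from 2(2n + |V|) ≤ 8n.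
  have hα := UFDecoder.one_le_inverseAckermann hn₀
  have hsum : ∑ p, t p = t .initialization + t .growth + t .unionFind + t .boundaryLists +
      t .peeling := by
    have : (Finset.univ : Finset UFDecoder.Phase) =
        {.initialization, .growth, .unionFind, .boundaryLists, .peeling} := rfl
    rw [this]
    simp [add_assoc]
  set n := G.numE
  set α := inverseAckermann n
  have hnα : n ≤ n * α := Nat.le_mul_of_pos_right n hα
  have e1 : (α + 3) * G.numV ≤ 8 * (n * α) := by nlinarith
  have e2 : (72 * (α + 3) + 137) * (2 * (2 * n + G.numV)) ≤ (72 * (α + 3) + 137) * (8 * n) :=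
    Nat.mul_le_mul_left _ (by omega)
  have e3 : (72 * (α + 3) + 137) * (8 * n) = 576 * (n * α) + 2824 * n := by ring
  omega
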